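/- **Setting.** Let $n\ge 2$ nodes hold differentiable functions $f_1,\dots,f_n:\mathbb R^d\to\mathbb R$, and let $f=\frac1n\sum_i f_i$. Let $A\in\mathbb R^{n\times n}$ be row-stochastic and $B\in\mathbb R^{n\times n}$ column-stochastic. Stochastic Push-Pull with step size $\alpha>0$ starts from $x_1^{(0)}=\dots=x_n^{(0)}=x^{(0)}$ (deterministic), $\mathbf y^{(0)}=\mathbf g^{(0)}$, and iterates $$\mathbf x^{(t+1)}=A\mathbf x^{(t)}-\alpha\mathbf y^{(t)},\qquad \mathbf y^{(t+1)}=B\mathbf y^{(t)}+\mathbf g^{(t+1)}-\mathbf g^{(t)},$$ where the $i$-th row of the $n\times d$ matrix $\mathbf g^{(t)}$ is the stochastic gradient $g_i^{(t)}=\nabla F_i(x_i^{(t)};\xi_i^{(t)})$. **Exponential decay property.** There are entrywise positive $\pi_A,\pi_B\in\mathbb R^n$ with $\pi_A^\top A=\pi_A^\top$, $B\pi_B=\pi_B$, $\|\pi_A\|_1=\|\pi_B\|_1=1$, and, with $A_\infty=\mathbb 1\pi_A^\top$ and $B_\infty=\pi_B\mathbb 1^\top$, there are $p_A,p_B>0$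 and $\lambda_A,\lambda_B\in[0,1)$ such that $\|A^t-A_\infty\|_2\le p_A\lambda_A^t$ and $\|B^t-B_\infty\|_2\le p_B\lambda_B^t$ for all $t\ge0$. This property holds whenever $A$ and $B$ have positive trace and their underlying digraphs are strongly connected. When it holds, put $\hat x^{(t)}=\pi_A^\top\mathbf x^{(t)}$, $c=n\,\pi_A^\top\pi_B$, and $$s_A=\max\Big\{\sum_{i\ge0}\|A^i-A_\infty\|_2,\ \sum_{i\ge0}\|A^i-A_\infty\|_2^2\Big\},$$ let $s_B$ be defined in the same way from $B,B_\infty$, and let $s_{A^m}$, $s_{B^m}$ be defined in the same way with $A^m$, $B^m$ in place of $A$, $B$. Put $$C_m=\max\Big\{\tfrac{s_A^2}{n},\ \tfrac{20ns_As_{A^m}}{c^2},\ \tfrac{n^2s_B^2}{c^2},\ \tfrac{30s_B^2s_{B^m}}{c^2},\ \tfrac{n^2(8s_A^2s_B+2ns_B+2s_As_B+\sqrt n\,s_B)}{c^2},\ \tfrac{20n^3s_As_{A^m}s_Bs_{B^m}}{c^2}\Big\},$$ $$C_{\Delta,1}=\frac{10s_As_{A^m}^2n^2+312s_B^2s_{B^m}n}{c^2}.$$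 **Assumptions.** (i) $A,B$ have the exponential decay property. (ii) For constants $L,\Delta>0$ and all $i$: $\|\nabla f_i(x)-\nabla f_i(y)\|\le L\|x-y\|$ for all $x,y$, and $f_i$ is bounded below with $f_i(x^{(0)})-\inf f_i\le\Delta$. (iii) For a constant $\sigma\ge0$ and a filtration $(\mathcal F_t)$ such that $\mathcal F_t$ contains the information of all stochastic gradients of iterations before $t$: $\mathbb E[g_i^{(t)}\mid\mathcal F_t]=\nabla f_i(x_i^{(t)})$, $\mathbb E[\|g_i^{(t)}-\nabla f_i(x_i^{(t)})\|^2\mid\mathcal F_t]\le\sigma^2$, and for $i\ne j$ the stochastic gradients $g_i^{(t)}$ and $g_j^{(t)}$ are conditionally independent given $\mathcal F_t$, for all $t\ge 0$. **Theorem 1.** Let $m,K$ be positive integers and $T=mK$. (1) If $\alpha\le\frac{1}{10cm\sqrt{s_Bs_{B^m}^2}\,L}$ and $m\ge C_m$, then $$\frac1K\sum_{k\in\{0,m,\dots,(K-1)m\}}\mathbb E\|\nabla f(\hat x^{(k)})\|^2\le\frac{4\Delta}{c\alpha T}+\frac{100c\alpha L}{n}\sigma^2+\frac{384s_B^3s_{B^m}^2}{m^2c^2}\sigma^2+C_{\Delta,1}\frac{L\Delta}{mT}.$$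 (2) Put $M=\max\{4c^{-1}s_B^{1.5}s_{B^m}(\frac{nT\sigma^2}{L\Delta})^{1/4},\,C_m\}$. If $m\ge M$ (in particular, if $m=\lceil M\rceil$) and $$\alpha=\min\Big\{\frac{\sqrt{n\Delta}}{10c\,\sigma\sqrt{LT}},\ \frac1{10cm\sqrt{s_Bs_{B^m}^2}\,L},\ \frac1{6L}\Big\}$$ (the first entry being $+\infty$ if $\sigma=0$), then $$\min_{0\le t<T}\mathbb E\|\nabla f(\hat x^{(t)})\|^2\le\frac{44\sigma\sqrt{L\Delta}}{\sqrt{nT}}+\frac{L\Delta\big(m^{-1}C_{\Delta,1}+40m\sqrt{s_Bs_{B^m}^2}+24c^{-1}\big)}{T}.$$ (3) Moreover, there are constants $C_1,C_2$ depending only on $n,A,B,\pi_A,\pi_B$ such that, if in (2) also $m\le\lceil \overline M\rceil$, where $\overline M$ is $M$ with $s_{A^m},s_{B^m}$ replaced by $s_A,s_B$ (in particular, if $m=\lceil M\rceil$), then $$\min_{0\le t<T}\mathbb E\|\nabla f(\hat x^{(t)})\|^2\le\frac{44\sigma\sqrt{L\Delta}}{\sqrt{nT}}+C_1\sqrt\sigma\Big(\frac{L\Delta}{T}\Big)^{3/4}+C_2\frac{L\Delta}{T}.$$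 That is, the leading term has linear speedup in $n$, on arbitrary strongly connected digraphs. All the expectations above are finite. -/

import Mathlib

open MeasureTheory ProbabilityTheory
open scoped BigOperators

noncomputable section

namespace PushPull

/-- The spectral norm `‖M‖₂ = max_{‖v‖ = 1} ‖M v‖` of a square real matrix. -/
def specNorm {n : ℕ} (M : Matrix (Fin n) (Fin n) ℝ) : ℝ :=
  ‖Matrix.toEuclideanCLM (n := Fin n) (𝕜 := ℝ) M‖

/-- `A_∞ = 𝟙 π_Aᵀ`. -/
def rowLimit {n : ℕ} (πA : Fin n → ℝ) : Matrix (Fin n) (Fin n) ℝ :=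
  Matrix.of fun _ j => πA j

/-- `B_∞ = π_B 𝟙ᵀ`. -/
def colLimit {n : ℕ} (πB : Fin n → ℝ) : Matrix (Fin n) (Fin n) ℝ :=
  Matrix.of fun i _ => πB i

/-- `‖Mᵗ - M_∞‖₂ ≤ p λᵗ` for all `t ≥ 0`, with some `p > 0` and `λ ∈ [0, 1)`. -/
def DecaysTo {n : ℕ} (M Minf : Matrix (Fin n) (Fin n) ℝ) : Prop :=
  ∃ p lam : ℝ, 0 < p ∧ 0 ≤ lam ∧ lam < 1 ∧ ∀ t : ℕ, specNorm (M ^ t - Minf) ≤ p * lam ^ t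

/-- The exponential decay property of a pair of weight matrices: `A` is row-stochastic, `B` is
column-stochastic, `π_A` and `π_B` are entrywise positive Perron vectors of `ℓ₁`-norm one, and the
powers of `A` and `B` converge geometrically to `A_∞` and `B_∞`. -/
structure ExpDecay {n : ℕ} (A B : Matrix (Fin n) (Fin n) ℝ) (πA πB : Fin n → ℝ) : Prop where
  rowStochastic_A : A ∈ Matrix.rowStochastic ℝ (Fin n)
  colStochastic_B : B ∈ Matrix.colStochastic ℝ (Fin n)
  pos_A : ∀ i, 0 < πA i
  pos_B : ∀ i, 0 < πB i
  sum_A : ∑ i, πA i = 1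
  sum_B : ∑ i, πB i = 1
  perron_A : Matrix.vecMul πA A = πA
  perron_B : Matrix.mulVec B πB = πB
  decay_A : DecaysTo A (rowLimit πA)
  decay_B : DecaysTo B (colLimit πB)

/-- `max {∑ᵢ ‖Mⁱ - M_∞‖₂, ∑ᵢ ‖Mⁱ - M_∞‖₂²}`; it gives `s_A`, `s_B`, and also `s_{A^m}`, `s_{B^m}`
when `M` is taken to be `A ^ m`, `B ^ m`. -/
def mixSum {n : ℕ} (M Minf : Matrix (Fin n) (Fin n) ℝ) : ℝ :=
  max (∑' i : ℕ, specNorm (M ^ i - Minf)) (∑' i : ℕ, specNorm (M ^ i - Minf) ^ 2)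

/-- `c = n π_Aᵀ π_B`. -/
def cConst {n : ℕ} (πA πB : Fin n → ℝ) : ℝ := (n : ℝ) * ∑ i, πA i * πB i

/-- The threshold `C_m` on the block length, with `sAm`, `sBm` standing for `s_{A^m}`, `s_{B^m}`. -/
def blockThreshold (n : ℕ) (c sA sAm sB sBm : ℝ) : ℝ :=
  max ((n : ℝ)⁻¹ * sA ^ 2) <|
  max (20 * (c ^ 2)⁻¹ * n * sA * sAm) <|
  max ((c ^ 2)⁻¹ * (n : ℝ) ^ 2 * sB ^ 2) <|
  max (30 * (c ^ 2)⁻¹ * sB ^ 2 * sBm) <|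
  max ((c ^ 2)⁻¹ * (n : ℝ) ^ 2 *
      (8 * sA ^ 2 * sB + 2 * n * sB + 2 * sA * sB + Real.sqrt n * sB))
    (20 * (c ^ 2)⁻¹ * (n : ℝ) ^ 3 * sA * sAm * sB * sBm)

/-- The constant `C_{Δ,1}`. -/
def deltaConst (n : ℕ) (c sA sAm sB sBm : ℝ) : ℝ :=
  (10 * sA * sAm ^ 2 * (n : ℝ) ^ 2 + 312 * sB ^ 2 * sBm * n) / c ^ 2

/-- The lower bound on the block length in the tuned choice of parameters:
`max {4 c⁻¹ s_B^{3/2} s_{B^m} (n T σ² / (L Δ))^{1/4}, C_m}`. -/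
def tunedBlock (n : ℕ) (c sA sAm sB sBm σ L Δ T : ℝ) : ℝ :=
  max (4 * c⁻¹ * sB ^ (3 / 2 : ℝ) * sBm * ((n : ℝ) * T * σ ^ 2 / (L * Δ)) ^ (1 / 4 : ℝ))
    (blockThreshold n c sA sAm sB sBm)

/-- The tuned step size: the minimum of `√(n Δ) / (10 c σ √(L T))`,
`1 / (10 c m √(s_B s_{B^m}²) L)` and `1 / (6 L)`, the first of which is `+∞` for `σ = 0`. -/
def tunedStep (n : ℕ) (c sB sBm σ L Δ T : ℝ) (m : ℕ) : ℝ :=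
  if σ = 0 then
    min (1 / (10 * c * m * Real.sqrt (sB * sBm ^ 2) * L)) (1 / (6 * L))
  else
    min (Real.sqrt (n * Δ) / (10 * c * σ * Real.sqrt (L * T)))
      (min (1 / (10 * c * m * Real.sqrt (sB * sBm ^ 2) * L)) (1 / (6 * L)))

section Algorithm

variable {n d : ℕ} {S : Fin n → Type*}

/-- The pair `(x⁽ᵗ⁾, y⁽ᵗ⁾)` of stochastic Push-Pull along a sequence `s` of samples (`s t i` is drawn
by node `i` at iteration `t`), where `G i x s` is the stochastic gradient `∇F_i(x; s)`:
`x⁽⁰⁾ = 𝟙 x0ᵀ`, `y⁽⁰⁾ = g⁽⁰⁾`, `x⁽ᵗ⁺¹⁾ = A x⁽ᵗ⁾ - α y⁽ᵗ⁾`,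
`y⁽ᵗ⁺¹⁾ = B y⁽ᵗ⁾ + g⁽ᵗ⁺¹⁾ - g⁽ᵗ⁾`, and row `i` of `g⁽ᵗ⁾` is `G i (x_i⁽ᵗ⁾) (s t i)`. -/
def iter (A B : Matrix (Fin n) (Fin n) ℝ) (α : ℝ)
    (G : (i : Fin n) → EuclideanSpace ℝ (Fin d) → S i → EuclideanSpace ℝ (Fin d))
    (x0 : EuclideanSpace ℝ (Fin d)) (s : ℕ → (i : Fin n) → S i) :
    ℕ → (Fin n → EuclideanSpace ℝ (Fin d)) × (Fin n → EuclideanSpace ℝ (Fin d))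
  | 0 => (fun _ => x0, fun i => G i x0 (s 0 i))
  | t + 1 =>
    let x := (iter A B α G x0 s t).1
    let y := (iter A B α G x0 s t).2
    let x' : Fin n → EuclideanSpace ℝ (Fin d) := fun i => (∑ j, A i j • x j) - α • y i
    (x', fun i => (∑ j, B i j • y j) + G i (x' i) (s (t + 1) i) - G i (x i) (s t i))

variable {Ω : Type*}

/-- The local variable `x_i⁽ᵗ⁾` as a random vector, for random samples `ξ t i`. -/
def xNode (A B : Matrix (Fin n) (Fin n) ℝ) (α : ℝ)
    (G : (i : Fin n) → EuclideanSpace ℝ (Fin d) → S i → EuclideanSpace ℝ (Fin d))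
    (x0 : EuclideanSpace ℝ (Fin d)) (ξ : ℕ → (i : Fin n) → Ω → S i)
    (t : ℕ) (i : Fin n) (ω : Ω) : EuclideanSpace ℝ (Fin d) :=
  (iter A B α G x0 (fun u j => ξ u j ω) t).1 i

/-- The stochastic gradient `∇F_i(x_i⁽ᵗ⁾; ξ_i⁽ᵗ⁾)` as a random vector. -/
def gNode (A B : Matrix (Fin n) (Fin n) ℝ) (α : ℝ)
    (G : (i : Fin n) → EuclideanSpace ℝ (Fin d) → S i → EuclideanSpace ℝ (Fin d))
    (x0 : EuclideanSpace ℝ (Fin d)) (ξ : ℕ → (i : Fin n) → Ω → S i)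
    (t : ℕ) (i : Fin n) (ω : Ω) : EuclideanSpace ℝ (Fin d) :=
  G i (xNode A B α G x0 ξ t i ω) (ξ t i ω)

/-- `x̂⁽ᵗ⁾ = π_Aᵀ x⁽ᵗ⁾`. -/
def xHat (A B : Matrix (Fin n) (Fin n) ℝ) (πA : Fin n → ℝ) (α : ℝ)
    (G : (i : Fin n) → EuclideanSpace ℝ (Fin d) → S i → EuclideanSpace ℝ (Fin d))
    (x0 : EuclideanSpace ℝ (Fin d)) (ξ : ℕ → (i : Fin n) → Ω → S i)
    (t : ℕ) (ω : Ω) : EuclideanSpace ℝ (Fin d) :=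
  ∑ i, πA i • xNode A B α G x0 ξ t i ω

end Algorithm

section Assumptions

variable {n d : ℕ}

/-- The global objective `f = (1/n) ∑ᵢ f_i`. -/
def avgFun (f : Fin n → EuclideanSpace ℝ (Fin d) → ℝ) (x : EuclideanSpace ℝ (Fin d)) : ℝ :=
  (1 / (n : ℝ)) * ∑ i, f i x

/-- Each `f_i` is differentiable with `L`-Lipschitz gradient, bounded below, and
`f_i(x0) - inf f_i ≤ Δ`. -/
structure Smooth (f : Fin n → EuclideanSpace ℝ (Fin d) → ℝ) (x0 : EuclideanSpace ℝ (Fin d))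
    (L Δ : ℝ) : Prop where
  differentiable : ∀ i, Differentiable ℝ (f i)
  lipschitz : ∀ i x y, ‖gradient (f i) x - gradient (f i) y‖ ≤ L * ‖x - y‖
  bddBelow : ∀ i, BddBelow (Set.range (f i))
  gap : ∀ i, f i x0 - ⨅ x, f i x ≤ Δ

/-- `X` and `Y` are conditionally independent given the σ-algebra `m`. -/
def CondIndepGiven {Ω E : Type*} [MeasurableSpace E]
    (m : MeasurableSpace Ω) {mΩ : MeasurableSpace Ω} (μ : Measure Ω) (X Y : Ω → E) : Prop :=
  ∀ U V : Set E, MeasurableSet U → MeasurableSet V →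
    μ⟦X ⁻¹' U ∩ Y ⁻¹' V | m⟧ =ᵐ[μ] μ⟦X ⁻¹' U | m⟧ * μ⟦Y ⁻¹' V | m⟧

/-- The stochastic gradients `g t i`, evaluated at the local variables `x t i`, are unbiased with
variance at most `σ²` and independent across nodes, conditionally on `ℱ t`. The filtration is such
that `ℱ t` contains the information of the stochastic gradients of all iterations before `t`. -/
structure GradientOracle {Ω : Type*} {mΩ : MeasurableSpace Ω} (μ : Measure Ω)
    (ℱ : Filtration ℕ mΩ) (f : Fin n → EuclideanSpace ℝ (Fin d) → ℝ)
    (x g : ℕ → Fin n → Ω → EuclideanSpace ℝ (Fin d)) (σ : ℝ) : Prop where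
  measurable : ∀ t i, StronglyMeasurable[ℱ (t + 1)] (g t i)
  memLp : ∀ t i, MemLp (fun ω => g t i ω - gradient (f i) (x t i ω)) 2 μ
  unbiased : ∀ t i, μ[g t i | ℱ t] =ᵐ[μ] fun ω => gradient (f i) (x t i ω)
  variance : ∀ t i,
    μ[fun ω => ‖g t i ω - gradient (f i) (x t i ω)‖ ^ 2 | ℱ t] ≤ᵐ[μ] fun _ => σ ^ 2
  indep : ∀ t i j, i < j → CondIndepGiven (ℱ t) μ (g t i) (g t j)

end Assumptions

end PushPull

end

/-!
Convergence of stochastic Push-Pull, by comparing the run with exact gradient descent on the average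
objective, one step per block of `m` iterations.

Existence of the weights. An irreducible stochastic matrix with positive trace has an entrywise
positive power, and averaging with weights at least `δ` contracts oscillations by `1 - δ`
(`osc_mulVec_le`), so the rows of its powers converge geometrically to a common positive vector
(`exists_perron`). The column-stochastic case is the transpose.

Expectations as Hilbert space geometry. The iterates are regarded as vectors with entries in
`H = L²(Ω; ℝᵈ)`, on which the weight matrices act with their spectral norm
(`norm_matrix_smul_le`). Unbiasedness, the variance bound and conditional independence then say
precisely that the noise vectors at distinct times or nodes are orthogonal and of length at most `σ`,
and that they are orthogonal to what was known before (`Recursion.inner_noise_eq_zero`,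
`integral_inner_centered_eq_zero`). `Recursion.system` collects this in the structure `System`; what
follows is deterministic.

One block as a gradient step. Since `π_Aᵀ A = π_Aᵀ`, only the cumulated trackers `∑ y⁽ᵘ⁾` move
`x̂ = π_Aᵀ x`, and since `Bⁱ → π_B 𝟙ᵀ`, over the block from `k m` to `(k + 1) m` they amount to
`c m ∇f(x̂)` plus a residual plus the noise drawn inside the block (`System.pair_block_eq`). This
fresh noise has mean square about `2 m c² σ² / n` and is orthogonal to the gradient at the start of
the block, so that it enters the descent inequality to second order only (`System.block_descent`);
the noise drawn earlier enters through differences of powers of `B`, hence with a bounded mean square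
no matter how long the block is (`norm_staleNoise_sq_le`).

Closing the estimates. The residual is controlled by the drift of `x̂` within blocks and by the
consensus error, which in turn are convolutions of gradients and of themselves with the summable
sequences `‖Aⁱ - A_∞‖` and `‖Bⁱ - B_∞‖`. Taking `ℓ²` norms over the blocks, Young's inequality
(`l2_conv_le`) turns this into a linear system of inequalities (`System.l2_drift_le`,
`System.l2_consensus_le`, `System.l2_residual_le`) with coefficients that the conditions `m ≥ C_m` and
`α ≤ 1 / (10 c m √(s_B s_{B^m}²) L)` make small; it is solved in `residual_le_of_system` and combined
with the descent inequality in `System.sum_gradient_sq_le`. The rates follow by inserting the tuned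
parameters (`tuned_terms_le`, `tuned_rate_le`).
-/

namespace PushPull

/-! ### The spectral norm -/

section SpecNorm

open scoped Matrix.Norms.L2Operator

variable {n : ℕ} (M N : Matrix (Fin n) (Fin n) ℝ)

theorem specNorm_eq_norm : specNorm M = ‖M‖ := rfl

theorem specNorm_nonneg : 0 ≤ specNorm M := norm_nonneg _

theorem specNorm_sub_le : specNorm (M - N) ≤ specNorm M + specNorm N := by
  simpa only [specNorm_eq_norm] using norm_sub_le M N

theorem specNorm_mul_le : specNorm (M * N) ≤ specNorm M * specNorm N := by
  simpa only [specNorm_eq_norm] using norm_mul_le M N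

theorem specNorm_transpose : specNorm M.transpose = specNorm M := by
  have h := Matrix.l2_opNorm_conjTranspose M
  rwa [Matrix.conjTranspose_eq_transpose_of_trivial] at h

theorem specNorm_one_le : specNorm (1 : Matrix (Fin n) (Fin n) ℝ) ≤ 1 := by
  unfold specNorm
  rw [map_one]
  exact ContinuousLinearMap.norm_id_le

theorem sum_mulVec_sq_le (v : Fin n → ℝ) :
    ∑ i, (M.mulVec v) i ^ 2 ≤ specNorm M ^ 2 * ∑ i, v i ^ 2 := by
  have h := Matrix.l2_opNorm_mulVec M (WithLp.toLp 2 v)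
  have h2 := pow_le_pow_left₀ (norm_nonneg _) h 2
  rw [mul_pow, EuclideanSpace.norm_sq_eq, EuclideanSpace.norm_sq_eq] at h2
  simpa [specNorm_eq_norm] using h2

theorem sum_vecMul_sq_le (v : Fin n → ℝ) :
    ∑ i, (Matrix.vecMul v M) i ^ 2 ≤ specNorm M ^ 2 * ∑ i, v i ^ 2 := by
  have h := sum_mulVec_sq_le M.transpose v
  rwa [Matrix.mulVec_transpose, specNorm_transpose] at h

theorem sum_sq_le_specNorm : ∑ i, ∑ j, M i j ^ 2 ≤ n * specNorm M ^ 2 := by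
  have h : ∀ i, ∑ j, M i j ^ 2 ≤ specNorm M ^ 2 := fun i => by
    have := sum_vecMul_sq_le M (Pi.single i 1)
    simpa [Matrix.single_one_vecMul, Pi.single_apply, ite_pow] using this
  calc ∑ i, ∑ j, M i j ^ 2 ≤ ∑ _i : Fin n, specNorm M ^ 2 := Finset.sum_le_sum fun i _ => h i
    _ = n * specNorm M ^ 2 := by simp

theorem specNorm_sq_le_sum_sq : specNorm M ^ 2 ≤ ∑ i, ∑ j, M i j ^ 2 := by
  have hS : 0 ≤ ∑ i, ∑ j, M i j ^ 2 := Finset.sum_nonneg fun i _ =>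
    Finset.sum_nonneg fun j _ => sq_nonneg _
  have : specNorm M ≤ Real.sqrt (∑ i, ∑ j, M i j ^ 2) := by
    refine ContinuousLinearMap.opNorm_le_bound _ (Real.sqrt_nonneg _) fun x => ?_
    refine le_of_sq_le_sq ?_ (by positivity)
    rw [mul_pow, Real.sq_sqrt hS, EuclideanSpace.norm_sq_eq, EuclideanSpace.norm_sq_eq,
      Finset.sum_mul]
    refine Finset.sum_le_sum fun i _ => ?_
    rw [Matrix.ofLp_toEuclideanCLM, Real.norm_eq_abs, sq_abs]
    simpa [Matrix.mulVec, dotProduct] using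
      Finset.sum_mul_sq_le_sq_mul_sq Finset.univ (M i) (fun j => x j)
  calc specNorm M ^ 2 ≤ Real.sqrt (∑ i, ∑ j, M i j ^ 2) ^ 2 :=
        pow_le_pow_left₀ (specNorm_nonneg M) this 2
    _ = _ := Real.sq_sqrt hS

/-- A nonzero idempotent has spectral norm at least one. -/
theorem one_le_specNorm_of_idempotent (h : M * M = M) (h0 : M ≠ 0) : 1 ≤ specNorm M := by
  have hpos : 0 < specNorm M := by
    rw [specNorm_eq_norm]; exact norm_pos_iff.mpr h0
  have := specNorm_mul_le M M
  rw [h] at this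
  nlinarith

theorem specNorm_sq_le_card_of_rowStochastic (h : M ∈ Matrix.rowStochastic ℝ (Fin n)) :
    specNorm M ^ 2 ≤ n := by
  refine (specNorm_sq_le_sum_sq M).trans ?_
  calc ∑ i, ∑ j, M i j ^ 2 ≤ ∑ i, ∑ j, M i j := by
        refine Finset.sum_le_sum fun i _ => Finset.sum_le_sum fun j _ => ?_
        have h0 := Matrix.nonneg_of_mem_rowStochastic h (i := i) (j := j)
        have h1 := Matrix.le_one_of_mem_rowStochastic h (i := i) (j := j)
        nlinarith
    _ = n := by simp [Matrix.sum_row_of_mem_rowStochastic h]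

end SpecNorm

/-! ### Matrices acting on vectors with entries in a Hilbert space -/

section Action

variable {n : ℕ} {H : Type*} [NormedAddCommGroup H] [InnerProductSpace ℝ H]

/-- Vectors indexed by the nodes with entries in `H`, with the norm `(∑ᵢ ‖w i‖²)^{1/2}`. For
`H = L²(Ω; ℝᵈ)` the norm is the root mean square of the Frobenius norm of a random `n × d`
matrix. -/
abbrev NodeVec (n : ℕ) (H : Type*) [NormedAddCommGroup H] := PiLp 2 (fun _ : Fin n => H)

instance : SMul (Matrix (Fin n) (Fin n) ℝ) (NodeVec n H) where
  smul M w := WithLp.toLp 2 fun i => ∑ j, M i j • w j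

theorem matrix_smul_apply (M : Matrix (Fin n) (Fin n) ℝ) (w : NodeVec n H) (i : Fin n) :
    (M • w) i = ∑ j, M i j • w j := rfl

instance : Module (Matrix (Fin n) (Fin n) ℝ) (NodeVec n H) where
  one_smul w := by
    ext i; simp [matrix_smul_apply, Matrix.one_apply]
  mul_smul M N w := by
    ext i
    simp only [matrix_smul_apply, Matrix.mul_apply, Finset.sum_smul, Finset.smul_sum, mul_smul]
    exact Finset.sum_comm
  smul_zero M := by ext i; simp [matrix_smul_apply]
  smul_add M v w := by
    ext i; simp [matrix_smul_apply, Finset.sum_add_distrib]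
  add_smul M N w := by
    ext i; simp [matrix_smul_apply, add_smul, Finset.sum_add_distrib]
  zero_smul w := by ext i; simp [matrix_smul_apply]

instance : SMulCommClass (Matrix (Fin n) (Fin n) ℝ) ℝ (NodeVec n H) where
  smul_comm M a w := by
    ext i; simp [matrix_smul_apply, Finset.smul_sum, smul_comm a]

theorem sum_posSemidef_inner_nonneg {S : Matrix (Fin n) (Fin n) ℝ} (hS : S.PosSemidef)
    (w : Fin n → H) : 0 ≤ ∑ i, ∑ j, S i j * inner ℝ (w i) (w j) := by
  obtain ⟨k, v, rfl⟩ := Matrix.posSemidef_iff_eq_sum_vecMulVec.mp hS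
  have : ∑ i, ∑ j, (∑ l, Matrix.vecMulVec (v l) (star (v l))) i j * inner ℝ (w i) (w j)
      = ∑ l, ‖∑ i, v l i • w i‖ ^ 2 := by
    simp_rw [← real_inner_self_eq_norm_sq, sum_inner, inner_sum, inner_smul_left,
      inner_smul_right, Matrix.sum_apply, Finset.sum_mul, Matrix.vecMulVec_apply]
    rw [Finset.sum_congr rfl fun i _ => Finset.sum_comm, Finset.sum_comm]
    simp [mul_assoc]
  rw [this]
  positivity

/-- A matrix acts on vectors with Hilbert space entries with the norm it has on real vectors. -/
theorem norm_matrix_smul_le (M : Matrix (Fin n) (Fin n) ℝ) (w : NodeVec n H) :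
    ‖M • w‖ ≤ specNorm M * ‖w‖ := by
  -- `‖M‖² I - Mᵀ M` is positive semidefinite, so its quadratic form is nonnegative on `Hⁿ` too.
  have hpsd : (specNorm M ^ 2 • (1 : Matrix (Fin n) (Fin n) ℝ) - M.transpose * M).PosSemidef := by
    refine Matrix.PosSemidef.of_dotProduct_mulVec_nonneg ?_ fun v => ?_
    · simp [Matrix.IsHermitian, Matrix.conjTranspose_eq_transpose_of_trivial,
        Matrix.transpose_mul]
    · have h := sum_mulVec_sq_le M v
      have e1 : ∑ i, (M.mulVec v) i ^ 2 = M.mulVec v ⬝ᵥ M.mulVec v := by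
        simp [dotProduct, sq]
      have e2 : ∑ i, v i ^ 2 = v ⬝ᵥ v := by simp [dotProduct, sq]
      rw [e1, e2] at h
      rw [Matrix.sub_mulVec, dotProduct_sub, Matrix.smul_mulVec, Matrix.one_mulVec,
        ← Matrix.mulVec_mulVec, Matrix.dotProduct_mulVec, Matrix.vecMul_transpose, dotProduct_smul]
      simpa using h
  have h := sum_posSemidef_inner_nonneg hpsd (fun i => w i)
  have e : ∑ i, ∑ j, (specNorm M ^ 2 • (1 : Matrix (Fin n) (Fin n) ℝ) - M.transpose * M) i j
        * inner ℝ (w i) (w j) = specNorm M ^ 2 * ‖w‖ ^ 2 - ‖M • w‖ ^ 2 := by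
    rw [PiLp.norm_sq_eq_of_L2, PiLp.norm_sq_eq_of_L2]
    simp_rw [matrix_smul_apply, ← real_inner_self_eq_norm_sq, sum_inner, inner_sum,
      inner_smul_left, inner_smul_right, Matrix.sub_apply, sub_mul, Finset.sum_sub_distrib]
    congr 1
    · simp [Matrix.one_apply, Finset.mul_sum]
    · simp_rw [Matrix.mul_apply, Finset.sum_mul, Matrix.transpose_apply]
      rw [Finset.sum_congr rfl fun i _ => Finset.sum_comm, Finset.sum_comm]
      simp [mul_assoc]
  rw [e] at h
  refine le_of_sq_le_sq ?_ (mul_nonneg (specNorm_nonneg M) (norm_nonneg _))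
  rw [mul_pow]; linarith

/-- The combination `vᵀ w = ∑ᵢ vᵢ wᵢ` of the entries of `w`. -/
noncomputable def pair (v : Fin n → ℝ) : NodeVec n H →ₗ[ℝ] H where
  toFun w := ∑ i, v i • w i
  map_add' w z := by simp [Finset.sum_add_distrib]
  map_smul' a w := by simp [Finset.smul_sum, smul_comm a]

theorem pair_apply (v : Fin n → ℝ) (w : NodeVec n H) : pair v w = ∑ i, v i • w i := rfl

theorem pair_matrix_smul (v : Fin n → ℝ) (M : Matrix (Fin n) (Fin n) ℝ) (w : NodeVec n H) :
    pair v (M • w) = pair (Matrix.vecMul v M) w := by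
  simp only [pair_apply, matrix_smul_apply, Matrix.vecMul, dotProduct, Finset.smul_sum,
    Finset.sum_smul, mul_smul]
  exact Finset.sum_comm

theorem norm_pair_sq_le (v : Fin n → ℝ) (w : NodeVec n H) :
    ‖pair v w‖ ^ 2 ≤ (∑ i, v i ^ 2) * ‖w‖ ^ 2 := by
  have h1 : ‖pair v w‖ ≤ ∑ i, |v i| * ‖w i‖ := by
    rw [pair_apply]
    refine (norm_sum_le _ _).trans (Finset.sum_le_sum fun i _ => ?_)
    rw [norm_smul, Real.norm_eq_abs]
  calc ‖pair v w‖ ^ 2 ≤ (∑ i, |v i| * ‖w i‖) ^ 2 := pow_le_pow_left₀ (norm_nonneg _) h1 2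
    _ ≤ (∑ i, |v i| ^ 2) * ∑ i, ‖w i‖ ^ 2 := Finset.sum_mul_sq_le_sq_mul_sq _ _ _
    _ = _ := by rw [PiLp.norm_sq_eq_of_L2]; simp

theorem norm_pair_le {v : Fin n → ℝ} (hv : ∑ i, v i ^ 2 ≤ 1) (w : NodeVec n H) :
    ‖pair v w‖ ≤ ‖w‖ := by
  refine le_of_sq_le_sq ((norm_pair_sq_le v w).trans ?_) (norm_nonneg _)
  nlinarith [sq_nonneg ‖w‖]

/-- The constant vector `𝟙 xᵀ`. -/
noncomputable def const (n : ℕ) : H →ₗ[ℝ] NodeVec n H where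
  toFun x := WithLp.toLp 2 fun _ => x
  map_add' _ _ := rfl
  map_smul' _ _ := rfl

theorem const_apply (x : H) (i : Fin n) : const n x i = x := rfl

theorem norm_const (x : H) : ‖const n x‖ = Real.sqrt n * ‖x‖ := by
  rw [PiLp.norm_eq_of_L2]
  simp [const_apply, Real.sqrt_mul, Real.sqrt_sq]

theorem rowLimit_smul (π : Fin n → ℝ) (w : NodeVec n H) :
    rowLimit π • w = const n (pair π w) := by
  ext i; simp [matrix_smul_apply, rowLimit, const_apply, pair_apply]

/-- The average `(1/n) ∑ᵢ wᵢ`. -/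
noncomputable def mean : NodeVec n H →ₗ[ℝ] H := pair fun _ => (n : ℝ)⁻¹

theorem mean_apply (w : NodeVec n H) : mean w = (n : ℝ)⁻¹ • ∑ i, w i := by
  simp [mean, pair_apply, Finset.smul_sum]

end Action

/-! ### Perron vectors and geometric mixing of stochastic matrices -/

section Perron

open Filter Topology

variable {n : ℕ} {A : Matrix (Fin n) (Fin n) ℝ}

theorem mul_apply_pos {P Q : Matrix (Fin n) (Fin n) ℝ} (hP : ∀ i j, 0 ≤ P i j)
    (hQ : ∀ i j, 0 ≤ Q i j) {i k j : Fin n} (h1 : 0 < P i k) (h2 : 0 < Q k j) :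
    0 < (P * Q) i j := by
  rw [Matrix.mul_apply]
  exact Finset.sum_pos' (fun l _ => mul_nonneg (hP i l) (hQ l j))
    ⟨k, Finset.mem_univ k, mul_pos h1 h2⟩

/-- An irreducible matrix with a positive diagonal entry is primitive: paths through the node that
carries a loop can be padded to a common length. -/
theorem exists_pow_pos_of_irreducible (hA : A.IsIrreducible) (htr : 0 < A.trace) :
    ∃ N, 0 < N ∧ ∀ i j, 0 < (A ^ N) i j := by
  have hnn : ∀ k i j, 0 ≤ (A ^ k) i j := fun k i j => Matrix.pow_apply_nonneg hA.nonneg k i j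
  obtain ⟨k, -, hk⟩ := Finset.exists_lt_of_sum_lt (s := Finset.univ) (f := fun _ => (0 : ℝ))
    (g := fun i => A i i) (by simpa [Matrix.trace] using htr)
  have hloop : ∀ l, 0 < (A ^ l) k k := by
    intro l
    induction l with
    | zero => simp
    | succ l ih => rw [pow_succ]; exact mul_apply_pos (hnn l) hA.nonneg ih hk
  choose e he hpos using (Matrix.isIrreducible_iff_exists_pow_pos hA.nonneg).mp hA
  refine ⟨∑ i, e i k + ∑ j, e k j, ?_, fun i j => ?_⟩
  · exact Nat.add_pos_left (Finset.sum_pos (fun i _ => he i k) ⟨k, Finset.mem_univ k⟩) _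
  · have h1 : e i k ≤ ∑ i, e i k :=
      Finset.single_le_sum (f := fun i => e i k) (fun _ _ => Nat.zero_le _) (Finset.mem_univ i)
    have h2 : e k j ≤ ∑ j, e k j :=
      Finset.single_le_sum (f := fun j => e k j) (fun _ _ => Nat.zero_le _) (Finset.mem_univ j)
    obtain ⟨l, hl⟩ : ∃ l, ∑ i, e i k + ∑ j, e k j = e i k + l + e k j :=
      ⟨∑ i, e i k + ∑ j, e k j - e i k - e k j, by omega⟩
    rw [hl, pow_add, pow_add]
    refine mul_apply_pos (fun a b => ?_) (hnn _) (mul_apply_pos (hnn _) (hnn _) (hpos i k) (hloop l))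
      (hpos k j)
    rw [← pow_add]; exact hnn _ a b

/-- Doeblin's contraction: averaging with weights at least `δ` contracts the oscillation by the
factor `1 - δ`. -/
theorem osc_mulVec_le {P : Matrix (Fin n) (Fin n) ℝ} (hP : P ∈ Matrix.rowStochastic ℝ (Fin n))
    {δ o : ℝ} (hδ : ∀ i j, δ ≤ P i j) (v : Fin n → ℝ) (ho : 0 ≤ o) (hv : ∀ i j, v i - v j ≤ o)
    (i j : Fin n) : P.mulVec v i - P.mulVec v j ≤ (1 - δ) * o := by
  obtain ⟨k, -, hk⟩ := Finset.exists_min_image Finset.univ v ⟨i, Finset.mem_univ i⟩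
  have h0 : ∀ a b, 0 ≤ P a b := fun a b => Matrix.nonneg_of_mem_rowStochastic hP
  have h1 := Matrix.sum_row_of_mem_rowStochastic hP
  have hlow : v k ≤ P.mulVec v j := by
    calc v k = ∑ l, P j l * v k := by rw [← Finset.sum_mul, h1, one_mul]
      _ ≤ _ := Finset.sum_le_sum fun l hl => mul_le_mul_of_nonneg_left (hk l hl) (h0 j l)
  have hup : P.mulVec v i ≤ v k + o - P i k * o := by
    have : ∀ l, P i l * v l ≤ P i l * (v k + o) - if l = k then P i k * o else 0 := by
      intro l
      split_ifs with h
      · subst h; linarith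
      · have := mul_le_mul_of_nonneg_left (hv l k) (h0 i l)
        linarith
    calc P.mulVec v i ≤ ∑ l, (P i l * (v k + o) - if l = k then P i k * o else 0) :=
          (Finset.sum_le_sum fun l _ => this l : ∑ l, P i l * v l ≤ _)
      _ = _ := by rw [Finset.sum_sub_distrib, ← Finset.sum_mul, h1]; simp
  nlinarith [mul_le_mul_of_nonneg_right (hδ i k) ho]

theorem pow_rowStochastic (hA : A ∈ Matrix.rowStochastic ℝ (Fin n)) (t : ℕ) :
    A ^ t ∈ Matrix.rowStochastic ℝ (Fin n) := pow_mem hA t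

theorem osc_pow_le (hA : A ∈ Matrix.rowStochastic ℝ (Fin n)) {N : ℕ} {δ : ℝ}
    (hδ1 : δ ≤ 1) (hδ : ∀ i j, δ ≤ (A ^ N) i j) (t : ℕ) (i k j : Fin n) :
    (A ^ t) i j - (A ^ t) k j ≤ (1 - δ) ^ (t / N) := by
  have hcol : ∀ (P Q : Matrix (Fin n) (Fin n) ℝ) (i j : Fin n),
      (P * Q) i j = P.mulVec (fun l => Q l j) i := fun P Q i j => by
    simp [Matrix.mul_apply, Matrix.mulVec, dotProduct]
  have h0 : ∀ s a b, 0 ≤ (A ^ s) a b := fun s a b =>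
    Matrix.nonneg_of_mem_rowStochastic (pow_rowStochastic hA s)
  have hq : ∀ q, ∀ i k j : Fin n, (A ^ (N * q)) i j - (A ^ (N * q)) k j ≤ (1 - δ) ^ q := by
    intro q
    induction q with
    | zero =>
      intro i k j
      have h1 := Matrix.le_one_of_mem_rowStochastic (pow_rowStochastic hA 0) (i := i) (j := j)
      have h2 := h0 0 k j
      simp only [mul_zero, pow_zero] at *
      linarith
    | succ q ih =>
      intro i k j
      rw [Nat.mul_succ, add_comm, pow_add, hcol, hcol, pow_succ']
      exact osc_mulVec_le (pow_rowStochastic hA N) hδ _ (pow_nonneg (by linarith) _)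
        (fun a b => ih a b j) i k
  have := osc_mulVec_le (pow_rowStochastic hA (t % N)) (h0 _) (fun l => (A ^ (N * (t / N))) l j)
    (pow_nonneg (by linarith : 0 ≤ 1 - δ) (t / N)) (fun a b => hq (t / N) a b j) i k
  rw [← hcol, ← hcol, ← pow_add, Nat.mod_add_div] at this
  linarith

/-- Perron--Frobenius for stochastic matrices, with geometric convergence of the powers. -/
theorem exists_perron (hA : A ∈ Matrix.rowStochastic ℝ (Fin n)) (hirr : A.IsIrreducible)
    (htr : 0 < A.trace) :
    ∃ π : Fin n → ℝ, (∀ i, 0 < π i) ∧ ∑ i, π i = 1 ∧ Matrix.vecMul π A = π ∧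
      DecaysTo A (rowLimit π) := by
  obtain ⟨N, hN, hpos⟩ := exists_pow_pos_of_irreducible hirr htr
  obtain ⟨i0⟩ : Nonempty (Fin n) := by
    by_contra h
    rw [not_nonempty_iff] at h
    simp [Matrix.trace] at htr
  obtain ⟨δ, hδ0, hδ2, hδ⟩ : ∃ δ : ℝ, 0 < δ ∧ δ ≤ 1 / 2 ∧ ∀ i j, δ ≤ (A ^ N) i j := by
    obtain ⟨⟨a, b⟩, -, hab⟩ := Finset.exists_min_image (Finset.univ : Finset (Fin n × Fin n))
      (fun p => (A ^ N) p.1 p.2) ⟨(i0, i0), Finset.mem_univ _⟩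
    exact ⟨min ((A ^ N) a b) (1 / 2), lt_min (hpos a b) (by norm_num), min_le_right _ _,
      fun i j => (min_le_left _ _).trans (hab (i, j) (Finset.mem_univ _))⟩
  set ρ : ℝ := 1 - δ with hρ
  have hρ0 : 0 < ρ := by linarith
  have hρ1 : ρ < 1 := by linarith
  have hst : ∀ t, A ^ t ∈ Matrix.rowStochastic ℝ (Fin n) := pow_rowStochastic hA
  have h0 : ∀ s a b, 0 ≤ (A ^ s) a b := fun s a b => Matrix.nonneg_of_mem_rowStochastic (hst s)
  have hosc := osc_pow_le hA (by linarith) hδ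
  -- later rows are averages of the rows of `A ^ t`, hence stay within the oscillation at time `t`
  have hdiff : ∀ s t i k j, |(A ^ (s + t)) i j - (A ^ t) k j| ≤ ρ ^ (t / N) := by
    intro s t i k j
    have : (A ^ (s + t)) i j - (A ^ t) k j = ∑ l, (A ^ s) i l * ((A ^ t) l j - (A ^ t) k j) := by
      simp_rw [mul_sub, Finset.sum_sub_distrib, ← Finset.sum_mul,
        Matrix.sum_row_of_mem_rowStochastic (hst s), pow_add, Matrix.mul_apply, one_mul]
    rw [this]
    refine (Finset.abs_sum_le_sum_abs _ _).trans ?_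
    calc ∑ l, |(A ^ s) i l * ((A ^ t) l j - (A ^ t) k j)| ≤ ∑ l, (A ^ s) i l * ρ ^ (t / N) := by
          refine Finset.sum_le_sum fun l _ => ?_
          rw [abs_mul, abs_of_nonneg (h0 s i l)]
          refine mul_le_mul_of_nonneg_left (abs_le.mpr ⟨?_, hosc t l k j⟩) (h0 s i l)
          linarith [hosc t k l j]
      _ = _ := by rw [← Finset.sum_mul, Matrix.sum_row_of_mem_rowStochastic (hst s), one_mul]
  have hlim0 : Tendsto (fun t : ℕ => ρ ^ (t / N)) atTop (𝓝 0) :=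
    (tendsto_pow_atTop_nhds_zero_of_lt_one hρ0.le hρ1).comp (Nat.tendsto_div_const_atTop hN.ne')
  have hcau : ∀ j, CauchySeq fun t => (A ^ t) i0 j := by
    intro j
    refine cauchySeq_of_le_tendsto_0' (fun t : ℕ => ρ ^ (t / N)) (fun t u htu => ?_) hlim0
    obtain ⟨s, rfl⟩ := Nat.exists_eq_add_of_le' htu
    rw [dist_comm, Real.dist_eq]
    exact hdiff s t i0 i0 j
  choose π hπ using fun j => cauchySeq_tendsto_of_complete (hcau j)
  have hclose : ∀ t i j, |(A ^ t) i j - π j| ≤ ρ ^ (t / N) := by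
    intro t i j
    have h1 : Tendsto (fun s => |(A ^ t) i j - (A ^ (s + t)) i0 j|) atTop
        (𝓝 |(A ^ t) i j - π j|) :=
      ((tendsto_const_nhds.sub ((tendsto_add_atTop_iff_nat t).mpr (hπ j)))).abs
    exact le_of_tendsto' h1 fun s => by rw [abs_sub_comm]; exact hdiff s t i0 i j
  have hsum : ∑ i, π i = 1 := by
    have h1 := tendsto_finsetSum (s := Finset.univ) fun j _ => hπ j
    simp_rw [Matrix.sum_row_of_mem_rowStochastic (hst _)] at h1
    exact tendsto_nhds_unique h1 tendsto_const_nhds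
  have hstat : ∀ s, Matrix.vecMul π (A ^ s) = π := by
    intro s
    ext j
    have h1 : Tendsto (fun t => ∑ l, (A ^ t) i0 l * (A ^ s) l j) atTop
        (𝓝 (∑ l, π l * (A ^ s) l j)) :=
      tendsto_finsetSum _ fun l _ => (hπ l).mul_const _
    simp_rw [← Matrix.mul_apply, ← pow_add] at h1
    exact tendsto_nhds_unique h1 ((tendsto_add_atTop_iff_nat s).mpr (hπ j))
  have hπ0 : ∀ j, 0 ≤ π j := fun j => ge_of_tendsto' (hπ j) fun t => h0 t i0 j
  refine ⟨π, fun j => ?_, hsum, by simpa using hstat 1, ?_⟩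
  · have h1 := congrFun (hstat N) j
    rw [← h1]
    calc 0 < δ := hδ0
      _ = ∑ l, π l * δ := by rw [← Finset.sum_mul, hsum, one_mul]
      _ ≤ _ := Finset.sum_le_sum fun l _ => mul_le_mul_of_nonneg_left (hδ l j) (hπ0 l)
  · set lam : ℝ := ρ ^ ((N : ℝ)⁻¹) with hlam
    have hlam0 : 0 < lam := Real.rpow_pos_of_pos hρ0 _
    have hlam1 : lam < 1 := Real.rpow_lt_one hρ0.le hρ1 (by positivity)
    have hlamN : lam ^ N = ρ := Real.rpow_inv_natCast_pow hρ0.le hN.ne'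
    refine ⟨(n + 1) / ρ, lam, by positivity, hlam0.le, hlam1, fun t => ?_⟩
    have hpow : ρ ^ (t / N) ≤ lam ^ t / ρ := by
      rw [le_div_iff₀ hρ0, ← pow_succ, ← hlamN, ← pow_mul]
      refine pow_le_pow_of_le_one hlam0.le hlam1.le ?_
      rw [Nat.mul_succ]
      have := Nat.div_add_mod t N
      have := Nat.mod_lt t hN
      omega
    have hsq : specNorm (A ^ t - rowLimit π) ^ 2 ≤ (n * ρ ^ (t / N)) ^ 2 := by
      refine (specNorm_sq_le_sum_sq _).trans ?_
      calc ∑ i, ∑ j, (A ^ t - rowLimit π) i j ^ 2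
          ≤ ∑ _i : Fin n, ∑ _j : Fin n, (ρ ^ (t / N)) ^ 2 := by
            refine Finset.sum_le_sum fun i _ => Finset.sum_le_sum fun j _ => ?_
            rw [Matrix.sub_apply, ← sq_abs]
            exact pow_le_pow_left₀ (abs_nonneg _) (hclose t i j) 2
        _ = _ := by simp; ring
    have hle := le_of_sq_le_sq hsq (by positivity)
    calc specNorm (A ^ t - rowLimit π) ≤ n * ρ ^ (t / N) := hle
      _ ≤ (n + 1) * (lam ^ t / ρ) := by
        gcongr
        linarith
      _ = _ := by ring

theorem colLimit_eq_transpose (π : Fin n → ℝ) : colLimit π = (rowLimit π).transpose := rfl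

theorem exists_expDecay {A B : Matrix (Fin n) (Fin n) ℝ}
    (hA : A ∈ Matrix.rowStochastic ℝ (Fin n)) (hB : B ∈ Matrix.colStochastic ℝ (Fin n))
    (iA : A.IsIrreducible) (iB : B.IsIrreducible) (tA : 0 < A.trace) (tB : 0 < B.trace) :
    ∃ πA πB : Fin n → ℝ, ExpDecay A B πA πB := by
  obtain ⟨πA, pA, sA, eA, dA⟩ := exists_perron hA iA tA
  obtain ⟨πB, pB, sB, eB, p, lam, hp, hl0, hl1, hd⟩ := exists_perron
    (Matrix.transpose_mem_rowStochastic_iff_mem_colStochastic.mpr hB) iB.transpose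
    (by rwa [Matrix.trace_transpose])
  refine ⟨πA, πB, hA, hB, pA, pB, sA, sB, eA, ?_, dA, p, lam, hp, hl0, hl1, fun t => ?_⟩
  · rwa [Matrix.vecMul_transpose] at eB
  · rw [colLimit_eq_transpose, ← specNorm_transpose]
    simpa [Matrix.transpose_sub, Matrix.transpose_pow] using hd t

end Perron

/-! ### The mixing sums -/

section MixSum

variable {n : ℕ} {M Minf : Matrix (Fin n) (Fin n) ℝ}

theorem DecaysTo.summable (h : DecaysTo M Minf) : Summable fun i => specNorm (M ^ i - Minf) := by
  obtain ⟨p, lam, hp, h0, h1, hb⟩ := h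
  exact Summable.of_nonneg_of_le (fun _ => specNorm_nonneg _) hb
    ((summable_geometric_of_lt_one h0 h1).mul_left p)

theorem DecaysTo.summable_sq (h : DecaysTo M Minf) :
    Summable fun i => specNorm (M ^ i - Minf) ^ 2 := by
  obtain ⟨p, lam, hp, h0, h1, hb⟩ := h
  refine Summable.of_nonneg_of_le (fun _ => sq_nonneg _)
    (fun i => pow_le_pow_left₀ (specNorm_nonneg _) (hb i) 2) ?_
  have : ∀ i, (p * lam ^ i) ^ 2 = p ^ 2 * (lam ^ 2) ^ i := fun i => by ring
  simp_rw [this]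
  exact (summable_geometric_of_lt_one (sq_nonneg _) (by nlinarith)).mul_left _

theorem DecaysTo.sum_le (h : DecaysTo M Minf) (s : Finset ℕ) :
    ∑ i ∈ s, specNorm (M ^ i - Minf) ≤ mixSum M Minf :=
  (h.summable.sum_le_tsum s fun _ _ => specNorm_nonneg _).trans (le_max_left _ _)

theorem DecaysTo.sum_sq_le (h : DecaysTo M Minf) (s : Finset ℕ) :
    ∑ i ∈ s, specNorm (M ^ i - Minf) ^ 2 ≤ mixSum M Minf :=
  (h.summable_sq.sum_le_tsum s fun _ _ => sq_nonneg _).trans (le_max_right _ _)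

theorem DecaysTo.pow (h : DecaysTo M Minf) {m : ℕ} (hm : 0 < m) : DecaysTo (M ^ m) Minf := by
  obtain ⟨p, lam, hp, h0, h1, hb⟩ := h
  refine ⟨p, lam ^ m, hp, pow_nonneg h0 m, pow_lt_one₀ h0 h1 hm.ne', fun t => ?_⟩
  rw [← pow_mul, ← pow_mul]
  exact hb _

theorem DecaysTo.mixSum_pow_le (h : DecaysTo M Minf) {m : ℕ} (hm : 0 < m) :
    mixSum (M ^ m) Minf ≤ mixSum M Minf := by
  have hinj : Function.Injective fun i : ℕ => m * i := fun i j hij => Nat.eq_of_mul_eq_mul_left hm hij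
  unfold mixSum
  simp_rw [← pow_mul]
  exact max_le_max
    (tsum_comp_le_tsum_of_inj h.summable (fun _ => specNorm_nonneg _) hinj)
    (tsum_comp_le_tsum_of_inj h.summable_sq (fun _ => sq_nonneg _) hinj)

theorem DecaysTo.one_le_mixSum (h : DecaysTo M Minf) (hidem : Minf * Minf = Minf)
    (hne : Minf ≠ 1) : 1 ≤ mixSum M Minf := by
  have h1 : 1 ≤ specNorm (1 - Minf) := by
    refine one_le_specNorm_of_idempotent _ ?_ (sub_ne_zero.mpr hne.symm)
    rw [sub_mul, mul_sub, mul_sub, hidem]; simp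
  simpa using h1.trans (by simpa using h.sum_le {0})

end MixSum

theorem rowLimit_mul_self {n : ℕ} {π : Fin n → ℝ} (h : ∑ i, π i = 1) :
    rowLimit π * rowLimit π = rowLimit π := by
  ext i j
  simp [Matrix.mul_apply, rowLimit, ← Finset.sum_mul, h]

theorem rowLimit_ne_one {n : ℕ} (hn : 2 ≤ n) (π : Fin n → ℝ) : rowLimit π ≠ 1 := by
  intro h
  have h1 := congrFun (congrFun h ⟨0, by omega⟩) ⟨0, by omega⟩
  have h2 := congrFun (congrFun h ⟨1, by omega⟩) ⟨0, by omega⟩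
  simp [rowLimit] at h1 h2
  linarith

theorem sum_sq_le_one {n : ℕ} {π : Fin n → ℝ} (h0 : ∀ i, 0 ≤ π i) (h : ∑ i, π i = 1) :
    ∑ i, π i ^ 2 ≤ 1 := by
  rw [← h]
  refine Finset.sum_le_sum fun i _ => ?_
  have : π i ≤ 1 := h ▸ Finset.single_le_sum (fun i _ => h0 i) (Finset.mem_univ i)
  nlinarith [h0 i]

namespace ExpDecay

variable {n : ℕ} {A B : Matrix (Fin n) (Fin n) ℝ} {πA πB : Fin n → ℝ}

theorem rowLimit_mul_pow (h : ExpDecay A B πA πB) (t : ℕ) :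
    rowLimit πA * A ^ t = rowLimit πA := by
  have h1 : rowLimit πA * A = rowLimit πA := by
    ext i j
    exact congrFun h.perron_A j
  induction t with
  | zero => simp
  | succ t ih => rw [pow_succ', ← mul_assoc, h1, ih]

theorem sum_sq_A_le (h : ExpDecay A B πA πB) : ∑ i, πA i ^ 2 ≤ 1 :=
  sum_sq_le_one (fun i => (h.pos_A i).le) h.sum_A

theorem sum_sq_B_le (h : ExpDecay A B πA πB) : ∑ i, πB i ^ 2 ≤ 1 :=
  sum_sq_le_one (fun i => (h.pos_B i).le) h.sum_B

theorem one_le_mixSum_A (h : ExpDecay A B πA πB) (hn : 2 ≤ n) {m : ℕ} (hm : 0 < m) :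
    1 ≤ mixSum (A ^ m) (rowLimit πA) :=
  (h.decay_A.pow hm).one_le_mixSum (rowLimit_mul_self h.sum_A) (rowLimit_ne_one hn _)

theorem one_le_mixSum_B (h : ExpDecay A B πA πB) (hn : 2 ≤ n) {m : ℕ} (hm : 0 < m) :
    1 ≤ mixSum (B ^ m) (colLimit πB) := by
  refine (h.decay_B.pow hm).one_le_mixSum ?_ fun h1 => rowLimit_ne_one hn πB ?_
  · rw [colLimit_eq_transpose, ← Matrix.transpose_mul, rowLimit_mul_self h.sum_B]
  · rw [colLimit_eq_transpose] at h1
    rw [← Matrix.transpose_transpose (rowLimit πB), h1, Matrix.transpose_one]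

theorem cConst_pos (h : ExpDecay A B πA πB) (hn : 2 ≤ n) : 0 < cConst πA πB := by
  have : Nonempty (Fin n) := ⟨⟨0, by omega⟩⟩
  exact mul_pos (by positivity)
    (Finset.sum_pos (fun i _ => mul_pos (h.pos_A i) (h.pos_B i)) Finset.univ_nonempty)

theorem cConst_le (h : ExpDecay A B πA πB) : cConst πA πB ≤ n := by
  have : ∑ i, πA i * πB i ≤ 1 := by
    rw [← h.sum_A]
    refine Finset.sum_le_sum fun i _ => mul_le_of_le_one_right (h.pos_A i).le ?_
    exact h.sum_B ▸ Finset.single_le_sum (fun i _ => (h.pos_B i).le) (Finset.mem_univ i)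
  exact mul_le_of_le_one_right (Nat.cast_nonneg n) this

/-- Submultiplicativity of the deviations of the powers of `A`, up to `‖Aʳ‖₂ ≤ √n`. -/
theorem deviation_add_le (h : ExpDecay A B πA πB) (q r : ℕ) :
    specNorm (A ^ (q + r) - rowLimit πA) ≤ Real.sqrt n * specNorm (A ^ q - rowLimit πA) := by
  have e : A ^ (q + r) - rowLimit πA = (A ^ q - rowLimit πA) * A ^ r := by
    rw [sub_mul, h.rowLimit_mul_pow, pow_add]
  have hr : specNorm (A ^ r) ≤ Real.sqrt n := Real.le_sqrt_of_sq_le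
    (specNorm_sq_le_card_of_rowStochastic _ (pow_rowStochastic h.rowStochastic_A r))
  rw [e, mul_comm (Real.sqrt n)]
  exact (specNorm_mul_le _ _).trans (mul_le_mul_of_nonneg_left hr (specNorm_nonneg _))

theorem vecMul_colLimit (πA πB : Fin n → ℝ) (hn : 2 ≤ n) :
    Matrix.vecMul πA (colLimit πB) = fun _ => cConst πA πB * (n : ℝ)⁻¹ := by
  ext j
  have : (n : ℝ) ≠ 0 := by positivity
  simp only [Matrix.vecMul, dotProduct, colLimit, cConst, Matrix.of_apply]
  field_simp

end ExpDecay

/-! ### The iteration in a Hilbert space -/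

section System

variable {n : ℕ} {H : Type*} [NormedAddCommGroup H] [InnerProductSpace ℝ H]

/-- The causal convolution `∑_{i < t} M i • w (t - 1 - i)` of matrices with vectors. -/
noncomputable def conv (M : ℕ → Matrix (Fin n) (Fin n) ℝ) (w : ℕ → NodeVec n H) (t : ℕ) :
    NodeVec n H := ∑ i ∈ Finset.range t, M i • w (t - 1 - i)

/-- Push-Pull for random vectors regarded as elements of a Hilbert space `H` of square integrable
vectors: `h` are the exact gradients at the nodes, `ε` the gradient noise, `Gr t` is the gradient
of the average objective at `x̂⁽ᵗ⁾ = π_Aᵀ x⁽ᵗ⁾` and `F t` is the expected objective value there. The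
fields record exactly what the convergence proof uses. -/
structure System (A B : Matrix (Fin n) (Fin n) ℝ) (πA : Fin n → ℝ) (α L Δ σ : ℝ) (x0 : H)
    (x y h ε : ℕ → NodeVec n H) (Gr : ℕ → H) (F : ℕ → ℝ) : Prop where
  x_zero : x 0 = const n x0
  y_zero : y 0 = h 0 + ε 0
  x_succ : ∀ t, x (t + 1) = A • x t - α • y t
  y_succ : ∀ t, y (t + 1) = B • y t + (h (t + 1) + ε (t + 1)) - (h t + ε t)
  lipschitz : ∀ s t, ‖h s - h t‖ ≤ L * ‖x s - x t‖
  grad_mean : ∀ s t, ‖mean (h s) - Gr t‖ ≤ L * (Real.sqrt n)⁻¹ * ‖x s - const n (pair πA (x t))‖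
  init : ‖h 0‖ ^ 2 ≤ 2 * n * L * Δ
  noise_orth : ∀ s t i j, (s, i) ≠ (t, j) → inner ℝ (ε s i) (ε t j) = 0
  noise_sq : ∀ s i, ‖ε s i‖ ^ 2 ≤ σ ^ 2
  grad_orth : ∀ s t i, s ≤ t → inner ℝ (Gr s) (ε t i) = 0
  descent : ∀ s t, F t ≤ F s + inner ℝ (Gr s) (pair πA (x t - x s))
    + L / 2 * ‖pair πA (x t - x s)‖ ^ 2
  gap : ∀ t, F 0 - F t ≤ Δ

theorem conv_add (M : ℕ → Matrix (Fin n) (Fin n) ℝ) (v w : ℕ → NodeVec n H) (t : ℕ) :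
    conv M (fun s => v s + w s) t = conv M v t + conv M w t := by
  simp [conv, smul_add, Finset.sum_add_distrib]

theorem conv_pow_succ (M : Matrix (Fin n) (Fin n) ℝ) (w : ℕ → NodeVec n H) (t : ℕ) :
    conv (fun i => M ^ i) w (t + 1) = M • conv (fun i => M ^ i) w t + w t := by
  unfold conv
  rw [Finset.sum_range_succ', Finset.smul_sum]
  congr 1
  · refine Finset.sum_congr rfl fun i _ => ?_
    beta_reduce
    rw [pow_succ', mul_smul, show t + 1 - 1 - (i + 1) = t - 1 - i by omega]
  · simp

theorem norm_conv_le (M : ℕ → Matrix (Fin n) (Fin n) ℝ) (w : ℕ → NodeVec n H) (t : ℕ) :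
    ‖conv M w t‖ ≤ ∑ i ∈ Finset.range t, specNorm (M i) * ‖w (t - 1 - i)‖ :=
  (norm_sum_le _ _).trans (Finset.sum_le_sum fun _ _ => norm_matrix_smul_le _ _)

/-- A difference of convolutions at two times, with the values before time `0` continued by the
value at time `0` (as truncated subtraction does). -/
theorem conv_sub_conv (M : ℕ → Matrix (Fin n) (Fin n) ℝ) (w : ℕ → NodeVec n H) (s r : ℕ) :
    conv M w (s + r) - conv M w s =
      ∑ i ∈ Finset.range (s + r), M i • (w (s + r - 1 - i) - w (s - 1 - i))
        + ∑ i ∈ Finset.Ico s (s + r), M i • w 0 := by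
  unfold conv
  simp_rw [smul_sub, Finset.sum_sub_distrib]
  have h1 : ∑ i ∈ Finset.range (s + r), M i • w (s - 1 - i)
      = ∑ i ∈ Finset.range s, M i • w (s - 1 - i) + ∑ i ∈ Finset.Ico s (s + r), M i • w 0 := by
    rw [← Finset.sum_range_add_sum_Ico _ (Nat.le_add_right s r)]
    congr 1
    refine Finset.sum_congr rfl fun i hi => ?_
    rw [show s - 1 - i = 0 by have := (Finset.mem_Ico.mp hi).1; omega]
  rw [h1]
  abel

theorem norm_conv_sub_conv_le (M : ℕ → Matrix (Fin n) (Fin n) ℝ) (w : ℕ → NodeVec n H)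
    (s r : ℕ) :
    ‖conv M w (s + r) - conv M w s‖ ≤
      ∑ i ∈ Finset.range (s + r), specNorm (M i) * ‖w (s + r - 1 - i) - w (s - 1 - i)‖
        + (∑ i ∈ Finset.Ico s (s + r), specNorm (M i)) * ‖w 0‖ := by
  rw [conv_sub_conv, Finset.sum_mul]
  exact (norm_add_le _ _).trans (add_le_add
    ((norm_sum_le _ _).trans (Finset.sum_le_sum fun _ _ => norm_matrix_smul_le _ _))
    ((norm_sum_le _ _).trans (Finset.sum_le_sum fun _ _ => norm_matrix_smul_le _ _)))

namespace System

variable {A B : Matrix (Fin n) (Fin n) ℝ} {πA πB : Fin n → ℝ} {α L Δ σ : ℝ} {x0 : H}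
  {x y h ε : ℕ → NodeVec n H} {Gr : ℕ → H} {F : ℕ → ℝ}

/-- Gradient tracking: `y⁽ᵗ⁾` is the increment of the response of `B` to the stochastic gradients. -/
theorem tracker_eq (S : System A B πA α L Δ σ x0 x y h ε Gr F) (t : ℕ) :
    y t = conv (fun i => B ^ i) (fun s => h s + ε s) (t + 1)
      - conv (fun i => B ^ i) (fun s => h s + ε s) t := by
  induction t with
  | zero => simp [S.y_zero, conv]
  | succ t ih =>
    rw [S.y_succ, ih, conv_pow_succ B _ (t + 1), smul_sub]
    nth_rewrite 3 [conv_pow_succ]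
    abel

theorem smul_const (hE : ExpDecay A B πA πB) (z : H) : A • const n z = const n z := by
  ext i
  simp [matrix_smul_apply, const_apply, ← Finset.sum_smul,
    Matrix.sum_row_of_mem_rowStochastic hE.rowStochastic_A]

theorem node_eq (hE : ExpDecay A B πA πB) (S : System A B πA α L Δ σ x0 x y h ε Gr F) (t : ℕ) :
    x t = const n x0 - α • conv (fun i => A ^ i) y t := by
  induction t with
  | zero => simp [S.x_zero, conv]
  | succ t ih =>
    rw [S.x_succ, ih, conv_pow_succ, smul_sub, smul_const hE, smul_add, smul_comm A α]
    abel

/-- `π_Aᵀ A = π_Aᵀ`, so `x̂` moves by the cumulated trackers only. -/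
theorem pair_node_eq (hE : ExpDecay A B πA πB) (S : System A B πA α L Δ σ x0 x y h ε Gr F)
    (t : ℕ) :
    pair πA (x t) = x0 - α • pair πA (conv (fun i => B ^ i) (fun s => h s + ε s) t) := by
  induction t with
  | zero => simp [S.x_zero, conv, pair_apply, const_apply, ← Finset.sum_smul, hE.sum_A]
  | succ t ih =>
    rw [S.x_succ, map_sub, pair_matrix_smul, hE.perron_A, map_smul, S.tracker_eq, ih, map_sub,
      smul_sub]
    abel

/-- The consensus error is the convolution of the trackers with the deviations `Aⁱ - A_∞`. -/
theorem consensus_eq (hE : ExpDecay A B πA πB) (S : System A B πA α L Δ σ x0 x y h ε Gr F)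
    (t : ℕ) :
    x t - const n (pair πA (x t)) = -(α • conv (fun i => A ^ i - rowLimit πA) y t) := by
  have h1 : rowLimit πA • const n x0 = const n x0 := by
    rw [rowLimit_smul]
    simp [pair_apply, const_apply, ← Finset.sum_smul, hE.sum_A]
  rw [← rowLimit_smul, S.node_eq hE, smul_sub, h1, smul_comm (rowLimit πA) α]
  have h2 : conv (fun i => A ^ i - rowLimit πA) y t
      = conv (fun i => A ^ i) y t - rowLimit πA • conv (fun i => A ^ i) y t := by
    simp only [conv, sub_smul, Finset.sum_sub_distrib, Finset.smul_sum, ← mul_smul,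
      hE.rowLimit_mul_pow]
  rw [h2, smul_sub]
  abel

end System

/-- Splitting `Bⁱ` into its limit and its deviation, `π_Aᵀ` of the cumulated trackers is `c` times
the cumulated average gradients plus a deviation. -/
theorem pair_conv_pow (hn : 2 ≤ n) (B : Matrix (Fin n) (Fin n) ℝ) (πA πB : Fin n → ℝ)
    (w : ℕ → NodeVec n H) (t : ℕ) :
    pair πA (conv (fun i => B ^ i) w t) = cConst πA πB • ∑ s ∈ Finset.range t, mean (w s)
      + pair πA (conv (fun i => B ^ i - colLimit πB) w t) := by
  have h1 : ∀ v : NodeVec n H, pair πA (colLimit πB • v) = cConst πA πB • mean v := by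
    intro v
    rw [pair_matrix_smul, ExpDecay.vecMul_colLimit _ _ hn]
    simp [mean, pair_apply, Finset.smul_sum, mul_smul]
  have h2 : ∑ s ∈ Finset.range t, mean (w s) = ∑ i ∈ Finset.range t, mean (w (t - 1 - i)) :=
    (Finset.sum_range_reflect (fun s => mean (w s)) t).symm
  rw [h2, Finset.smul_sum]
  simp only [conv, map_sum, sub_smul, map_sub, h1, ← Finset.sum_add_distrib]
  exact Finset.sum_congr rfl fun i _ => by abel

theorem norm_colLimit_smul_le {πB : Fin n → ℝ} (hB : ∑ i, πB i ^ 2 ≤ 1) (hn : 2 ≤ n)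
    (w : NodeVec n H) : ‖colLimit πB • w‖ ≤ n * ‖mean w‖ := by
  have hn0 : (n : ℝ) ≠ 0 := by positivity
  have e : ∀ i, (colLimit πB • w) i = (πB i * n) • mean w := fun i => by
    rw [mean_apply, smul_smul, mul_assoc, mul_inv_cancel₀ hn0, mul_one, Finset.smul_sum]
    rfl
  refine le_of_sq_le_sq ?_ (by positivity)
  rw [PiLp.norm_sq_eq_of_L2]
  simp_rw [e, norm_smul, mul_pow, Real.norm_eq_abs, sq_abs, mul_pow, ← Finset.sum_mul]
  rw [← mul_pow]
  nlinarith [sq_nonneg ((n : ℝ) * ‖mean w‖)]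

/-! ### Orthogonal noise -/

theorem norm_sum_pair_sq_le {ε : ℕ → NodeVec n H} {σ : ℝ}
    (orth : ∀ s t i j, (s, i) ≠ (t, j) → inner ℝ (ε s i) (ε t j) = 0)
    (hσ : ∀ s i, ‖ε s i‖ ^ 2 ≤ σ ^ 2) (V : ℕ → Fin n → ℝ) (s : Finset ℕ) :
    ‖∑ j ∈ s, pair (V j) (ε j)‖ ^ 2 ≤ σ ^ 2 * ∑ j ∈ s, ∑ i, V j i ^ 2 := by
  simp_rw [pair_apply, ← Finset.sum_product']
  rw [← real_inner_self_eq_norm_sq, sum_inner, Finset.mul_sum]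
  refine Finset.sum_le_sum fun p hp => ?_
  rw [inner_sum, Finset.sum_eq_single_of_mem p hp]
  · rw [inner_smul_left, inner_smul_right, real_inner_self_eq_norm_sq]
    have := mul_le_mul_of_nonneg_left (hσ p.1 p.2) (sq_nonneg (V p.1 p.2))
    simp only [conj_trivial]
    linarith
  · intro q _ hqp
    rw [inner_smul_left, inner_smul_right, orth _ _ _ _ (fun h => hqp h.symm)]
    simp

theorem pair_conv_eq (v : Fin n → ℝ) (M : ℕ → Matrix (Fin n) (Fin n) ℝ) (w : ℕ → NodeVec n H)
    (t : ℕ) : pair v (conv M w t)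
      = ∑ j ∈ Finset.range t, pair (Matrix.vecMul v (M (t - 1 - j))) (w j) := by
  rw [conv, ← Finset.sum_range_reflect, map_sum]
  refine Finset.sum_congr rfl fun i hi => ?_
  rw [pair_matrix_smul, show t - 1 - (t - 1 - i) = i by have := Finset.mem_range.mp hi; omega]

theorem DecaysTo.sum_sq_comp_le {M Minf : Matrix (Fin n) (Fin n) ℝ}
    (h : DecaysTo M Minf) (s : Finset ℕ) {f : ℕ → ℕ} (hf : Set.InjOn f s) :
    ∑ j ∈ s, specNorm (M ^ f j - Minf) ^ 2 ≤ mixSum M Minf := by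
  rw [← Finset.sum_image (f := fun i => specNorm (M ^ i - Minf) ^ 2) hf]
  exact h.sum_sq_le _

theorem specNorm_pow_sub_pow_sq_le (M Minf : Matrix (Fin n) (Fin n) ℝ) (k l : ℕ) :
    specNorm (M ^ k - M ^ l) ^ 2
      ≤ 2 * specNorm (M ^ k - Minf) ^ 2 + 2 * specNorm (M ^ l - Minf) ^ 2 := by
  have h : specNorm (M ^ k - M ^ l) ≤ specNorm (M ^ k - Minf) + specNorm (M ^ l - Minf) := by
    rw [show M ^ k - M ^ l = (M ^ k - Minf) - (M ^ l - Minf) by abel]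
    exact specNorm_sub_le _ _
  nlinarith [pow_le_pow_left₀ (specNorm_nonneg _) h 2,
    sq_nonneg (specNorm (M ^ k - Minf) - specNorm (M ^ l - Minf))]

section NoiseBounds

variable {A B : Matrix (Fin n) (Fin n) ℝ} {πA πB : Fin n → ℝ}

/-- The coefficients of noise drawn within the last `r` steps: each row `π_Aᵀ Bˡ` is the constant row
`c / n` up to a summable deviation. -/
theorem sum_coef_new_le (hn : 2 ≤ n) (hE : ExpDecay A B πA πB) (s r : ℕ) :
    ∑ j ∈ Finset.Ico s (s + r), ∑ i, (Matrix.vecMul πA (B ^ (s + r - 1 - j))) i ^ 2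
      ≤ 2 * (r * (cConst πA πB ^ 2 / n)) + 2 * mixSum B (colLimit πB) := by
  have hn0 : (n : ℝ) ≠ 0 := by positivity
  have h1 : ∀ l, ∑ i, (Matrix.vecMul πA (B ^ l)) i ^ 2
      ≤ 2 * (cConst πA πB ^ 2 / n) + 2 * specNorm (B ^ l - colLimit πB) ^ 2 := by
    intro l
    have e : Matrix.vecMul πA (B ^ l) = fun i => cConst πA πB * (n : ℝ)⁻¹
        + Matrix.vecMul πA (B ^ l - colLimit πB) i := by
      rw [Matrix.vecMul_sub, ExpDecay.vecMul_colLimit _ _ hn]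
      ext i; simp
    have h2 := sum_vecMul_sq_le (B ^ l - colLimit πB) πA
    have h3 : ∑ _i : Fin n, (cConst πA πB * (n : ℝ)⁻¹) ^ 2 = cConst πA πB ^ 2 / n := by
      simp; field_simp
    have h4 := mul_le_mul_of_nonneg_left hE.sum_sq_A_le
      (sq_nonneg (specNorm (B ^ l - colLimit πB)))
    calc ∑ i, (Matrix.vecMul πA (B ^ l)) i ^ 2
        ≤ ∑ i, (2 * (cConst πA πB * (n : ℝ)⁻¹) ^ 2
          + 2 * Matrix.vecMul πA (B ^ l - colLimit πB) i ^ 2) := by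
          rw [e]
          exact Finset.sum_le_sum fun i _ => add_sq_le.trans_eq (by ring)
      _ = 2 * (cConst πA πB ^ 2 / n)
          + 2 * ∑ i, Matrix.vecMul πA (B ^ l - colLimit πB) i ^ 2 := by
          rw [Finset.sum_add_distrib, ← Finset.mul_sum, ← Finset.mul_sum, h3]
      _ ≤ _ := by linarith
  refine (Finset.sum_le_sum fun j _ => h1 _).trans ?_
  rw [Finset.sum_add_distrib, Finset.sum_const, ← Finset.mul_sum]
  have h5 := hE.decay_B.sum_sq_comp_le (Finset.Ico s (s + r)) (f := fun j => s + r - 1 - j)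
    (fun a ha b hb hab => by
      simp only [Finset.coe_Ico, Set.mem_Ico] at ha hb hab
      omega)
  simp only [Nat.card_Ico, nsmul_eq_mul, add_tsub_cancel_left]
  linarith

/-- The coefficients of noise drawn before the last `r` steps are summable, uniformly in `r`. -/
theorem sum_coef_old_le (hE : ExpDecay A B πA πB) (s r : ℕ) :
    ∑ j ∈ Finset.range s, ∑ i, (Matrix.vecMul πA (B ^ (s + r - 1 - j) - B ^ (s - 1 - j))) i ^ 2
      ≤ 4 * mixSum B (colLimit πB) := by
  have h1 : ∀ k l, ∑ i, (Matrix.vecMul πA (B ^ k - B ^ l)) i ^ 2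
      ≤ 2 * specNorm (B ^ k - colLimit πB) ^ 2 + 2 * specNorm (B ^ l - colLimit πB) ^ 2 := by
    intro k l
    have h2 := sum_vecMul_sq_le (B ^ k - B ^ l) πA
    have h4 := mul_le_mul_of_nonneg_left hE.sum_sq_A_le (sq_nonneg (specNorm (B ^ k - B ^ l)))
    have h5 := specNorm_pow_sub_pow_sq_le B (colLimit πB) k l
    linarith
  refine (Finset.sum_le_sum fun j _ => h1 _ _).trans ?_
  rw [Finset.sum_add_distrib, ← Finset.mul_sum, ← Finset.mul_sum]
  have h5 := hE.decay_B.sum_sq_comp_le (Finset.range s) (f := fun j => s + r - 1 - j)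
    (fun a ha b hb hab => by
      simp only [Finset.coe_range, Set.mem_Iio] at ha hb hab
      omega)
  have h6 := hE.decay_B.sum_sq_comp_le (Finset.range s) (f := fun j => s - 1 - j)
    (fun a ha b hb hab => by
      simp only [Finset.coe_range, Set.mem_Iio] at ha hb hab
      omega)
  linarith

/-- The contribution to `π_Aᵀ ∑_{s ≤ u < s + r} y⁽ᵘ⁾` of the noise drawn at the times
`s ≤ j < s + r`. -/
noncomputable def freshNoise (B : Matrix (Fin n) (Fin n) ℝ) (πA : Fin n → ℝ)
    (ε : ℕ → NodeVec n H) (s r : ℕ) : H :=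
  ∑ j ∈ Finset.Ico s (s + r), pair (Matrix.vecMul πA (B ^ (s + r - 1 - j))) (ε j)

/-- The contribution to `π_Aᵀ ∑_{s ≤ u < s + r} y⁽ᵘ⁾` of the noise drawn before time `s`. The
powers of `B` telescope, so only a difference of two powers is left. -/
noncomputable def staleNoise (B : Matrix (Fin n) (Fin n) ℝ) (πA : Fin n → ℝ)
    (ε : ℕ → NodeVec n H) (s r : ℕ) : H :=
  ∑ j ∈ Finset.range s, pair (Matrix.vecMul πA (B ^ (s + r - 1 - j) - B ^ (s - 1 - j))) (ε j)

theorem pair_conv_pow_sub (B : Matrix (Fin n) (Fin n) ℝ) (πA : Fin n → ℝ)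
    (ε : ℕ → NodeVec n H) (s r : ℕ) :
    pair πA (conv (fun i => B ^ i) ε (s + r)) - pair πA (conv (fun i => B ^ i) ε s)
      = freshNoise B πA ε s r + staleNoise B πA ε s r := by
  have hsub : ∀ (u v : Fin n → ℝ) (w : NodeVec n H), pair (u - v) w = pair u w - pair v w := by
    intro u v w
    simp [pair_apply, sub_smul]
  rw [pair_conv_eq, pair_conv_eq, freshNoise, staleNoise,
    ← Finset.sum_range_add_sum_Ico _ (Nat.le_add_right s r)]
  simp_rw [Matrix.vecMul_sub, hsub, Finset.sum_sub_distrib]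
  abel

variable {ε : ℕ → NodeVec n H} {σ : ℝ}

theorem norm_freshNoise_sq_le (hn : 2 ≤ n) (hE : ExpDecay A B πA πB)
    (orth : ∀ s t i j, (s, i) ≠ (t, j) → inner ℝ (ε s i) (ε t j) = 0)
    (hσ : ∀ s i, ‖ε s i‖ ^ 2 ≤ σ ^ 2) (s r : ℕ) :
    ‖freshNoise B πA ε s r‖ ^ 2
      ≤ σ ^ 2 * (2 * (r * (cConst πA πB ^ 2 / n)) + 2 * mixSum B (colLimit πB)) :=
  (norm_sum_pair_sq_le orth hσ _ _).trans
    (mul_le_mul_of_nonneg_left (sum_coef_new_le hn hE s r) (sq_nonneg σ))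

theorem norm_staleNoise_sq_le (hE : ExpDecay A B πA πB)
    (orth : ∀ s t i j, (s, i) ≠ (t, j) → inner ℝ (ε s i) (ε t j) = 0)
    (hσ : ∀ s i, ‖ε s i‖ ^ 2 ≤ σ ^ 2) (s r : ℕ) :
    ‖staleNoise B πA ε s r‖ ^ 2 ≤ σ ^ 2 * (4 * mixSum B (colLimit πB)) :=
  (norm_sum_pair_sq_le orth hσ _ _).trans
    (mul_le_mul_of_nonneg_left (sum_coef_old_le hE s r) (sq_nonneg σ))

theorem norm_noise_sq_le (hn : 2 ≤ n) (hE : ExpDecay A B πA πB)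
    (orth : ∀ s t i j, (s, i) ≠ (t, j) → inner ℝ (ε s i) (ε t j) = 0)
    (hσ : ∀ s i, ‖ε s i‖ ^ 2 ≤ σ ^ 2) (s r : ℕ) :
    ‖freshNoise B πA ε s r + staleNoise B πA ε s r‖ ^ 2
      ≤ σ ^ 2 * (2 * (r * (cConst πA πB ^ 2 / n)) + 6 * mixSum B (colLimit πB)) := by
  -- one orthogonal sum over all noise times, with the two kinds of coefficients glued together
  have e : freshNoise B πA ε s r + staleNoise B πA ε s r = ∑ j ∈ Finset.range (s + r),
      pair (if j < s then Matrix.vecMul πA (B ^ (s + r - 1 - j) - B ^ (s - 1 - j))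
        else Matrix.vecMul πA (B ^ (s + r - 1 - j))) (ε j) := by
    rw [← Finset.sum_range_add_sum_Ico _ (Nat.le_add_right s r), add_comm, freshNoise, staleNoise]
    congr 1
    · exact Finset.sum_congr rfl fun j hj => by rw [if_pos (Finset.mem_range.mp hj)]
    · exact Finset.sum_congr rfl fun j hj => by
        rw [if_neg (not_lt.mpr (Finset.mem_Ico.mp hj).1)]
  rw [e]
  refine (norm_sum_pair_sq_le orth hσ _ _).trans
    (mul_le_mul_of_nonneg_left ?_ (sq_nonneg σ))
  rw [← Finset.sum_range_add_sum_Ico _ (Nat.le_add_right s r)]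
  have h1 := sum_coef_new_le hn hE s r
  have h2 := sum_coef_old_le hE s r
  rw [Finset.sum_congr rfl fun j hj => by rw [if_pos (Finset.mem_range.mp hj)],
    Finset.sum_congr (s₁ := Finset.Ico s (s + r)) rfl fun j hj => by
      rw [if_neg (not_lt.mpr (Finset.mem_Ico.mp hj).1)]]
  linarith

/-- The mean square of the noise in the trackers is bounded uniformly in time. -/
theorem norm_tracker_noise_sq_le (hn : 2 ≤ n) (hE : ExpDecay A B πA πB)
    (orth : ∀ s t i j, (s, i) ≠ (t, j) → inner ℝ (ε s i) (ε t j) = 0)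
    (hσ : ∀ s i, ‖ε s i‖ ^ 2 ≤ σ ^ 2) (s : ℕ) :
    ‖conv (fun i => B ^ i) ε (s + 1) - conv (fun i => B ^ i) ε s‖ ^ 2
      ≤ σ ^ 2 * (5 * n * mixSum B (colLimit πB)) := by
  set D : ℕ → Matrix (Fin n) (Fin n) ℝ := fun k => if k = 0 then 1 else B ^ k - B ^ (k - 1)
    with hD
  have e : conv (fun i => B ^ i) ε (s + 1) - conv (fun i => B ^ i) ε s = conv D ε (s + 1) := by
    unfold conv
    rw [Finset.sum_range_succ', Finset.sum_range_succ' (fun i => D i • ε (s + 1 - 1 - i))]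
    have h1 : ∀ i, D (i + 1) • ε (s + 1 - 1 - (i + 1))
        = B ^ (i + 1) • ε (s + 1 - 1 - (i + 1)) - B ^ i • ε (s - 1 - i) := by
      intro i
      rw [show s + 1 - 1 - (i + 1) = s - 1 - i by omega]
      simp [hD, sub_smul]
    simp_rw [h1, Finset.sum_sub_distrib]
    simp [hD]
    abel
  have hrow : ∀ (M : Matrix (Fin n) (Fin n) ℝ) (i : Fin n), ∑ l, (M i l) ^ 2
      = ∑ l, (Matrix.vecMul (Pi.single i 1) M) l ^ 2 := fun M i => by
    simp
  have happ : ∀ (w : NodeVec n H) (i : Fin n), w i = pair (Pi.single i 1) w := fun w i => by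
    simp [pair_apply, Pi.single_apply]
  rw [e, PiLp.norm_sq_eq_of_L2]
  calc ∑ i, ‖conv D ε (s + 1) i‖ ^ 2
      ≤ ∑ i, σ ^ 2 * ∑ j ∈ Finset.range (s + 1), ∑ l, D (s + 1 - 1 - j) i l ^ 2 := by
        refine Finset.sum_le_sum fun i _ => ?_
        rw [happ, pair_conv_eq]
        simp_rw [hrow]
        exact norm_sum_pair_sq_le orth hσ _ _
    _ = σ ^ 2 * ∑ k ∈ Finset.range (s + 1), ∑ i, ∑ l, D k i l ^ 2 := by
        rw [← Finset.mul_sum, Finset.sum_comm,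
          Finset.sum_range_reflect (fun k => ∑ i, ∑ l, D k i l ^ 2) (s + 1)]
    _ ≤ σ ^ 2 * (n * (1 + 4 * mixSum B (colLimit πB))) := by
        refine mul_le_mul_of_nonneg_left ?_ (sq_nonneg σ)
        have h1 : ∑ k ∈ Finset.range (s + 1), ∑ i, ∑ l, D k i l ^ 2
            ≤ ∑ k ∈ Finset.range (s + 1), n * specNorm (D k) ^ 2 :=
          Finset.sum_le_sum fun k _ => sum_sq_le_specNorm _
        refine h1.trans ?_
        rw [← Finset.mul_sum]
        refine mul_le_mul_of_nonneg_left ?_ (Nat.cast_nonneg n)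
        rw [Finset.sum_range_succ']
        have h2 : ∑ k ∈ Finset.range s, specNorm (D (k + 1)) ^ 2
            ≤ ∑ k ∈ Finset.range s, (2 * specNorm (B ^ (k + 1) - colLimit πB) ^ 2
              + 2 * specNorm (B ^ k - colLimit πB) ^ 2) :=
          Finset.sum_le_sum fun k _ => by
            simpa [hD] using specNorm_pow_sub_pow_sq_le B (colLimit πB) (k + 1) k
        rw [Finset.sum_add_distrib, ← Finset.mul_sum, ← Finset.mul_sum] at h2
        have h3 := hE.decay_B.sum_sq_le (Finset.range s)
        have h4 := hE.decay_B.sum_sq_comp_le (Finset.range s) (f := fun k => k + 1)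
          (fun a _ b _ hab => by simpa using hab)
        have h5 : specNorm (D 0) ^ 2 ≤ 1 := by
          have := specNorm_one_le (n := n)
          have h0 := specNorm_nonneg (1 : Matrix (Fin n) (Fin n) ℝ)
          simp only [hD, if_true]
          nlinarith
        linarith
    _ ≤ _ := by
        have hB := hE.one_le_mixSum_B hn one_pos
        rw [pow_one] at hB
        refine mul_le_mul_of_nonneg_left ?_ (sq_nonneg σ)
        nlinarith [Nat.cast_nonneg (α := ℝ) n]

end NoiseBounds

end System

/-! ### Square sums over blocks -/

section L2

/-- The `ℓ²` norm of the first `K` terms of a real sequence. -/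
noncomputable def l2 (K : ℕ) (f : ℕ → ℝ) : ℝ := Real.sqrt (∑ k ∈ Finset.range K, f k ^ 2)

variable {K : ℕ} {f g : ℕ → ℝ}

theorem l2_nonneg : 0 ≤ l2 K f := Real.sqrt_nonneg _

theorem l2_sq : l2 K f ^ 2 = ∑ k ∈ Finset.range K, f k ^ 2 :=
  Real.sq_sqrt (Finset.sum_nonneg fun _ _ => sq_nonneg _)

theorem l2_eq_norm : l2 K f = ‖(WithLp.toLp 2 fun k : Fin K => f k : EuclideanSpace ℝ (Fin K))‖ := by
  rw [EuclideanSpace.norm_eq, l2, Finset.sum_range]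
  simp

theorem l2_add_le : l2 K (fun k => f k + g k) ≤ l2 K f + l2 K g := by
  simp only [l2_eq_norm]
  exact norm_add_le (WithLp.toLp 2 fun k : Fin K => f k : EuclideanSpace ℝ (Fin K))
    (WithLp.toLp 2 fun k : Fin K => g k)

theorem l2_mono (h0 : ∀ k < K, 0 ≤ f k) (h : ∀ k < K, f k ≤ g k) : l2 K f ≤ l2 K g :=
  Real.sqrt_le_sqrt (Finset.sum_le_sum fun k hk =>
    pow_le_pow_left₀ (h0 k (Finset.mem_range.mp hk)) (h k (Finset.mem_range.mp hk)) 2)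

theorem l2_const_mul {a : ℝ} (ha : 0 ≤ a) : l2 K (fun k => a * f k) = a * l2 K f := by
  simp only [l2, mul_pow, ← Finset.mul_sum]
  rw [Real.sqrt_mul (sq_nonneg a), Real.sqrt_sq ha]

theorem l2_const {a : ℝ} (ha : 0 ≤ a) : l2 K (fun _ => a) = Real.sqrt K * a := by
  simp [l2, Real.sqrt_sq ha]

theorem l2_le_of_sum_sq_le {a : ℝ} (ha : 0 ≤ a) (h : ∑ k ∈ Finset.range K, f k ^ 2 ≤ a ^ 2) :
    l2 K f ≤ a := (Real.sqrt_le_sqrt h).trans_eq (Real.sqrt_sq ha)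

/-- The sequence delayed by one step, starting with zero. -/
def delay (f : ℕ → ℝ) : ℕ → ℝ
  | 0 => 0
  | k + 1 => f k

theorem l2_delay_le : l2 K (delay f) ≤ l2 K f := by
  refine Real.sqrt_le_sqrt ?_
  cases K with
  | zero => simp
  | succ K =>
    rw [Finset.sum_range_succ', Finset.sum_range_succ]
    simp [delay, sq_nonneg]

theorem l2_le_sum (h : ∀ k, 0 ≤ f k) : l2 K f ≤ ∑ k ∈ Finset.range K, f k := by
  refine l2_le_of_sum_sq_le (Finset.sum_nonneg fun k _ => h k) ?_
  rw [sq, Finset.sum_mul]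
  refine Finset.sum_le_sum fun k hk => ?_
  rw [sq]
  exact mul_le_mul_of_nonneg_left (Finset.single_le_sum (fun k _ => h k) hk) (h k)

/-- For a fixed lag `i`, every block `l` is hit by at most two of the times `m k + r k - 1 - i`. -/
theorem sum_lag_le {m : ℕ} (hm : 0 < m) {ψ : ℕ → ℝ} (hψ : ∀ l, 0 ≤ ψ l) {r : ℕ → ℕ}
    (hr : ∀ k, r k ≤ m) (i : ℕ) :
    ∑ k ∈ (Finset.range K).filter (fun k => i < m * k + r k), ψ ((m * k + r k - 1 - i) / m)
      ≤ 2 * ∑ l ∈ Finset.range K, ψ l := by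
  rw [← Finset.sum_fiberwise_of_maps_to (t := Finset.range K)
    (g := fun k => (m * k + r k - 1 - i) / m), Finset.mul_sum]
  · refine Finset.sum_le_sum fun l _ => ?_
    rw [Finset.sum_congr rfl fun k hk => by rw [(Finset.mem_filter.mp hk).2], Finset.sum_const,
      nsmul_eq_mul]
    refine mul_le_mul_of_nonneg_right ?_ (hψ l)
    have hsub : ((Finset.range K).filter (fun k => i < m * k + r k)).filter
        (fun k => (m * k + r k - 1 - i) / m = l) ⊆ {l + i / m, l + i / m + 1} := by
      intro k hk
      simp only [Finset.mem_filter, Finset.mem_insert, Finset.mem_singleton] at hk ⊢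
      obtain ⟨⟨-, h1⟩, h2⟩ := hk
      have h3 := Nat.div_add_mod (m * k + r k - 1 - i) m
      have h4 := Nat.mod_lt (m * k + r k - 1 - i) hm
      have h5 := Nat.div_add_mod i m
      have h6 := Nat.mod_lt i hm
      have h7 := hr k
      rw [h2] at h3
      have a1 : m * (l + i / m) < m * (k + 1) := by
        rw [mul_add, mul_add]; omega
      have a2 : m * k < m * (l + i / m + 2) := by
        rw [mul_add, mul_add]; omega
      have b1 := Nat.lt_of_mul_lt_mul_left a1
      have b2 := Nat.lt_of_mul_lt_mul_left a2
      omega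
    have := (Finset.card_le_card hsub).trans Finset.card_le_two
    exact_mod_cast this
  · intro k hk
    simp only [Finset.mem_filter, Finset.mem_range] at hk ⊢
    rw [Nat.div_lt_iff_lt_mul hm]
    have h7 := hr k
    have : m * (k + 1) ≤ m * K := Nat.mul_le_mul_left m hk.1
    rw [mul_add] at this
    rw [mul_comm K]
    omega

/-- Young's inequality for a convolution that is read off at one time `m k + r k` of each block and
sees its second factor only through the block index. -/
theorem l2_conv_le {m : ℕ} (hm : 0 < m) {w φ : ℕ → ℝ} {s : ℝ} (hw : ∀ i, 0 ≤ w i)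
    (hs : ∀ t, ∑ i ∈ Finset.range t, w i ≤ s) {r : ℕ → ℕ} (hr : ∀ k, r k ≤ m) :
    l2 K (fun k => ∑ i ∈ Finset.range (m * k + r k), w i * φ ((m * k + r k - 1 - i) / m))
      ≤ Real.sqrt 2 * s * l2 K φ := by
  have hs0 : 0 ≤ s := by simpa using hs 0
  refine l2_le_of_sum_sq_le (mul_nonneg (mul_nonneg (Real.sqrt_nonneg 2) hs0) l2_nonneg) ?_
  have hcs : ∀ k, (∑ i ∈ Finset.range (m * k + r k), w i * φ ((m * k + r k - 1 - i) / m)) ^ 2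
      ≤ s * ∑ i ∈ Finset.range (m * k + r k), w i * φ ((m * k + r k - 1 - i) / m) ^ 2 := by
    intro k
    refine (Finset.sum_sq_le_sum_mul_sum_of_sq_le_mul _ (f := w)
      (g := fun i => w i * φ ((m * k + r k - 1 - i) / m) ^ 2) (fun i _ => hw i)
      (fun i _ => mul_nonneg (hw i) (sq_nonneg _)) (fun i _ => le_of_eq (by ring))).trans ?_
    exact mul_le_mul_of_nonneg_right (hs _)
      (Finset.sum_nonneg fun i _ => mul_nonneg (hw i) (sq_nonneg _))
  have hle : ∀ k ∈ Finset.range K, m * k + r k ≤ m * K := by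
    intro k hk
    have : m * (k + 1) ≤ m * K := Nat.mul_le_mul_left m (Finset.mem_range.mp hk)
    rw [mul_add] at this
    have := hr k
    omega
  have hswap : ∑ k ∈ Finset.range K, ∑ i ∈ Finset.range (m * k + r k),
        w i * φ ((m * k + r k - 1 - i) / m) ^ 2
      = ∑ i ∈ Finset.range (m * K), w i * ∑ k ∈ (Finset.range K).filter
          (fun k => i < m * k + r k), φ ((m * k + r k - 1 - i) / m) ^ 2 := by
    simp_rw [Finset.mul_sum]
    refine Finset.sum_comm' fun k i => ?_
    simp only [Finset.mem_range, Finset.mem_filter]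
    constructor
    · rintro ⟨h1, h2⟩
      exact ⟨⟨h1, h2⟩, h2.trans_le (hle k (Finset.mem_range.mpr h1))⟩
    · rintro ⟨h1, -⟩
      exact h1
  calc ∑ k ∈ Finset.range K,
        (∑ i ∈ Finset.range (m * k + r k), w i * φ ((m * k + r k - 1 - i) / m)) ^ 2
      ≤ ∑ k ∈ Finset.range K, s * ∑ i ∈ Finset.range (m * k + r k),
          w i * φ ((m * k + r k - 1 - i) / m) ^ 2 := Finset.sum_le_sum fun k _ => hcs k
    _ = s * ∑ i ∈ Finset.range (m * K), w i * ∑ k ∈ (Finset.range K).filter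
          (fun k => i < m * k + r k), φ ((m * k + r k - 1 - i) / m) ^ 2 := by
        rw [← Finset.mul_sum, hswap]
    _ ≤ s * ∑ i ∈ Finset.range (m * K), w i * (2 * l2 K φ ^ 2) := by
        refine mul_le_mul_of_nonneg_left (Finset.sum_le_sum fun i _ =>
          mul_le_mul_of_nonneg_left ?_ (hw i)) hs0
        rw [l2_sq]
        exact sum_lag_le hm (ψ := fun l => φ l ^ 2) (fun l => sq_nonneg _) hr i
    _ ≤ s * (s * (2 * l2 K φ ^ 2)) := by
        rw [← Finset.sum_mul]
        exact mul_le_mul_of_nonneg_left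
          (mul_le_mul_of_nonneg_right (hs _) (by positivity)) hs0
    _ = (Real.sqrt 2 * s * l2 K φ) ^ 2 := by
        rw [mul_pow, mul_pow, Real.sq_sqrt (by norm_num)]; ring

/-- Disjoint blocks of a summable sequence. -/
theorem l2_block_le {m : ℕ} {w : ℕ → ℝ} {s : ℝ} (hw : ∀ i, 0 ≤ w i)
    (hs : ∀ t, ∑ i ∈ Finset.range t, w i ≤ s) :
    l2 K (fun k => ∑ i ∈ Finset.Ico (m * k) (m * k + m), w i) ≤ s := by
  refine (l2_le_sum fun k => Finset.sum_nonneg fun i _ => hw i).trans ?_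
  refine le_trans (le_of_eq ?_) (hs (m * K))
  induction K with
  | zero => simp
  | succ K ih =>
    rw [Finset.sum_range_succ, ih, Nat.mul_succ,
      Finset.sum_range_add_sum_Ico _ (Nat.le_add_right _ _)]

/-- Cauchy products of nonnegative sequences. -/
theorem sum_antidiagonal_le {a b : ℕ → ℝ} {sa sb : ℝ} (ha : ∀ i, 0 ≤ a i)
    (hsa : ∀ t, ∑ i ∈ Finset.range t, a i ≤ sa) (hsb : ∀ t, ∑ i ∈ Finset.range t, b i ≤ sb)
    (t : ℕ) :
    ∑ j ∈ Finset.range t, ∑ i ∈ Finset.range (j + 1), a i * b (j - i) ≤ sa * sb := by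
  rw [Finset.sum_range_diag_flip t fun i l => a i * b l]
  have hsb0 : 0 ≤ sb := by simpa using hsb 0
  calc ∑ i ∈ Finset.range t, ∑ l ∈ Finset.range (t - i), a i * b l
      ≤ ∑ i ∈ Finset.range t, a i * sb := by
        refine Finset.sum_le_sum fun i _ => ?_
        rw [← Finset.mul_sum]
        exact mul_le_mul_of_nonneg_left (hsb _) (ha i)
    _ ≤ sa * sb := by
        rw [← Finset.sum_mul]
        exact mul_le_mul_of_nonneg_right (hsa t) hsb0

end L2

/-! ### Errors over a block -/

section Blocks

variable {n : ℕ} {H : Type*} [NormedAddCommGroup H] [InnerProductSpace ℝ H]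

/-- The largest displacement of `x̂` from the start of block `k` within that block. -/
noncomputable def drift (πA : Fin n → ℝ) (x : ℕ → NodeVec n H) (m k : ℕ) : ℝ :=
  (Finset.range (m + 1)).sup' ⟨0, by simp⟩ fun r => ‖pair πA (x (m * k + r) - x (m * k))‖

/-- The largest consensus error within block `k`. -/
noncomputable def consensus (πA : Fin n → ℝ) (x : ℕ → NodeVec n H) (m k : ℕ) : ℝ :=
  (Finset.range (m + 1)).sup' ⟨0, by simp⟩ fun r =>
    ‖x (m * k + r) - const n (pair πA (x (m * k + r)))‖

/-- A bound on the distance of the nodes in block `k` from `x̂` at the start of the block. -/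
noncomputable def spread (πA : Fin n → ℝ) (x : ℕ → NodeVec n H) (m k : ℕ) : ℝ :=
  consensus πA x m k + Real.sqrt n * drift πA x m k

/-- A bound on the displacement of the nodes over at most `m` steps that end in block `k`. -/
noncomputable def jump (πA : Fin n → ℝ) (x : ℕ → NodeVec n H) (m k : ℕ) : ℝ :=
  2 * spread πA x m k + delay (spread πA x m) k + Real.sqrt n * delay (drift πA x m) k

variable (πA : Fin n → ℝ) (x : ℕ → NodeVec n H) {m : ℕ}

theorem le_drift {k r : ℕ} (hr : r ≤ m) :
    ‖pair πA (x (m * k + r) - x (m * k))‖ ≤ drift πA x m k :=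
  Finset.le_sup' (fun r => ‖pair πA (x (m * k + r) - x (m * k))‖)
    (Finset.mem_range.mpr (Nat.lt_succ_of_le hr))

theorem le_consensus {k r : ℕ} (hr : r ≤ m) :
    ‖x (m * k + r) - const n (pair πA (x (m * k + r)))‖ ≤ consensus πA x m k :=
  Finset.le_sup' (fun r => ‖x (m * k + r) - const n (pair πA (x (m * k + r)))‖)
    (Finset.mem_range.mpr (Nat.lt_succ_of_le hr))

theorem exists_drift_eq (m k : ℕ) :
    ∃ r ≤ m, drift πA x m k = ‖pair πA (x (m * k + r) - x (m * k))‖ := by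
  obtain ⟨r, hr, h⟩ := Finset.exists_mem_eq_sup' (s := Finset.range (m + 1)) ⟨0, by simp⟩
    fun r => ‖pair πA (x (m * k + r) - x (m * k))‖
  exact ⟨r, Nat.lt_succ_iff.mp (Finset.mem_range.mp hr), h⟩

theorem exists_consensus_eq (m k : ℕ) :
    ∃ r ≤ m, consensus πA x m k = ‖x (m * k + r) - const n (pair πA (x (m * k + r)))‖ := by
  obtain ⟨r, hr, h⟩ := Finset.exists_mem_eq_sup' (s := Finset.range (m + 1)) ⟨0, by simp⟩
    fun r => ‖x (m * k + r) - const n (pair πA (x (m * k + r)))‖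
  exact ⟨r, Nat.lt_succ_iff.mp (Finset.mem_range.mp hr), h⟩

theorem drift_nonneg (m k : ℕ) : 0 ≤ drift πA x m k :=
  (norm_nonneg _).trans (le_drift πA x (Nat.zero_le m))

theorem consensus_nonneg (m k : ℕ) : 0 ≤ consensus πA x m k :=
  (norm_nonneg _).trans (le_consensus πA x (Nat.zero_le m))

theorem spread_nonneg (m k : ℕ) : 0 ≤ spread πA x m k :=
  add_nonneg (consensus_nonneg πA x m k)
    (mul_nonneg (Real.sqrt_nonneg _) (drift_nonneg πA x m k))

theorem delay_nonneg {f : ℕ → ℝ} (hf : ∀ k, 0 ≤ f k) (k : ℕ) : 0 ≤ delay f k := by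
  cases k with
  | zero => exact le_rfl
  | succ k => exact hf k

theorem norm_sub_const_le_spread {k r : ℕ} (hr : r ≤ m) :
    ‖x (m * k + r) - const n (pair πA (x (m * k)))‖ ≤ spread πA x m k := by
  have e : x (m * k + r) - const n (pair πA (x (m * k)))
      = (x (m * k + r) - const n (pair πA (x (m * k + r))))
        + const n (pair πA (x (m * k + r) - x (m * k))) := by
    rw [map_sub, map_sub]; abel
  rw [e]
  refine (norm_add_le _ _).trans (add_le_add (le_consensus πA x hr) ?_)
  rw [norm_const]
  exact mul_le_mul_of_nonneg_left (le_drift πA x hr) (Real.sqrt_nonneg _)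

theorem norm_sub_le_jump (hm : 0 < m) {s u : ℕ} (h1 : u ≤ s) (h2 : s ≤ u + m) :
    ‖x s - x u‖ ≤ jump πA x m (s / m) := by
  have hs := Nat.div_add_mod s m
  have hu := Nat.div_add_mod u m
  have hs' := (Nat.mod_lt s hm).le
  have hu' := (Nat.mod_lt u hm).le
  have b1 := norm_sub_const_le_spread πA x (k := s / m) hs'
  have b2 := norm_sub_const_le_spread πA x (k := u / m) hu'
  rw [hs] at b1
  rw [hu] at b2
  have hle : u / m ≤ s / m := Nat.div_le_div_right h1
  have hge : s / m ≤ u / m + 1 := by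
    rw [← Nat.add_div_right u hm]; exact Nat.div_le_div_right h2
  have p1 := delay_nonneg (spread_nonneg πA x m) (s / m)
  have p2 := mul_nonneg (Real.sqrt_nonneg n) (delay_nonneg (drift_nonneg πA x m) (s / m))
  have p3 := spread_nonneg πA x m (s / m)
  rcases Nat.lt_or_ge (u / m) (s / m) with hlt | hge'
  · have hk : s / m = u / m + 1 := by omega
    have b3 := le_drift πA x (m := m) (k := u / m) le_rfl
    have e : x s - x u = (x s - const n (pair πA (x (m * (s / m)))))
        - (x u - const n (pair πA (x (m * (u / m)))))
        + const n (pair πA (x (m * (u / m) + m) - x (m * (u / m)))) := by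
      rw [map_sub, map_sub, hk, Nat.mul_succ]; abel
    have : ‖x s - x u‖ ≤ spread πA x m (s / m) + spread πA x m (u / m)
        + Real.sqrt n * drift πA x m (u / m) := by
      rw [e]
      refine (norm_add_le _ _).trans (add_le_add ((norm_sub_le _ _).trans (add_le_add b1 b2)) ?_)
      rw [norm_const]
      exact mul_le_mul_of_nonneg_left b3 (Real.sqrt_nonneg _)
    have d1 : delay (spread πA x m) (s / m) = spread πA x m (u / m) := by rw [hk]; rfl
    have d2 : delay (drift πA x m) (s / m) = drift πA x m (u / m) := by rw [hk]; rfl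
    unfold jump
    rw [d1, d2]
    linarith
  · have hk : u / m = s / m := le_antisymm hle hge'
    rw [hk] at b2
    have e : x s - x u = (x s - const n (pair πA (x (m * (s / m)))))
        - (x u - const n (pair πA (x (m * (s / m))))) := by abel
    have : ‖x s - x u‖ ≤ spread πA x m (s / m) + spread πA x m (s / m) := by
      rw [e]
      exact (norm_sub_le _ _).trans (add_le_add b1 b2)
    unfold jump
    linarith

theorem l2_spread_le (K : ℕ) : l2 K (spread πA x m)
    ≤ l2 K (consensus πA x m) + Real.sqrt n * l2 K (drift πA x m) := by
  rw [← l2_const_mul (Real.sqrt_nonneg _)]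
  exact l2_add_le

theorem l2_jump_le (K : ℕ) : l2 K (jump πA x m)
    ≤ 3 * l2 K (spread πA x m) + Real.sqrt n * l2 K (drift πA x m) := by
  have h1 : l2 K (jump πA x m) ≤ l2 K (fun k => 2 * spread πA x m k + delay (spread πA x m) k)
      + l2 K (fun k => Real.sqrt n * delay (drift πA x m) k) := l2_add_le
  have h2 : l2 K (fun k => 2 * spread πA x m k + delay (spread πA x m) k)
      ≤ l2 K (fun k => 2 * spread πA x m k) + l2 K (delay (spread πA x m)) := l2_add_le
  rw [l2_const_mul (Real.sqrt_nonneg _)] at h1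
  rw [l2_const_mul (by norm_num)] at h2
  have h3 := l2_delay_le (K := K) (f := spread πA x m)
  have h4 := mul_le_mul_of_nonneg_left (l2_delay_le (K := K) (f := drift πA x m))
    (Real.sqrt_nonneg n)
  linarith

end Blocks

namespace System

variable {n : ℕ} {H : Type*} [NormedAddCommGroup H] [InnerProductSpace ℝ H]
  {A B : Matrix (Fin n) (Fin n) ℝ} {πA πB : Fin n → ℝ} {α L Δ σ : ℝ} {x0 : H}
  {x y h ε : ℕ → NodeVec n H} {Gr : ℕ → H} {F : ℕ → ℝ} {m : ℕ}

theorem norm_mean_sub_le (S : System A B πA α L Δ σ x0 x y h ε Gr F) (hL : 0 ≤ L)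
    {k r : ℕ} (hr : r ≤ m) :
    ‖mean (h (m * k + r)) - Gr (m * k)‖ ≤ L * (Real.sqrt n)⁻¹ * spread πA x m k :=
  (S.grad_mean _ _).trans (mul_le_mul_of_nonneg_left (norm_sub_const_le_spread πA x hr)
    (by positivity))

theorem norm_mean_le (S : System A B πA α L Δ σ x0 x y h ε Gr F) (hL : 0 ≤ L) (hm : 0 < m)
    (s : ℕ) : ‖mean (h s)‖
      ≤ ‖Gr (m * (s / m))‖ + L * (Real.sqrt n)⁻¹ * spread πA x m (s / m) := by
  have h1 := S.norm_mean_sub_le hL (k := s / m) (Nat.mod_lt s hm).le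
  rw [Nat.div_add_mod] at h1
  have h2 := norm_add_le (Gr (m * (s / m))) (mean (h s) - Gr (m * (s / m)))
  rw [add_sub_cancel] at h2
  linarith

/-- The deviation part of the cumulated trackers moves over `r ≤ m` steps by a convolution of the
block displacements, and by a transient from the initial gradients. -/
theorem norm_conv_deviation_sub_le (S : System A B πA α L Δ σ x0 x y h ε Gr F) (hL : 0 ≤ L)
    (hm : 0 < m) (M : ℕ → Matrix (Fin n) (Fin n) ℝ) {s r : ℕ} (hr : r ≤ m) :
    ‖conv M h (s + r) - conv M h s‖
      ≤ L * ∑ i ∈ Finset.range (s + r), specNorm (M i) * jump πA x m ((s + r - 1 - i) / m)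
        + (∑ i ∈ Finset.Ico s (s + r), specNorm (M i)) * ‖h 0‖ := by
  refine (norm_conv_sub_conv_le M h s r).trans (add_le_add ?_ le_rfl)
  rw [Finset.mul_sum]
  refine Finset.sum_le_sum fun i _ => ?_
  have h1 := (S.lipschitz (s + r - 1 - i) (s - 1 - i)).trans (mul_le_mul_of_nonneg_left
    (norm_sub_le_jump πA x hm (s := s + r - 1 - i) (u := s - 1 - i) (by omega) (by omega)) hL)
  calc _ ≤ specNorm (M i) * (L * jump πA x m ((s + r - 1 - i) / m)) :=
        mul_le_mul_of_nonneg_left h1 (specNorm_nonneg _)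
    _ = _ := by ring

/-- The displacement of `x̂` over `r` steps: average gradients, mixing error of the trackers, noise. -/
theorem pair_sub_eq (hn : 2 ≤ n) (hE : ExpDecay A B πA πB)
    (S : System A B πA α L Δ σ x0 x y h ε Gr F) (s r : ℕ) :
    pair πA (x (s + r) - x s) = -(α • (cConst πA πB • ∑ u ∈ Finset.Ico s (s + r), mean (h u)
      + pair πA (conv (fun i => B ^ i - colLimit πB) h (s + r)
          - conv (fun i => B ^ i - colLimit πB) h s)
      + (freshNoise B πA ε s r + staleNoise B πA ε s r))) := by
  rw [map_sub, S.pair_node_eq hE, S.pair_node_eq hE, conv_add, conv_add, map_add, map_add,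
    ← pair_conv_pow_sub, pair_conv_pow hn B πA πB h, pair_conv_pow hn B πA πB h,
    ← Finset.sum_range_add_sum_Ico _ (Nat.le_add_right s r), map_sub]
  simp only [smul_add, smul_sub]
  abel

/-- The part of `π_Aᵀ ∑ y⁽ᵘ⁾` over block `k` that is neither its main term `c m ∇f(x̂)` nor
noise drawn inside the block. -/
noncomputable def residual (B : Matrix (Fin n) (Fin n) ℝ) (πA πB : Fin n → ℝ)
    (h ε : ℕ → NodeVec n H) (Gr : ℕ → H) (m k : ℕ) : H :=
  cConst πA πB • ∑ u ∈ Finset.Ico (m * k) (m * k + m), (mean (h u) - Gr (m * k))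
    + pair πA (conv (fun i => B ^ i - colLimit πB) h (m * k + m)
        - conv (fun i => B ^ i - colLimit πB) h (m * k))
    + staleNoise B πA ε (m * k) m

theorem pair_block_eq (hn : 2 ≤ n) (hE : ExpDecay A B πA πB)
    (S : System A B πA α L Δ σ x0 x y h ε Gr F) (m k : ℕ) :
    pair πA (x (m * (k + 1)) - x (m * k)) = -(α • ((cConst πA πB * m) • Gr (m * k)
      + residual B πA πB h ε Gr m k + freshNoise B πA ε (m * k) m)) := by
  rw [Nat.mul_succ, S.pair_sub_eq hn hE, residual, Finset.sum_sub_distrib]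
  simp only [Finset.sum_const, Nat.card_Ico, add_tsub_cancel_left, smul_sub, mul_smul,
    Nat.cast_smul_eq_nsmul]
  congr 2
  abel

theorem norm_sum_mean_le (S : System A B πA α L Δ σ x0 x y h ε Gr F) (hL : 0 ≤ L) (hm : 0 < m)
    {k r : ℕ} (hr : r ≤ m) :
    ‖∑ u ∈ Finset.Ico (m * k) (m * k + r), mean (h u)‖
      ≤ m * (‖Gr (m * k)‖ + L * (Real.sqrt n)⁻¹ * spread πA x m k) := by
  have h1 : ∀ u ∈ Finset.Ico (m * k) (m * k + r), ‖mean (h u)‖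
      ≤ ‖Gr (m * k)‖ + L * (Real.sqrt n)⁻¹ * spread πA x m k := by
    intro u hu
    obtain ⟨h2, h3⟩ := Finset.mem_Ico.mp hu
    have h4 : u / m = k := by
      rw [Nat.div_eq_iff hm]
      constructor
      · rwa [mul_comm]
      · rw [mul_comm k]; omega
    simpa [h4] using S.norm_mean_le (πA := πA) (B := B) hL hm u
  refine (norm_sum_le_of_le _ h1).trans ?_
  have h0 : 0 ≤ ‖Gr (m * k)‖ + L * (Real.sqrt n)⁻¹ * spread πA x m k := by
    have := spread_nonneg πA x m k
    positivity
  simp only [Finset.sum_const, Nat.card_Ico, add_tsub_cancel_left, nsmul_eq_mul]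
  exact mul_le_mul_of_nonneg_right (by exact_mod_cast hr) h0

end System

/-! ### The coupled inequalities for drift, consensus and residual -/

namespace System

variable {n : ℕ} {H : Type*} [NormedAddCommGroup H] [InnerProductSpace ℝ H]
  {A B : Matrix (Fin n) (Fin n) ℝ} {πA πB : Fin n → ℝ} {α L Δ σ : ℝ} {x0 : H}
  {x y h ε : ℕ → NodeVec n H} {Gr : ℕ → H} {F : ℕ → ℝ} {m : ℕ}

/-- The mixing error of the trackers over a block, as seen by `x̂`. -/
theorem norm_pair_deviation_sub_le (hE : ExpDecay A B πA πB)
    (S : System A B πA α L Δ σ x0 x y h ε Gr F) (hL : 0 ≤ L) (hm : 0 < m) {k r : ℕ}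
    (hr : r ≤ m) :
    ‖pair πA (conv (fun i => B ^ i - colLimit πB) h (m * k + r)
        - conv (fun i => B ^ i - colLimit πB) h (m * k))‖
      ≤ L * ∑ i ∈ Finset.range (m * k + r),
          specNorm (B ^ i - colLimit πB) * jump πA x m ((m * k + r - 1 - i) / m)
        + ‖h 0‖ * ∑ i ∈ Finset.Ico (m * k) (m * k + m), specNorm (B ^ i - colLimit πB) := by
  refine (norm_pair_le hE.sum_sq_A_le _).trans
    ((S.norm_conv_deviation_sub_le hL hm _ hr).trans (add_le_add le_rfl ?_))
  rw [mul_comm]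
  refine mul_le_mul_of_nonneg_left (Finset.sum_le_sum_of_subset_of_nonneg ?_
    fun _ _ _ => specNorm_nonneg _) (norm_nonneg _)
  exact Finset.Ico_subset_Ico le_rfl (by omega)

/-- The displacement of `x̂` within a block, in terms of the errors of this and earlier blocks. -/
theorem norm_pair_sub_le (hn : 2 ≤ n) (hE : ExpDecay A B πA πB)
    (S : System A B πA α L Δ σ x0 x y h ε Gr F) (hα : 0 ≤ α) (hL : 0 ≤ L) (hm : 0 < m) {ν : ℝ}
    (hν : ∀ s r, r ≤ m → ‖freshNoise B πA ε s r + staleNoise B πA ε s r‖ ≤ ν) {k r : ℕ}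
    (hr : r ≤ m) :
    ‖pair πA (x (m * k + r) - x (m * k))‖ ≤ α * (cConst πA πB * m
        * (‖Gr (m * k)‖ + L * (Real.sqrt n)⁻¹ * spread πA x m k)
      + L * ∑ i ∈ Finset.range (m * k + r),
          specNorm (B ^ i - colLimit πB) * jump πA x m ((m * k + r - 1 - i) / m)
      + ‖h 0‖ * ∑ i ∈ Finset.Ico (m * k) (m * k + m), specNorm (B ^ i - colLimit πB) + ν) := by
  have hc := (hE.cConst_pos hn).le
  rw [S.pair_sub_eq hn hE, norm_neg, norm_smul, Real.norm_of_nonneg hα]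
  refine mul_le_mul_of_nonneg_left ?_ hα
  have h1 := S.norm_sum_mean_le (πA := πA) hL hm (k := k) hr
  have h2 := S.norm_pair_deviation_sub_le hE hL hm (k := k) hr
  have h3 := mul_le_mul_of_nonneg_left h1 hc
  refine (norm_add₃_le).trans ?_
  rw [norm_smul, Real.norm_of_nonneg hc]
  linarith [hν (m * k) r hr]

/-- The residual has the bound of the displacement without the gradient at the start of the block. -/
theorem norm_residual_le (hn : 2 ≤ n) (hE : ExpDecay A B πA πB)
    (S : System A B πA α L Δ σ x0 x y h ε Gr F) (hL : 0 ≤ L) (hm : 0 < m) {ν : ℝ}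
    (hν : ∀ s, ‖staleNoise B πA ε s m‖ ≤ ν) (k : ℕ) :
    ‖residual B πA πB h ε Gr m k‖ ≤ cConst πA πB * m
        * (L * (Real.sqrt n)⁻¹ * spread πA x m k)
      + L * ∑ i ∈ Finset.range (m * k + m),
          specNorm (B ^ i - colLimit πB) * jump πA x m ((m * k + m - 1 - i) / m)
      + ‖h 0‖ * ∑ i ∈ Finset.Ico (m * k) (m * k + m), specNorm (B ^ i - colLimit πB) + ν := by
  have hc := (hE.cConst_pos hn).le
  have h1 : ‖∑ u ∈ Finset.Ico (m * k) (m * k + m), (mean (h u) - Gr (m * k))‖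
      ≤ m * (L * (Real.sqrt n)⁻¹ * spread πA x m k) := by
    refine (norm_sum_le_of_le (f := fun u => mean (h u) - Gr (m * k))
      (Finset.Ico (m * k) (m * k + m))
      (n := fun _ => L * (Real.sqrt n)⁻¹ * spread πA x m k) fun u hu => ?_).trans_eq (by simp)
    obtain ⟨h2, h3⟩ := Finset.mem_Ico.mp hu
    obtain ⟨r, rfl⟩ := Nat.exists_eq_add_of_le h2
    exact S.norm_mean_sub_le hL (by omega)
  have h2 := S.norm_pair_deviation_sub_le hE hL hm (k := k) le_rfl
  have h3 := mul_le_mul_of_nonneg_left h1 hc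
  rw [residual]
  refine (norm_add₃_le).trans ?_
  rw [norm_smul, Real.norm_of_nonneg hc]
  linarith [hν (m * k)]

/-- The size of the trackers: `n` times the average gradient, mixing error, transient and noise. -/
theorem norm_tracker_le (hn : 2 ≤ n) (hE : ExpDecay A B πA πB)
    (S : System A B πA α L Δ σ x0 x y h ε Gr F) (hL : 0 ≤ L) (hm : 0 < m) {ν : ℝ}
    (hν : ∀ s, ‖conv (fun i => B ^ i) ε (s + 1) - conv (fun i => B ^ i) ε s‖ ≤ ν) (s : ℕ) :
    ‖y s‖ ≤ n * (‖Gr (m * (s / m))‖ + L * (Real.sqrt n)⁻¹ * spread πA x m (s / m))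
      + L * ∑ i ∈ Finset.range (s + 1),
          specNorm (B ^ i - colLimit πB) * jump πA x m ((s - i) / m)
      + specNorm (B ^ s - colLimit πB) * ‖h 0‖ + ν := by
  have h1 : ∀ t, conv (fun i => B ^ i) h t = ∑ u ∈ Finset.range t, colLimit πB • h u
      + conv (fun i => B ^ i - colLimit πB) h t := by
    intro t
    rw [← Finset.sum_range_reflect]
    simp only [conv, sub_smul, ← Finset.sum_add_distrib]
    exact Finset.sum_congr rfl fun i _ => by abel
  have e : y s = colLimit πB • h s
      + (conv (fun i => B ^ i - colLimit πB) h (s + 1)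
        - conv (fun i => B ^ i - colLimit πB) h s)
      + (conv (fun i => B ^ i) ε (s + 1) - conv (fun i => B ^ i) ε s) := by
    rw [S.tracker_eq, conv_add, conv_add, h1, h1, Finset.sum_range_succ]
    abel
  have h2 := S.norm_conv_deviation_sub_le (πA := πA) hL hm
    (fun i => B ^ i - colLimit πB) (s := s) (r := 1) hm
  simp only [Nat.add_sub_cancel, Nat.Ico_succ_singleton, Finset.sum_singleton] at h2
  have h3 := (norm_colLimit_smul_le hE.sum_sq_B_le hn (h s)).trans
    (mul_le_mul_of_nonneg_left (S.norm_mean_le (πA := πA) hL hm s) (Nat.cast_nonneg n))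
  rw [e]
  refine (norm_add₃_le).trans ?_
  linarith [hν s]

/-- The consensus error. Composing the two mixing processes gives the Cauchy product of their
deviations as the kernel. -/
theorem norm_consensus_le (hn : 2 ≤ n) (hE : ExpDecay A B πA πB)
    (S : System A B πA α L Δ σ x0 x y h ε Gr F) (hα : 0 ≤ α) (hL : 0 ≤ L) (hm : 0 < m) {ν : ℝ}
    (hν : ∀ s, ‖conv (fun i => B ^ i) ε (s + 1) - conv (fun i => B ^ i) ε s‖ ≤ ν) (t : ℕ) :
    ‖x t - const n (pair πA (x t))‖ ≤ α * (
      ∑ i ∈ Finset.range t, specNorm (A ^ i - rowLimit πA) * (n * (‖Gr (m * ((t - 1 - i) / m))‖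
          + L * (Real.sqrt n)⁻¹ * spread πA x m ((t - 1 - i) / m)))
      + L * ∑ j ∈ Finset.range t, (∑ i ∈ Finset.range (j + 1),
          specNorm (A ^ i - rowLimit πA) * specNorm (B ^ (j - i) - colLimit πB))
            * jump πA x m ((t - 1 - j) / m)
      + ‖h 0‖ * ∑ i ∈ Finset.range t, specNorm (B ^ i - colLimit πB)
          * (Real.sqrt n * specNorm (A ^ (m * ((t - 1 - i) / m)) - rowLimit πA))
      + mixSum A (rowLimit πA) * ν) := by
  have hν0 : 0 ≤ ν := (norm_nonneg _).trans (hν 0)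
  rw [S.consensus_eq hE, norm_neg, norm_smul, Real.norm_of_nonneg hα]
  refine mul_le_mul_of_nonneg_left ((norm_conv_le _ _ _).trans ?_) hα
  set a : ℕ → ℝ := fun i => specNorm (A ^ i - rowLimit πA) with ha
  set b : ℕ → ℝ := fun i => specNorm (B ^ i - colLimit πB) with hb
  have ha0 : ∀ i, 0 ≤ a i := fun i => specNorm_nonneg _
  have hb0 : ∀ i, 0 ≤ b i := fun i => specNorm_nonneg _
  have h1 : ∀ i ∈ Finset.range t, a i * ‖y (t - 1 - i)‖ ≤
      a i * (n * (‖Gr (m * ((t - 1 - i) / m))‖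
          + L * (Real.sqrt n)⁻¹ * spread πA x m ((t - 1 - i) / m)))
      + L * ∑ l ∈ Finset.range (t - i), a i * b l * jump πA x m ((t - 1 - (i + l)) / m)
      + ‖h 0‖ * (a i * b (t - 1 - i)) + a i * ν := by
    intro i hi
    have hi' := Finset.mem_range.mp hi
    have h2 := mul_le_mul_of_nonneg_left (S.norm_tracker_le hn hE hL hm hν (t - 1 - i)) (ha0 i)
    rw [show t - 1 - i + 1 = t - i by omega] at h2
    refine h2.trans_eq ?_
    simp_rw [show ∀ l, t - 1 - i - l = t - 1 - (i + l) from fun l => by omega, Finset.mul_sum,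
      mul_add, Finset.mul_sum]
    congr 1
    congr 1
    · congr 1
      exact Finset.sum_congr rfl fun l _ => by ring
    · ring
  refine (Finset.sum_le_sum h1).trans ?_
  rw [Finset.sum_add_distrib, Finset.sum_add_distrib, Finset.sum_add_distrib, ← Finset.mul_sum,
    ← Finset.mul_sum, ← Finset.sum_mul]
  have h3 : ∑ i ∈ Finset.range t, ∑ l ∈ Finset.range (t - i),
        a i * b l * jump πA x m ((t - 1 - (i + l)) / m)
      = ∑ j ∈ Finset.range t, (∑ i ∈ Finset.range (j + 1), a i * b (j - i))
          * jump πA x m ((t - 1 - j) / m) := by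
    rw [← Finset.sum_range_diag_flip t
      fun i l => a i * b l * jump πA x m ((t - 1 - (i + l)) / m)]
    refine Finset.sum_congr rfl fun j _ => ?_
    rw [Finset.sum_mul]
    refine Finset.sum_congr rfl fun i hi => ?_
    rw [Nat.add_sub_cancel' (Nat.lt_succ_iff.mp (Finset.mem_range.mp hi))]
  -- the deviations of `A` at any time of a block are controlled by the one at its start
  have h4 : ∑ i ∈ Finset.range t, a i * b (t - 1 - i)
      ≤ ∑ i ∈ Finset.range t, b i * (Real.sqrt n * a (m * ((t - 1 - i) / m))) := by
    rw [← Finset.sum_range_reflect]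
    refine Finset.sum_le_sum fun i hi => ?_
    have hi' := Finset.mem_range.mp hi
    rw [show t - 1 - (t - 1 - i) = i by omega, mul_comm]
    refine mul_le_mul_of_nonneg_left ?_ (hb0 i)
    have := hE.deviation_add_le (m * ((t - 1 - i) / m)) ((t - 1 - i) % m)
    rwa [Nat.div_add_mod] at this
  have h5 := mul_le_mul_of_nonneg_left h4 (norm_nonneg (h 0))
  have h6 := mul_le_mul_of_nonneg_right (hE.decay_A.sum_le (Finset.range t)) hν0
  rw [h3]
  linarith

end System

theorem l2_add_four_le {K : ℕ} {f₁ f₂ f₃ f₄ : ℕ → ℝ} {a₁ a₂ a₃ a₄ : ℝ} (h₁ : l2 K f₁ ≤ a₁)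
    (h₂ : l2 K f₂ ≤ a₂) (h₃ : l2 K f₃ ≤ a₃) (h₄ : l2 K f₄ ≤ a₄) :
    l2 K (fun k => f₁ k + f₂ k + f₃ k + f₄ k) ≤ a₁ + a₂ + a₃ + a₄ := by
  have e1 : l2 K (fun k => f₁ k + f₂ k + f₃ k + f₄ k)
      ≤ l2 K (fun k => f₁ k + f₂ k + f₃ k) + l2 K f₄ := l2_add_le
  have e2 : l2 K (fun k => f₁ k + f₂ k + f₃ k) ≤ l2 K (fun k => f₁ k + f₂ k) + l2 K f₃ :=
    l2_add_le
  have e3 : l2 K (fun k => f₁ k + f₂ k) ≤ l2 K f₁ + l2 K f₂ := l2_add_le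
  linarith

namespace System

variable {n : ℕ} {H : Type*} [NormedAddCommGroup H] [InnerProductSpace ℝ H]
  {A B : Matrix (Fin n) (Fin n) ℝ} {πA πB : Fin n → ℝ} {α L Δ σ : ℝ} {x0 : H}
  {x y h ε : ℕ → NodeVec n H} {Gr : ℕ → H} {F : ℕ → ℝ} {m : ℕ}

theorem l2_gradient_add_le (hL : 0 ≤ L) (K : ℕ) :
    l2 K (fun k => ‖Gr (m * k)‖ + L * (Real.sqrt n)⁻¹ * spread πA x m k)
      ≤ l2 K (fun k => ‖Gr (m * k)‖) + L * (Real.sqrt n)⁻¹ * l2 K (spread πA x m) := by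
  rw [← l2_const_mul (by positivity)]
  exact l2_add_le

/-- The first coupled inequality: the drift over all blocks, by Young's inequality. -/
theorem l2_drift_le (hn : 2 ≤ n) (hE : ExpDecay A B πA πB)
    (S : System A B πA α L Δ σ x0 x y h ε Gr F) (hα : 0 ≤ α) (hL : 0 ≤ L) (hm : 0 < m) {ν : ℝ}
    (hν : ∀ s r, r ≤ m → ‖freshNoise B πA ε s r + staleNoise B πA ε s r‖ ≤ ν) (K : ℕ) :
    l2 K (drift πA x m) ≤ α * (cConst πA πB * m * (l2 K (fun k => ‖Gr (m * k)‖)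
          + L * (Real.sqrt n)⁻¹ * l2 K (spread πA x m))
      + L * (Real.sqrt 2 * mixSum B (colLimit πB) * l2 K (jump πA x m))
      + ‖h 0‖ * mixSum B (colLimit πB) + Real.sqrt K * ν) := by
  have hν0 : 0 ≤ ν := (norm_nonneg _).trans (hν 0 0 (Nat.zero_le m))
  have hc := (hE.cConst_pos hn).le
  choose r hr hd using exists_drift_eq πA x m
  refine (l2_mono (fun k _ => drift_nonneg πA x m k) fun k _ =>
    (hd k).trans_le (S.norm_pair_sub_le hn hE hα hL hm hν (k := k) (hr k))).trans ?_
  rw [l2_const_mul hα]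
  refine mul_le_mul_of_nonneg_left (l2_add_four_le ?_ ?_ ?_ ?_) hα
  · rw [l2_const_mul (by positivity)]
    exact mul_le_mul_of_nonneg_left (l2_gradient_add_le hL K) (by positivity)
  · rw [l2_const_mul hL]
    exact mul_le_mul_of_nonneg_left (l2_conv_le hm (fun i => specNorm_nonneg _)
      (fun t => hE.decay_B.sum_le _) hr) hL
  · rw [l2_const_mul (norm_nonneg _)]
    exact mul_le_mul_of_nonneg_left (l2_block_le (fun i => specNorm_nonneg _)
      (fun t => hE.decay_B.sum_le _)) (norm_nonneg _)
  · exact (l2_const hν0).le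

/-- The residual over all blocks. -/
theorem l2_residual_le (hn : 2 ≤ n) (hE : ExpDecay A B πA πB)
    (S : System A B πA α L Δ σ x0 x y h ε Gr F) (hL : 0 ≤ L) (hm : 0 < m) {ν : ℝ}
    (hν : ∀ s, ‖staleNoise B πA ε s m‖ ≤ ν) (K : ℕ) :
    l2 K (fun k => ‖residual B πA πB h ε Gr m k‖)
      ≤ cConst πA πB * m * (L * (Real.sqrt n)⁻¹ * l2 K (spread πA x m))
      + L * (Real.sqrt 2 * mixSum B (colLimit πB) * l2 K (jump πA x m))
      + ‖h 0‖ * mixSum B (colLimit πB) + Real.sqrt K * ν := by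
  have hν0 : 0 ≤ ν := (norm_nonneg _).trans (hν 0)
  have hc := (hE.cConst_pos hn).le
  refine (l2_mono (fun k _ => norm_nonneg _) fun k _ =>
    S.norm_residual_le hn hE hL hm hν k).trans ?_
  refine l2_add_four_le ?_ ?_ ?_ ?_
  · rw [l2_const_mul (by positivity), l2_const_mul (by positivity)]
  · rw [l2_const_mul hL]
    exact mul_le_mul_of_nonneg_left (l2_conv_le hm (fun i => specNorm_nonneg _)
      (fun t => hE.decay_B.sum_le _) fun _ => le_rfl) hL
  · rw [l2_const_mul (norm_nonneg _)]
    exact mul_le_mul_of_nonneg_left (l2_block_le (fun i => specNorm_nonneg _)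
      (fun t => hE.decay_B.sum_le _)) (norm_nonneg _)
  · exact (l2_const hν0).le

/-- The second coupled inequality: the consensus error over all blocks. The transient carries the
square root of `s_{A^m}`, since only the deviations of `A` at the block starts enter. -/
theorem l2_consensus_le (hn : 2 ≤ n) (hE : ExpDecay A B πA πB)
    (S : System A B πA α L Δ σ x0 x y h ε Gr F) (hα : 0 ≤ α) (hL : 0 ≤ L) (hm : 0 < m) {ν : ℝ}
    (hν : ∀ s, ‖conv (fun i => B ^ i) ε (s + 1) - conv (fun i => B ^ i) ε s‖ ≤ ν) (K : ℕ) :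
    l2 K (consensus πA x m) ≤ α * (
      Real.sqrt 2 * mixSum A (rowLimit πA) * (n * (l2 K (fun k => ‖Gr (m * k)‖)
          + L * (Real.sqrt n)⁻¹ * l2 K (spread πA x m)))
      + L * (Real.sqrt 2 * (mixSum A (rowLimit πA) * mixSum B (colLimit πB))
          * l2 K (jump πA x m))
      + ‖h 0‖ * (Real.sqrt 2 * mixSum B (colLimit πB)
          * (Real.sqrt n * Real.sqrt (mixSum (A ^ m) (rowLimit πA))))
      + Real.sqrt K * (mixSum A (rowLimit πA) * ν)) := by
  have hν0 : 0 ≤ ν := (norm_nonneg _).trans (hν 0)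
  have hA0 : 0 ≤ mixSum A (rowLimit πA) := by simpa using hE.decay_A.sum_le ∅
  have hB0 : 0 ≤ mixSum B (colLimit πB) := by simpa using hE.decay_B.sum_le ∅
  choose r hr hd using exists_consensus_eq πA x m
  refine (l2_mono (fun k _ => consensus_nonneg πA x m k) fun k _ =>
    (hd k).trans_le (S.norm_consensus_le hn hE hα hL hm hν _)).trans ?_
  rw [l2_const_mul hα]
  refine mul_le_mul_of_nonneg_left (l2_add_four_le ?_ ?_ ?_ ?_) hα
  · refine (l2_conv_le hm (φ := fun k => n * (‖Gr (m * k)‖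
      + L * (Real.sqrt n)⁻¹ * spread πA x m k)) (fun i => specNorm_nonneg _)
      (fun t => hE.decay_A.sum_le _) hr).trans ?_
    rw [l2_const_mul (by positivity)]
    exact mul_le_mul_of_nonneg_left (mul_le_mul_of_nonneg_left (l2_gradient_add_le hL K)
      (by positivity)) (by positivity)
  · rw [l2_const_mul hL]
    exact mul_le_mul_of_nonneg_left (l2_conv_le hm
      (w := fun j => ∑ i ∈ Finset.range (j + 1),
        specNorm (A ^ i - rowLimit πA) * specNorm (B ^ (j - i) - colLimit πB))
      (fun j => Finset.sum_nonneg fun i _ => mul_nonneg (specNorm_nonneg _) (specNorm_nonneg _))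
      (sum_antidiagonal_le (a := fun i => specNorm (A ^ i - rowLimit πA))
        (b := fun i => specNorm (B ^ i - colLimit πB)) (fun i => specNorm_nonneg _)
        (fun t => hE.decay_A.sum_le _) (fun t => hE.decay_B.sum_le _)) hr) hL
  · rw [l2_const_mul (norm_nonneg _)]
    refine mul_le_mul_of_nonneg_left ((l2_conv_le hm
      (φ := fun k => Real.sqrt n * specNorm (A ^ (m * k) - rowLimit πA))
      (fun i => specNorm_nonneg _) (fun t => hE.decay_B.sum_le _) hr).trans ?_) (norm_nonneg _)
    rw [l2_const_mul (Real.sqrt_nonneg _)]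
    refine mul_le_mul_of_nonneg_left (mul_le_mul_of_nonneg_left (Real.sqrt_le_sqrt ?_)
      (Real.sqrt_nonneg _)) (by positivity)
    simp_rw [pow_mul]
    exact (hE.decay_A.pow hm).sum_sq_le _
  · exact (l2_const (by positivity)).le

end System

/-! ### Descent over blocks -/

namespace System

variable {n : ℕ} {H : Type*} [NormedAddCommGroup H] [InnerProductSpace ℝ H]
  {A B : Matrix (Fin n) (Fin n) ℝ} {πA πB : Fin n → ℝ} {α L Δ σ : ℝ} {x0 : H}
  {x y h ε : ℕ → NodeVec n H} {Gr : ℕ → H} {F : ℕ → ℝ} {m : ℕ}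

theorem inner_freshNoise (S : System A B πA α L Δ σ x0 x y h ε Gr F) (s r : ℕ) :
    inner ℝ (Gr s) (freshNoise B πA ε s r) = 0 := by
  rw [freshNoise, inner_sum]
  refine Finset.sum_eq_zero fun j hj => ?_
  rw [pair_apply, inner_sum]
  refine Finset.sum_eq_zero fun i _ => ?_
  rw [inner_smul_right, S.grad_orth s j i (Finset.mem_Ico.mp hj).1, mul_zero]

/-- Descent over one block. The noise drawn inside the block is orthogonal to the gradient at the
start of the block, so it enters to second order only; this is where the speedup in `n` comes
from. -/
theorem block_descent (hn : 2 ≤ n) (hE : ExpDecay A B πA πB)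
    (S : System A B πA α L Δ σ x0 x y h ε Gr F) (hα : 0 < α) (hL : 0 < L) (hm : 0 < m)
    (hstep : α * (cConst πA πB * m) * L ≤ 1 / 10) (k : ℕ) :
    F (m * (k + 1)) ≤ F (m * k)
      - 3 / 5 * (α * (cConst πA πB * m)) * ‖Gr (m * k)‖ ^ 2
      + 23 / 20 * (α / (cConst πA πB * m)) * ‖residual B πA πB h ε Gr m k‖ ^ 2
      + 3 / 2 * (L * α ^ 2) * ‖freshNoise B πA ε (m * k) m‖ ^ 2 := by
  have hc := hE.cConst_pos hn
  set D : ℝ := cConst πA πB * m with hD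
  have hD0 : 0 < D := by positivity
  set G := Gr (m * k)
  set R := residual B πA πB h ε Gr m k
  set N := freshNoise B πA ε (m * k) m with hN
  have h1 := S.descent (m * k) (m * (k + 1))
  rw [S.pair_block_eq hn hE] at h1
  have hGN : inner ℝ G N = 0 := S.inner_freshNoise _ _
  have h2 : inner ℝ G (-(α • (D • G + R + N))) = -(α * (D * ‖G‖ ^ 2 + inner ℝ G R)) := by
    rw [inner_neg_right, inner_smul_right, inner_add_right, inner_add_right, inner_smul_right,
      hGN, real_inner_self_eq_norm_sq, add_zero]
  have h3 : ‖-(α • (D • G + R + N))‖ ^ 2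
      ≤ α ^ 2 * (3 * (D ^ 2 * ‖G‖ ^ 2 + ‖R‖ ^ 2 + ‖N‖ ^ 2)) := by
    rw [norm_neg, norm_smul, mul_pow, Real.norm_eq_abs, sq_abs]
    refine mul_le_mul_of_nonneg_left ?_ (sq_nonneg α)
    have h4 : ‖D • G + R + N‖ ≤ D * ‖G‖ + ‖R‖ + ‖N‖ := by
      refine norm_add₃_le.trans_eq ?_
      rw [norm_smul, Real.norm_of_nonneg hD0.le]
    nlinarith [pow_le_pow_left₀ (norm_nonneg _) h4 2, sq_nonneg (D * ‖G‖ - ‖R‖),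
      sq_nonneg (D * ‖G‖ - ‖N‖), sq_nonneg (‖R‖ - ‖N‖)]
  have h5 : -inner ℝ G R ≤ D / 4 * ‖G‖ ^ 2 + ‖R‖ ^ 2 / D := by
    have h6 : -inner ℝ G R ≤ ‖G‖ * ‖R‖ := (neg_le_abs _).trans (abs_real_inner_le_norm G R)
    have h7 : D / 4 * ‖G‖ ^ 2 + ‖R‖ ^ 2 / D - ‖G‖ * ‖R‖ = (D * ‖G‖ / 2 - ‖R‖) ^ 2 / D := by
      field_simp; ring
    have h8 : 0 ≤ (D * ‖G‖ / 2 - ‖R‖) ^ 2 / D := by positivity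
    linarith
  rw [h2] at h1
  have h9 : L / 2 * (α ^ 2 * (3 * (D ^ 2 * ‖G‖ ^ 2 + ‖R‖ ^ 2 + ‖N‖ ^ 2)))
      = 3 / 2 * (α * D * L) * (α * D * ‖G‖ ^ 2) + 3 / 2 * (α * D * L) * (α / D * ‖R‖ ^ 2)
        + 3 / 2 * (L * α ^ 2) * ‖N‖ ^ 2 := by
    field_simp
  have h10 := mul_le_mul_of_nonneg_left h3 (by positivity : 0 ≤ L / 2)
  rw [h9] at h10
  have h11 := mul_le_mul_of_nonneg_right hstep (by positivity : 0 ≤ α * D * ‖G‖ ^ 2)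
  have h12 := mul_le_mul_of_nonneg_right hstep (by positivity : 0 ≤ α / D * ‖R‖ ^ 2)
  have h13 := mul_le_mul_of_nonneg_left h5 hα.le
  have h14 : α * (D / 4 * ‖G‖ ^ 2 + ‖R‖ ^ 2 / D) = 1 / 4 * (α * D * ‖G‖ ^ 2) + α / D * ‖R‖ ^ 2 := by
    field_simp
  rw [h14] at h13
  linarith

theorem sum_descent (hn : 2 ≤ n) (hE : ExpDecay A B πA πB)
    (S : System A B πA α L Δ σ x0 x y h ε Gr F) (hα : 0 < α) (hL : 0 < L) (hm : 0 < m)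
    (hstep : α * (cConst πA πB * m) * L ≤ 1 / 10) {ν : ℝ}
    (hν : ∀ s, ‖freshNoise B πA ε s m‖ ^ 2 ≤ ν) (K : ℕ) :
    3 / 5 * (α * (cConst πA πB * m)) * l2 K (fun k => ‖Gr (m * k)‖) ^ 2 ≤ Δ
      + 23 / 20 * (α / (cConst πA πB * m)) * l2 K (fun k => ‖residual B πA πB h ε Gr m k‖) ^ 2
      + K * (3 / 2 * (L * α ^ 2) * ν) := by
  have hgap := S.gap (m * K)
  have key : F (m * K) ≤ F 0
      - 3 / 5 * (α * (cConst πA πB * m)) * ∑ k ∈ Finset.range K, ‖Gr (m * k)‖ ^ 2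
      + 23 / 20 * (α / (cConst πA πB * m))
        * ∑ k ∈ Finset.range K, ‖residual B πA πB h ε Gr m k‖ ^ 2
      + K * (3 / 2 * (L * α ^ 2) * ν) := by
    clear hgap
    induction K with
    | zero => simp
    | succ K ih =>
      have h1 := S.block_descent hn hE hα hL hm hstep K
      have h2 := mul_le_mul_of_nonneg_left (hν (m * K)) (by positivity : 0 ≤ 3 / 2 * (L * α ^ 2))
      rw [Finset.sum_range_succ, Finset.sum_range_succ]
      push_cast
      linarith
  rw [l2_sq, l2_sq]
  linarith

end System

/-! ### Solving the coupled inequalities -/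

/-- The linear system behind the convergence bound: with `D = c m` and a small step size, the drift
`p`, the consensus error `q` and the residual `R` are at most a small multiple of the gradient size
`γ` plus noise and transient terms. -/
theorem residual_le_of_system {α L D n r sA sB γ p q e j R N₁ N₂ N₃ : ℝ} (hα : 0 ≤ α) (hL : 0 ≤ L)
    (hr0 : 0 < r) (hnr : r ^ 2 = n) (hγ : 0 ≤ γ) (he0 : 0 ≤ e) (hj0 : 0 ≤ j) (hN₁ : 0 ≤ N₁) (hN₂ : 0 ≤ N₂)
    (hstep : α * D * L ≤ 1 / 10)
    (hβ : Real.sqrt 2 * sB * r ≤ 16 / 100 * D)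
    (hδ : Real.sqrt 2 * sA * r ≤ 57 / 1000 * D)
    (hη : Real.sqrt 2 * (sA * sB) ≤ 4 / 100 * D)
    (hD : 0 < D)
    (he : e ≤ q + r * p) (hj : j ≤ 3 * e + r * p)
    (hp : p ≤ α * (D * (γ + L * (r)⁻¹ * e) + L * (Real.sqrt 2 * sB * j) + N₁))
    (hq : q ≤ α * (Real.sqrt 2 * sA * (n * (γ + L * (r)⁻¹ * e))
      + L * (Real.sqrt 2 * (sA * sB) * j) + N₂))
    (hR : R ≤ D * (L * (r)⁻¹ * e) + L * (Real.sqrt 2 * sB * j) + N₃) :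
    R ≤ D * (22 / 100 * γ + 21 / 10 * (α * L * N₁) + 2 * (α * L * ((r)⁻¹ * N₂))) + N₃ := by
  subst hnr
  -- rescale all unknowns to the size of `γ`
  set E := L * r⁻¹ * e with hE
  set P := L * p with hP
  set Q := L * r⁻¹ * q with hQ
  set J := L * r⁻¹ * j with hJ
  have hE0 : 0 ≤ E := by positivity
  have hJ0 : 0 ≤ J := by positivity
  have e1 : E ≤ Q + P := by
    have := mul_le_mul_of_nonneg_left he (by positivity : 0 ≤ L * r⁻¹)
    have h2 : L * r⁻¹ * (q + r * p) = Q + P := by rw [hQ, hP]; field_simp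
    linarith
  have e2 : J ≤ 3 * E + P := by
    have := mul_le_mul_of_nonneg_left hj (by positivity : 0 ≤ L * r⁻¹)
    have h2 : L * r⁻¹ * (3 * e + r * p) = 3 * E + P := by rw [hE, hP]; field_simp
    linarith
  have hαL : 0 ≤ α * L := mul_nonneg hα hL
  have hl : α * L * D ≤ 1 / 10 := by linarith
  have e3 : P ≤ 1 / 10 * (γ + E) + 16 / 1000 * J + α * L * N₁ := by
    have h1 := mul_le_mul_of_nonneg_left hp hL
    have h2 : L * (α * (D * (γ + E) + L * (Real.sqrt 2 * sB * j) + N₁))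
        = α * L * D * (γ + E) + α * L * (Real.sqrt 2 * sB * r) * J + α * L * N₁ := by
      rw [hJ]; field_simp
    have h3 := mul_le_mul_of_nonneg_right hl (by positivity : 0 ≤ γ + E)
    have h4 := mul_le_mul_of_nonneg_right (mul_le_mul_of_nonneg_left hβ hαL) hJ0
    have h5 := mul_le_mul_of_nonneg_right hl hJ0
    linarith
  have e4 : Q ≤ 57 / 10000 * (γ + E) + 4 / 1000 * J + α * L * (r⁻¹ * N₂) := by
    have h1 := mul_le_mul_of_nonneg_left hq (by positivity : 0 ≤ L * r⁻¹)
    have h2 : L * r⁻¹ * (α * (Real.sqrt 2 * sA * (r ^ 2 * (γ + E))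
          + L * (Real.sqrt 2 * (sA * sB) * j) + N₂))
        = α * L * (Real.sqrt 2 * sA * r) * (γ + E) + α * L * (Real.sqrt 2 * (sA * sB)) * J
          + α * L * (r⁻¹ * N₂) := by
      rw [hJ]; field_simp
    have h3 := mul_le_mul_of_nonneg_right hl (by positivity : 0 ≤ γ + E)
    have h4 := mul_le_mul_of_nonneg_right (mul_le_mul_of_nonneg_left hδ hαL)
      (by positivity : 0 ≤ γ + E)
    have h5 := mul_le_mul_of_nonneg_right (mul_le_mul_of_nonneg_left hη hαL) hJ0
    have h6 := mul_le_mul_of_nonneg_right hl hJ0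
    linarith
  have e5 : R ≤ D * E + 16 / 100 * D * J + N₃ := by
    have h2 : L * (Real.sqrt 2 * sB * j) = Real.sqrt 2 * sB * r * J := by rw [hJ]; field_simp
    have h4 := mul_le_mul_of_nonneg_right hβ hJ0
    linarith
  have h1 : E + 16 / 100 * J ≤ 22 / 100 * γ + 21 / 10 * (α * L * N₁) + 2 * (α * L * (r⁻¹ * N₂)) := by
    have h3 : 0 ≤ α * L * N₁ := mul_nonneg hαL hN₁
    have h4 : 0 ≤ α * L * (r⁻¹ * N₂) := by positivity
    linarith
  have h2 := mul_le_mul_of_nonneg_left h1 hD.le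
  linarith

/-- The convergence bound from the descent inequality and the bound on the residual. -/
theorem sq_le_of_descent {n c m D sA sB sAm sBm L α Δ K H₀ σ γ R νP νy νO r : ℝ} (hn : 2 ≤ n)
    (hc : 0 < c) (hD0 : 0 < D) (hD : D = c * m) (hsA : 1 ≤ sA) (hsB : 1 ≤ sB) (hsAm : 1 ≤ sAm) (hsBm : 1 ≤ sBm)
    (hL : 0 < L) (hα : 0 < α) (hΔ : 0 < Δ) (hK : 0 ≤ K) (hr : 0 < r) (hrn : r ^ 2 = n)
    (hR0 : 0 ≤ R) (hH : H₀ ^ 2 ≤ 2 * n * L * Δ)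
    (hP : νP ^ 2 = σ ^ 2 * (5 * (m * (c ^ 2 / n)))) (hy : νy ^ 2 = σ ^ 2 * (5 * n * sB))
    (hO : νO ^ 2 = σ ^ 2 * (4 * sB))
    (hstep : α * D * L ≤ 1 / 10) (hstep2 : (α * D * L) ^ 2 * sB ≤ 1 / 100)
    (hblock : 8 * n ^ 2 * sA ^ 2 * sB ≤ c * D)
    (hdesc : 3 / 5 * (α * D) * γ ^ 2 ≤ Δ + 23 / 20 * (α / D) * R ^ 2
      + K * (3 / 2 * (L * α ^ 2) * (σ ^ 2 * (3 * (m * (c ^ 2 / n))))))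
    (hR : R ≤ D * (22 / 100 * γ + 21 / 10 * (α * L * (H₀ * sB + Real.sqrt K * νP))
      + 2 * (α * L * (r⁻¹ * (H₀ * (Real.sqrt 2 * sB * (r * Real.sqrt sAm))
        + Real.sqrt K * (sA * νy))))) + (H₀ * sB + Real.sqrt K * νO)) :
    γ ^ 2 ≤ 5 / 2 * (Δ / (α * D)) + 100 * (c * α * L * σ ^ 2 * K / n)
      + 144 * (sB * σ ^ 2 * K / D ^ 2)
      + (10 * sA * sAm ^ 2 * n ^ 2 + 312 * sB ^ 2 * sBm * n) * (L * Δ / D ^ 2) := by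
  have hn0 : 0 < n := by linarith
  have hmD : m = D / c := by rw [hD]; field_simp
  have hKs : Real.sqrt K ^ 2 = K := Real.sq_sqrt hK
  have h2s : Real.sqrt 2 ^ 2 = 2 := Real.sq_sqrt (by norm_num)
  have hAs : Real.sqrt sAm ^ 2 = sAm := Real.sq_sqrt (by linarith)
  set X := c * α * L * σ ^ 2 * K / n with hX
  set Y := H₀ ^ 2 / D ^ 2 with hY
  set Z := sB * σ ^ 2 * K / D ^ 2 with hZ
  have hX0 : 0 ≤ X := by positivity
  have hY0 : 0 ≤ Y := by positivity
  have hl0 : 0 ≤ α * D * L := by positivity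
  have hl2 : (α * D * L) ^ 2 ≤ 1 / 100 :=
    (le_mul_of_one_le_right (sq_nonneg _) hsB).trans hstep2
  -- the squares of the six noise and transient terms
  have t1 : (21 / 10 * (α * L * (H₀ * sB))) ^ 2 ≤ 441 / 10000 * (Y * sB ^ 2) := by
    have e : (21 / 10 * (α * L * (H₀ * sB))) ^ 2 = 441 / 100 * ((α * D * L) ^ 2 * (Y * sB ^ 2)) := by
      rw [hY]; field_simp; ring
    have := mul_le_mul_of_nonneg_right hl2 (by positivity : 0 ≤ Y * sB ^ 2)
    linarith
  have t2 : (21 / 10 * (α * L * (Real.sqrt K * νP))) ^ 2 ≤ 2205 / 1000 * X := by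
    have e : (21 / 10 * (α * L * (Real.sqrt K * νP))) ^ 2 = 2205 / 100 * (α * D * L * X) := by
      rw [show (21 / 10 * (α * L * (Real.sqrt K * νP))) ^ 2
        = 441 / 100 * ((α * L) ^ 2 * (Real.sqrt K ^ 2 * νP ^ 2)) by ring, hKs, hP, hX, hmD]
      field_simp; ring
    have := mul_le_mul_of_nonneg_right hstep hX0
    linarith
  have t3 : (2 * (α * L * (H₀ * (Real.sqrt 2 * sB * Real.sqrt sAm)))) ^ 2
      ≤ 4 / 100 * (Y * sB ^ 2) + 4 / 100 * (Y * sAm ^ 2) := by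
    have e : (2 * (α * L * (H₀ * (Real.sqrt 2 * sB * Real.sqrt sAm)))) ^ 2
        = 8 * ((α * D * L) ^ 2 * sB * (Y * (sB * sAm))) := by
      rw [show (2 * (α * L * (H₀ * (Real.sqrt 2 * sB * Real.sqrt sAm)))) ^ 2
        = 4 * ((α * L) ^ 2 * (H₀ ^ 2 * (Real.sqrt 2 ^ 2 * sB ^ 2 * Real.sqrt sAm ^ 2))) by ring,
        h2s, hAs, hY]
      field_simp; ring
    have h1 := mul_le_mul_of_nonneg_right hstep2 (by positivity : 0 ≤ Y * (sB * sAm))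
    have h2 : Y * (sB * sAm) ≤ Y * ((sB ^ 2 + sAm ^ 2) / 2) :=
      mul_le_mul_of_nonneg_left (by linarith [two_mul_le_add_sq sB sAm]) hY0
    linarith
  have t4 : (2 * (α * L * (r⁻¹ * (Real.sqrt K * (sA * νy))))) ^ 2 ≤ 125 / 1000 * X := by
    have e : (2 * (α * L * (r⁻¹ * (Real.sqrt K * (sA * νy))))) ^ 2
        = 20 * (α * L * (n * sA ^ 2 * sB) / c * X) := by
      rw [show (2 * (α * L * (r⁻¹ * (Real.sqrt K * (sA * νy))))) ^ 2
        = 4 * ((α * L) ^ 2 * ((r ^ 2)⁻¹ * (Real.sqrt K ^ 2 * (sA ^ 2 * νy ^ 2)))) by ring,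
        hKs, hy, hrn, hX]
      field_simp; ring
    have h1 : n * sA ^ 2 * sB ≤ c * D / 16 := by
      have : n * (n * sA ^ 2 * sB) ≥ 2 * (n * sA ^ 2 * sB) :=
        mul_le_mul_of_nonneg_right hn (by positivity)
      have h0 := hblock
      rw [show 8 * n ^ 2 * sA ^ 2 * sB = 8 * (n * (n * sA ^ 2 * sB)) by ring] at h0
      linarith
    have h2 : α * L * (n * sA ^ 2 * sB) / c ≤ 1 / 160 := by
      rw [div_le_iff₀ hc]
      have h3 := mul_le_mul_of_nonneg_left h1 (by positivity : 0 ≤ α * L)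
      have h4 := mul_le_mul_of_nonneg_right hstep hc.le
      linarith
    have := mul_le_mul_of_nonneg_right h2 hX0
    linarith
  have t5 : (H₀ * sB / D) ^ 2 = Y * sB ^ 2 := by rw [hY]; field_simp
  have t6 : (Real.sqrt K * νO / D) ^ 2 = 4 * Z := by
    rw [div_pow, mul_pow, hKs, hO, hZ]; field_simp
  obtain ⟨a1, ha1⟩ : ∃ a, a = 21 / 10 * (α * L * (H₀ * sB)) := ⟨_, rfl⟩
  obtain ⟨a2, ha2⟩ : ∃ a, a = 21 / 10 * (α * L * (Real.sqrt K * νP)) := ⟨_, rfl⟩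
  obtain ⟨a3, ha3⟩ : ∃ a, a = 2 * (α * L * (H₀ * (Real.sqrt 2 * sB * Real.sqrt sAm))) := ⟨_, rfl⟩
  obtain ⟨a4, ha4⟩ : ∃ a, a = 2 * (α * L * (r⁻¹ * (Real.sqrt K * (sA * νy)))) := ⟨_, rfl⟩
  obtain ⟨a5, ha5⟩ : ∃ a, a = H₀ * sB / D := ⟨_, rfl⟩
  obtain ⟨a6, ha6⟩ : ∃ a, a = Real.sqrt K * νO / D := ⟨_, rfl⟩
  have hRD : R / D ≤ 22 / 100 * γ + (a1 + a2 + a3 + a4 + a5 + a6) := by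
    rw [div_le_iff₀ hD0]
    refine hR.trans_eq ?_
    rw [ha1, ha2, ha3, ha4, ha5, ha6]
    field_simp; ring
  rw [← ha1] at t1
  rw [← ha2] at t2
  rw [← ha3] at t3
  rw [← ha4] at t4
  rw [← ha5] at t5
  rw [← ha6] at t6
  have hRD0 : 0 ≤ R / D := by positivity
  have hsum : (a1 + a2 + a3 + a4 + a5 + a6) ^ 2
      ≤ 6 * (a1 ^ 2 + a2 ^ 2 + a3 ^ 2 + a4 ^ 2 + a5 ^ 2 + a6 ^ 2) := by
    have := sq_sum_le_card_mul_sum_sq (s := Finset.univ) (f := ![a1, a2, a3, a4, a5, a6])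
    simpa [Fin.sum_univ_six] using this
  have hRsq : (R / D) ^ 2 ≤ 968 / 10000 * γ ^ 2 + 2 * (a1 + a2 + a3 + a4 + a5 + a6) ^ 2 := by
    have h1 := pow_le_pow_left₀ hRD0 hRD 2
    have h2 := add_sq_le (a := 22 / 100 * γ) (b := a1 + a2 + a3 + a4 + a5 + a6)
    linarith
  have hdesc' : 3 / 5 * γ ^ 2 ≤ Δ / (α * D) + 23 / 20 * (R / D) ^ 2 + 9 / 2 * X := by
    have e : Δ + 23 / 20 * (α / D) * R ^ 2
        + K * (3 / 2 * (L * α ^ 2) * (σ ^ 2 * (3 * (m * (c ^ 2 / n)))))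
        = α * D * (Δ / (α * D) + 23 / 20 * (R / D) ^ 2 + 9 / 2 * X) := by
      rw [hX, hmD]; field_simp; ring
    rw [e, show 3 / 5 * (α * D) * γ ^ 2 = α * D * (3 / 5 * γ ^ 2) by ring] at hdesc
    exact le_of_mul_le_mul_left hdesc (by positivity)
  have hYle : Y ≤ 2 * n * (L * Δ / D ^ 2) := by
    rw [hY, div_le_iff₀ (by positivity)]
    refine hH.trans_eq ?_
    field_simp
  set W := L * Δ / D ^ 2 with hW
  have hW0 : 0 ≤ W := by positivity
  have hfin1 : Y * sB ^ 2 ≤ 2 * (sB ^ 2 * sBm * n * W) := by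
    have h1 := mul_le_mul_of_nonneg_right hYle (sq_nonneg sB)
    have h2 : sB ^ 2 * n * W * 1 ≤ sB ^ 2 * n * W * sBm :=
      mul_le_mul_of_nonneg_left hsBm (by positivity)
    linarith
  have hfin2 : Y * sAm ^ 2 ≤ sA * sAm ^ 2 * n ^ 2 * W := by
    have h1 := mul_le_mul_of_nonneg_right hYle (sq_nonneg sAm)
    have h2 : sAm ^ 2 * n * W * 2 ≤ sAm ^ 2 * n * W * (sA * n) :=
      mul_le_mul_of_nonneg_left (by linarith [mul_le_mul_of_nonneg_right hsA hn0.le]) (by positivity)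
    linarith
  have hYA : 0 ≤ sA * sAm ^ 2 * n ^ 2 * W := by positivity
  have hYB : 0 ≤ sB ^ 2 * sBm * n * W := by positivity
  have hZ0 : 0 ≤ Z := by positivity
  have hΔ0 : 0 ≤ Δ / (α * D) := by positivity
  linarith

/-- What the block length threshold gives: with `D = c m`, the kernels of the coupled inequalities
are small compared with `D`. -/
theorem small_of_blockThreshold_le {n : ℕ} {c sA sAm sB sBm m : ℝ} (hn : 2 ≤ n) (hc : 0 < c)
    (hcn : c ≤ n) (hsA : 1 ≤ sA) (hsAm : 1 ≤ sAm) (hsB : 1 ≤ sB) (hsBm : 1 ≤ sBm)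
    (hC : blockThreshold n c sA sAm sB sBm ≤ m) :
    0 < m ∧ (n : ℝ) ^ 2 * sB ^ 2 ≤ c ^ 2 * m ∧ 8 * (n : ℝ) ^ 2 * sA ^ 2 * sB ≤ c * (c * m) ∧
      Real.sqrt 2 * sB * Real.sqrt n ≤ 16 / 100 * (c * m) ∧
      Real.sqrt 2 * sA * Real.sqrt n ≤ 57 / 1000 * (c * m) ∧
      Real.sqrt 2 * (sA * sB) ≤ 4 / 100 * (c * m) := by
  have hn2 : (2 : ℝ) ≤ n := by exact_mod_cast hn
  have hn0 : (0 : ℝ) < n := by linarith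
  obtain ⟨N, hN⟩ : ∃ N : ℝ, N = n := ⟨_, rfl⟩
  simp only [blockThreshold, max_le_iff] at hC
  obtain ⟨-, -, h3, -, h5, h6⟩ := hC
  have hc2 : 0 < c ^ 2 := by positivity
  have e : ∀ z, (c ^ 2)⁻¹ * z ≤ m → z ≤ c ^ 2 * m := fun z hz => by
    rwa [inv_mul_le_iff₀ hc2] at hz
  have g3 : (n : ℝ) ^ 2 * sB ^ 2 ≤ c ^ 2 * m := e _ (by rw [← mul_assoc]; exact h3)
  have g5 : 8 * (n : ℝ) ^ 2 * sA ^ 2 * sB ≤ c ^ 2 * m := by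
    refine le_trans ?_ (e _ ((mul_assoc _ _ _).symm.le.trans h5))
    have : 0 ≤ (n : ℝ) ^ 2 * (2 * n * sB + 2 * sA * sB + Real.sqrt n * sB) := by positivity
    linarith
  have g6 : 20 * (n : ℝ) ^ 3 * (sA * sB) ≤ c ^ 2 * m := by
    refine le_trans ?_ (e (20 * (n : ℝ) ^ 3 * sA * sAm * sB * sBm) (le_trans (le_of_eq ?_) h6))
    · have : 1 ≤ sAm * sBm := one_le_mul_of_one_le_of_one_le hsAm hsBm
      have := mul_le_mul_of_nonneg_left this (by positivity : 0 ≤ 20 * (n : ℝ) ^ 3 * (sA * sB))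
      linarith
    · ring
  have hm0 : 0 < m := by
    have : 0 < c ^ 2 * m := lt_of_lt_of_le (by positivity) g3
    exact pos_of_mul_pos_right this hc2.le
  have hcn2 : c ^ 2 ≤ (n : ℝ) ^ 2 := pow_le_pow_left₀ hc.le hcn 2
  -- `m ≥ 20 n s_A s_B`, since `c ≤ n`
  have g7 : 20 * (n : ℝ) * (sA * sB) ≤ m := by
    have h1 : c ^ 2 * m ≤ (n : ℝ) ^ 2 * m := mul_le_mul_of_nonneg_right hcn2 hm0.le
    have h2 : (n : ℝ) ^ 2 * (20 * n * (sA * sB)) ≤ (n : ℝ) ^ 2 * m := by linarith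
    exact le_of_mul_le_mul_left h2 (by positivity)
  have g8 : 40 * sB ≤ m := by
    have h1 : 2 * sB ≤ n * (sA * sB) := by
      have : 1 * sB ≤ sA * sB := mul_le_mul_of_nonneg_right hsA (by linarith)
      exact mul_le_mul hn2 (by linarith) (by linarith) (by linarith)
    linarith
  have g9 : 40 ≤ m := by linarith
  have hD0 : 0 < c * m := by positivity
  have h2s : Real.sqrt 2 ^ 2 = 2 := Real.sq_sqrt (by norm_num)
  have hns : Real.sqrt n ^ 2 = n := Real.sq_sqrt hn0.le
  refine ⟨hm0, g3, by linarith, ?_, ?_, ?_⟩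
  · refine le_of_sq_le_sq ?_ (by positivity)
    have h1 : (n : ℝ) ^ 2 * sB ^ 2 * 40 ≤ c ^ 2 * m * m :=
      mul_le_mul g3 g9 (by norm_num) (by positivity)
    have h2 : 2 * (n * sB ^ 2) ≤ n * (n * sB ^ 2) :=
      mul_le_mul_of_nonneg_right hn2 (by positivity)
    have h3 : 0 ≤ n * sB ^ 2 := by positivity
    calc (Real.sqrt 2 * sB * Real.sqrt n) ^ 2 = 2 * (n * sB ^ 2) := by
          rw [mul_pow, mul_pow, h2s, hns]; ring
      _ ≤ 256 / 10000 * (c ^ 2 * m * m) := by linarith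
      _ = _ := by ring
  · refine le_of_sq_le_sq ?_ (by positivity)
    have h1 : 8 * (n : ℝ) ^ 2 * sA ^ 2 * sB * 40 ≤ c ^ 2 * m * m :=
      mul_le_mul g5 g9 (by norm_num) (by positivity)
    have h2 : 2 * (n * sA ^ 2 * sB) ≤ n * (n * sA ^ 2 * sB) :=
      mul_le_mul_of_nonneg_right hn2 (by positivity)
    have h3 : n * sA ^ 2 * 1 ≤ n * sA ^ 2 * sB := mul_le_mul_of_nonneg_left hsB (by positivity)
    have h4 : 0 ≤ n * sA ^ 2 := by positivity
    calc (Real.sqrt 2 * sA * Real.sqrt n) ^ 2 = 2 * (n * sA ^ 2) := by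
          rw [mul_pow, mul_pow, h2s, hns]; ring
      _ ≤ 3249 / 1000000 * (c ^ 2 * m * m) := by linarith
      _ = _ := by ring
  · refine le_of_sq_le_sq ?_ (by positivity)
    have h1 : 8 * (n : ℝ) ^ 2 * sA ^ 2 * sB * (40 * sB) ≤ c ^ 2 * m * m :=
      mul_le_mul g5 g8 (by positivity) (by positivity)
    have h2 : 4 * (sA ^ 2 * sB ^ 2) ≤ (n : ℝ) ^ 2 * (sA ^ 2 * sB ^ 2) :=
      mul_le_mul_of_nonneg_right (by nlinarith) (by positivity)
    have h4 : 0 ≤ sA ^ 2 * sB ^ 2 := by positivity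
    calc (Real.sqrt 2 * (sA * sB)) ^ 2 = 2 * (sA ^ 2 * sB ^ 2) := by
          rw [mul_pow, mul_pow, h2s]
      _ ≤ 16 / 10000 * (c ^ 2 * m * m) := by linarith
      _ = _ := by ring

/-- With a step size below the threshold, `α c m L` is small, even after squaring and multiplying
by `s_B`. -/
theorem small_of_step_le {α L D sB sBm : ℝ} (hα : 0 < α) (hL : 0 < L) (hD : 0 < D)
    (hsB : 1 ≤ sB) (hsBm : 1 ≤ sBm)
    (hstep : α ≤ 1 / (10 * D * Real.sqrt (sB * sBm ^ 2) * L)) :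
    α * D * L ≤ 1 / 10 ∧ (α * D * L) ^ 2 * sB ≤ 1 / 100 := by
  have hsB0 : 0 < sB := by linarith
  have hsBm0 : 0 < sBm := by linarith
  have hw1 : 1 ≤ Real.sqrt (sB * sBm ^ 2) := by
    rw [Real.one_le_sqrt]
    exact one_le_mul_of_one_le_of_one_le hsB (one_le_pow₀ hsBm)
  have hw : α * D * L * Real.sqrt (sB * sBm ^ 2) ≤ 1 / 10 := by
    rw [le_div_iff₀ (by positivity)] at hstep
    linarith
  refine ⟨(le_mul_of_one_le_right (by positivity) hw1).trans hw, ?_⟩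
  have h1 := pow_le_pow_left₀ (by positivity) hw 2
  rw [mul_pow, Real.sq_sqrt (by positivity)] at h1
  have h2 : sB * 1 ≤ sB * sBm ^ 2 := mul_le_mul_of_nonneg_left (one_le_pow₀ hsBm) hsB0.le
  have h3 := mul_le_mul_of_nonneg_left h2 (sq_nonneg (α * D * L))
  linarith

namespace System

variable {n : ℕ} {H : Type*} [NormedAddCommGroup H] [InnerProductSpace ℝ H]
  {A B : Matrix (Fin n) (Fin n) ℝ} {πA πB : Fin n → ℝ} {α L Δ σ : ℝ} {x0 : H}
  {x y h ε : ℕ → NodeVec n H} {Gr : ℕ → H} {F : ℕ → ℝ} {m : ℕ}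

/-- The convergence bound in a form slightly sharper than the stated one, as needed for the
constant of the leading term after tuning the step size. -/
theorem sum_gradient_sq_le (hn : 2 ≤ n) (hE : ExpDecay A B πA πB)
    (S : System A B πA α L Δ σ x0 x y h ε Gr F) (hσ : 0 ≤ σ) (hα : 0 < α) (hL : 0 < L)
    (hΔ : 0 < Δ) (hm : 0 < m)
    (hstep : α ≤ 1 / (10 * cConst πA πB * m * Real.sqrt (mixSum B (colLimit πB)
      * mixSum (B ^ m) (colLimit πB) ^ 2) * L))
    (hC : blockThreshold n (cConst πA πB) (mixSum A (rowLimit πA))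
      (mixSum (A ^ m) (rowLimit πA)) (mixSum B (colLimit πB)) (mixSum (B ^ m) (colLimit πB)) ≤ m)
    (K : ℕ) :
    ∑ k ∈ Finset.range K, ‖Gr (m * k)‖ ^ 2 ≤ 5 / 2 * (Δ / (α * (cConst πA πB * m)))
      + 100 * (cConst πA πB * α * L * σ ^ 2 * K / n)
      + 144 * (mixSum B (colLimit πB) * σ ^ 2 * K / (cConst πA πB * m) ^ 2)
      + (10 * mixSum A (rowLimit πA) * mixSum (A ^ m) (rowLimit πA) ^ 2 * (n : ℝ) ^ 2
        + 312 * mixSum B (colLimit πB) ^ 2 * mixSum (B ^ m) (colLimit πB) * n)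
          * (L * Δ / (cConst πA πB * m) ^ 2) := by
  have hc := hE.cConst_pos hn
  have hcn := hE.cConst_le
  have hn2 : (2 : ℝ) ≤ n := by exact_mod_cast hn
  have hn0 : (0 : ℝ) < n := by linarith
  have hsA : 1 ≤ mixSum A (rowLimit πA) := by simpa using hE.one_le_mixSum_A hn one_pos
  have hsB : 1 ≤ mixSum B (colLimit πB) := by simpa using hE.one_le_mixSum_B hn one_pos
  have hsAm := hE.one_le_mixSum_A hn hm
  have hsBm := hE.one_le_mixSum_B hn hm
  obtain ⟨hmR, hsmall, hblock, hβ, hδ, hη⟩ :=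
    small_of_blockThreshold_le hn hc hcn hsA hsAm hsB hsBm hC
  have hsB0 : 0 < mixSum B (colLimit πB) := by linarith
  have hsA0 : 0 < mixSum A (rowLimit πA) := by linarith
  have hD : 0 < cConst πA πB * m := by positivity
  obtain ⟨hstep1, hstep2⟩ := small_of_step_le hα hL hD hsB hsBm
    (by rwa [← mul_assoc (10 : ℝ)])
  -- `n s_B ≤ c² m / 2`, so the mixing part of the noise is dominated by its average part
  have hmix : mixSum B (colLimit πB) ≤ m * (cConst πA πB ^ 2 / n) / 2 := by
    rw [← mul_div_assoc, div_div, le_div_iff₀ (by positivity)]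
    have h1 : 2 * (n * mixSum B (colLimit πB)) ≤ n * (n * mixSum B (colLimit πB)) :=
      mul_le_mul_of_nonneg_right hn2 (by positivity)
    have h2 := mul_le_mul_of_nonneg_left hsB
      (by positivity : 0 ≤ (n : ℝ) ^ 2 * mixSum B (colLimit πB))
    linarith
  have hfresh : ∀ s, ‖freshNoise B πA ε s m‖ ^ 2 ≤ σ ^ 2 * (3 * (m * (cConst πA πB ^ 2 / n))) := fun s =>
    (norm_freshNoise_sq_le hn hE S.noise_orth S.noise_sq s m).trans
      (mul_le_mul_of_nonneg_left (by linarith) (sq_nonneg σ))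
  have hνP : ∀ s r, r ≤ m → ‖freshNoise B πA ε s r + staleNoise B πA ε s r‖
      ≤ σ * Real.sqrt (5 * (m * (cConst πA πB ^ 2 / n))) := fun s r hr => by
    refine le_of_sq_le_sq ?_ (by positivity)
    rw [mul_pow, Real.sq_sqrt (by positivity)]
    refine (norm_noise_sq_le hn hE S.noise_orth S.noise_sq s r).trans
      (mul_le_mul_of_nonneg_left ?_ (sq_nonneg σ))
    have hrm : (r : ℝ) ≤ m := by exact_mod_cast hr
    have h2 := mul_le_mul_of_nonneg_right hrm (by positivity : 0 ≤ cConst πA πB ^ 2 / n)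
    linarith
  have hνO : ∀ s, ‖staleNoise B πA ε s m‖ ≤ σ * Real.sqrt (4 * mixSum B (colLimit πB)) := fun s => by
    refine le_of_sq_le_sq ?_ (by positivity)
    rw [mul_pow, Real.sq_sqrt (by positivity)]
    exact norm_staleNoise_sq_le hE S.noise_orth S.noise_sq s m
  have hνy : ∀ s, ‖conv (fun i => B ^ i) ε (s + 1) - conv (fun i => B ^ i) ε s‖
      ≤ σ * Real.sqrt (5 * n * mixSum B (colLimit πB)) := fun s => by
    refine le_of_sq_le_sq ?_ (by positivity)
    rw [mul_pow, Real.sq_sqrt (by positivity)]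
    exact norm_tracker_noise_sq_le hn hE S.noise_orth S.noise_sq s
  have hp := S.l2_drift_le hn hE hα.le hL.le hm hνP K
  have hq := S.l2_consensus_le hn hE hα.le hL.le hm hνy K
  have hR := S.l2_residual_le hn hE hL.le hm hνO K
  have hdesc := S.sum_descent hn hE hα hL hm hstep1 hfresh K
  rw [← l2_sq]
  have hH := S.init
  generalize hsAm' : mixSum (A ^ m) (rowLimit πA) = sAm at *
  generalize hsBm' : mixSum (B ^ m) (colLimit πB) = sBm at *
  generalize hsB' : mixSum B (colLimit πB) = sB at *
  generalize hsA' : mixSum A (rowLimit πA) = sA at *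
  generalize hc' : cConst πA πB = c at *
  clear hsmall hC hstep hfresh hνP hνO hνy hmix
  have hres := residual_le_of_system (r := Real.sqrt n) (n := n) (α := α) (L := L) (D := c * m)
    (sA := sA) (sB := sB) (γ := l2 K (fun k => ‖Gr (m * k)‖))
    (e := l2 K (spread πA x m)) (j := l2 K (jump πA x m)) (p := l2 K (drift πA x m))
    (q := l2 K (consensus πA x m))
    (R := l2 K (fun k => ‖residual B πA πB h ε Gr m k‖))
    (N₁ := ‖h 0‖ * sB + Real.sqrt K * (σ * Real.sqrt (5 * (m * (c ^ 2 / n)))))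
    (N₂ := ‖h 0‖ * (Real.sqrt 2 * sB * (Real.sqrt n * Real.sqrt sAm))
      + Real.sqrt K * (sA * (σ * Real.sqrt (5 * n * sB))))
    (N₃ := ‖h 0‖ * sB + Real.sqrt K * (σ * Real.sqrt (4 * sB)))
    hα.le hL.le (Real.sqrt_pos.mpr hn0) (Real.sq_sqrt hn0.le) l2_nonneg l2_nonneg l2_nonneg
    (by positivity) (by positivity) hstep1 hβ hδ hη hD (l2_spread_le πA x K) (l2_jump_le πA x K)
    (by linarith) (by linarith) (by linarith)
  exact sq_le_of_descent hn2 hc hD rfl hsA hsB hsAm hsBm hL hα hΔ (Nat.cast_nonneg K)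
    (Real.sqrt_pos.mpr hn0) (Real.sq_sqrt hn0.le) l2_nonneg hH
    (by rw [mul_pow, Real.sq_sqrt (by positivity)])
    (by rw [mul_pow, Real.sq_sqrt (by positivity)])
    (by rw [mul_pow, Real.sq_sqrt (by positivity)])
    hstep1 hstep2 hblock hdesc hres

end System

/-! ### Conditionally unbiased and conditionally independent noise -/

section Orthogonality

/-- Conditional independence, integrated over an event of `Y`. -/
theorem measureReal_inter_eq_of_condIndepGiven {Ω E : Type*} [MeasurableSpace E]
    {m mΩ : MeasurableSpace Ω} {μ : Measure Ω} [IsProbabilityMeasure μ] (hm : m ≤ mΩ) {X Y : Ω → E}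
    (hX : Measurable X) (hY : Measurable Y) (h : CondIndepGiven m μ X Y) {U V : Set E}
    (hU : MeasurableSet U) (hV : MeasurableSet V) :
    μ.real (X ⁻¹' U ∩ Y ⁻¹' V) = ∫ ω in Y ⁻¹' V, (μ⟦X ⁻¹' U | m⟧) ω ∂μ := by
  have hA := hX hU
  have hB := hY hV
  have hi : ∀ {s : Set Ω}, MeasurableSet s → Integrable (s.indicator fun _ => (1 : ℝ)) μ :=
    fun hs => (integrable_const 1).indicator hs
  have hprod : Integrable (fun ω => (μ⟦X ⁻¹' U | m⟧) ω
      * (Y ⁻¹' V).indicator (fun _ => (1 : ℝ)) ω) μ := by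
    have : (fun ω => (μ⟦X ⁻¹' U | m⟧) ω * (Y ⁻¹' V).indicator (fun _ => (1 : ℝ)) ω)
        = (Y ⁻¹' V).indicator (μ⟦X ⁻¹' U | m⟧) := by
      ext ω
      by_cases hω : ω ∈ Y ⁻¹' V <;> simp [hω]
    rw [this]
    exact integrable_condExp.indicator hB
  calc μ.real (X ⁻¹' U ∩ Y ⁻¹' V)
      = ∫ ω, (X ⁻¹' U ∩ Y ⁻¹' V).indicator (fun _ => (1 : ℝ)) ω ∂μ := by
        rw [integral_indicator (hA.inter hB)]; simp
    _ = ∫ ω, (μ⟦X ⁻¹' U ∩ Y ⁻¹' V | m⟧) ω ∂μ := (integral_condExp hm).symm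
    _ = ∫ ω, (μ⟦X ⁻¹' U | m⟧) ω * (μ⟦Y ⁻¹' V | m⟧) ω ∂μ := integral_congr_ae (h U V hU hV)
    _ = ∫ ω, (μ[fun ω => (μ⟦X ⁻¹' U | m⟧) ω
          * (Y ⁻¹' V).indicator (fun _ => (1 : ℝ)) ω | m]) ω ∂μ :=
        (integral_congr_ae (condExp_mul_of_stronglyMeasurable_left stronglyMeasurable_condExp
          hprod (hi hB))).symm
    _ = ∫ ω, (μ⟦X ⁻¹' U | m⟧) ω * (Y ⁻¹' V).indicator (fun _ => (1 : ℝ)) ω ∂μ :=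
        integral_condExp hm
    _ = ∫ ω in Y ⁻¹' V, (μ⟦X ⁻¹' U | m⟧) ω ∂μ := by
        rw [← integral_indicator hB]
        refine integral_congr_ae (Filter.Eventually.of_forall fun ω => ?_)
        by_cases hω : ω ∈ Y ⁻¹' V <;> simp [hω]

section Integral

variable {Ω E : Type*} [NormedAddCommGroup E] [InnerProductSpace ℝ E]
  {mΩ : MeasurableSpace Ω} {μ : Measure Ω}

/-- The inner product of two classes in `L²` is the expected pointwise inner product. -/
theorem inner_toLp_eq_integral {f g : Ω → E} (hf : MemLp f 2 μ) (hg : MemLp g 2 μ) :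
    inner ℝ (hf.toLp f) (hg.toLp g) = ∫ ω, inner ℝ (f ω) (g ω) ∂μ := by
  rw [L2.inner_def]
  refine integral_congr_ae ?_
  filter_upwards [hf.coeFn_toLp, hg.coeFn_toLp] with ω h1 h2
  rw [h1, h2]

theorem integrable_inner_of_memLp {f g : Ω → E} (hf : MemLp f 2 μ) (hg : MemLp g 2 μ) :
    Integrable (fun ω => inner ℝ (f ω) (g ω)) μ := by
  refine (L2.integrable_inner (𝕜 := ℝ) (hf.toLp f) (hg.toLp g)).congr ?_
  filter_upwards [hf.coeFn_toLp, hg.coeFn_toLp] with ω h1 h2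
  rw [h1, h2]

end Integral

variable {Ω E : Type*} [NormedAddCommGroup E] [InnerProductSpace ℝ E] [CompleteSpace E]
  {m mΩ : MeasurableSpace Ω} {μ : Measure Ω} [IsProbabilityMeasure μ]

/-- A vector known to `m` is orthogonal to every vector with vanishing conditional mean. -/
theorem integral_inner_eq_zero_of_condExp (hm : m ≤ mΩ) {f Z : Ω → E}
    (hfm : StronglyMeasurable[m] f) (hf : MemLp f 2 μ) (hZ : MemLp Z 2 μ)
    (h0 : μ[Z | m] =ᵐ[μ] 0) : ∫ ω, inner ℝ (f ω) (Z ω) ∂μ = 0 := by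
  have hint : Integrable (fun ω => innerSL ℝ (f ω) (Z ω)) μ := integrable_inner_of_memLp hf hZ
  have h1 := condExp_bilin_of_stronglyMeasurable_left (innerSL ℝ (E := E)) hfm hint
    (hZ.integrable (by norm_num))
  have h2 := integral_condExp (μ := μ) (f := fun ω => innerSL ℝ (f ω) (Z ω)) hm
  rw [show (fun ω => inner ℝ (f ω) (Z ω)) = fun ω => innerSL ℝ (f ω) (Z ω) from rfl, ← h2,
    integral_congr_ae h1]
  refine (integral_congr_ae ?_).trans (integral_zero _ _)
  filter_upwards [h0] with ω hω
  simp [hω]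

variable [MeasurableSpace E] [BorelSpace E] [SecondCountableTopology E]

/-- Given conditional independence, the centered `Y` integrates to zero over the events of `X`. -/
theorem setIntegral_preimage_eq_of_condIndepGiven (hm : m ≤ mΩ) {X Y : Ω → E}
    (hX : Measurable X) (hY : Measurable Y) (hYi : Integrable Y μ)
    (h : CondIndepGiven m μ X Y) {U : Set E} (hU : MeasurableSet U) :
    ∫ ω in X ⁻¹' U, Y ω ∂μ = ∫ ω in X ⁻¹' U, (μ[Y | m]) ω ∂μ := by
  have hA := hX hU
  set w := μ⟦X ⁻¹' U | m⟧ with hw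
  have hwi : Integrable w μ := integrable_condExp
  have hiA : Integrable ((X ⁻¹' U).indicator fun _ => (1 : ℝ)) μ :=
    (integrable_const 1).indicator hA
  have hw0 : 0 ≤ᵐ[μ] w := condExp_nonneg (Filter.Eventually.of_forall fun ω =>
    Set.indicator_nonneg (fun _ _ => zero_le_one) ω)
  have hw1 : ∀ᵐ ω ∂μ, ‖w ω‖ ≤ 1 := by
    have h1 : w ≤ᵐ[μ] μ[fun _ => (1 : ℝ) | m] := condExp_mono hiA (integrable_const 1)
      (Filter.Eventually.of_forall fun ω => Set.indicator_le_self' (fun _ _ => zero_le_one) ω)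
    rw [condExp_const hm] at h1
    filter_upwards [hw0, h1] with ω a b
    rw [Real.norm_of_nonneg a]; exact b
  have hwm : Measurable fun ω => ENNReal.ofReal (w ω) :=
    (stronglyMeasurable_condExp.mono hm).measurable.ennreal_ofReal
  -- the law of `Y` on the event `X ∈ U` is its law weighted by `P(X ∈ U | m)`
  have hlaw : (μ.restrict (X ⁻¹' U)).map Y
      = (μ.withDensity fun ω => ENNReal.ofReal (w ω)).map Y := by
    ext V hV
    rw [Measure.map_apply hY hV, Measure.map_apply hY hV, Measure.restrict_apply (hY hV),
      withDensity_apply _ (hY hV), Set.inter_comm,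
      ← ofReal_integral_eq_lintegral_ofReal hwi.integrableOn (ae_restrict_of_ae hw0),
      ← measureReal_inter_eq_of_condIndepGiven hm hX hY h hU hV, ofReal_measureReal]
  have h1 : ∫ ω in X ⁻¹' U, Y ω ∂μ = ∫ ω, w ω • Y ω ∂μ := by
    have e1 := integral_map (μ := μ.restrict (X ⁻¹' U)) hY.aemeasurable
      (f := fun e : E => e) measurable_id.aestronglyMeasurable
    have e2 := integral_map (μ := μ.withDensity fun ω => ENNReal.ofReal (w ω)) hY.aemeasurable
      (f := fun e : E => e) measurable_id.aestronglyMeasurable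
    rw [← e1, hlaw, e2, integral_withDensity_eq_integral_toReal_smul hwm
      (Filter.Eventually.of_forall fun _ => ENNReal.ofReal_lt_top)]
    refine integral_congr_ae ?_
    filter_upwards [hw0] with ω hω
    rw [ENNReal.toReal_ofReal hω]
  have hlsmul : ∀ (a : Ω → ℝ) (v : Ω → E),
      (fun ω => (ContinuousLinearMap.lsmul ℝ ℝ : ℝ →L[ℝ] E →L[ℝ] E) (a ω) (v ω))
        = fun ω => a ω • v ω := fun a v => rfl
  have hwY : Integrable (fun ω => w ω • Y ω) μ :=
    hYi.bdd_smul 1 hwi.aestronglyMeasurable hw1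
  have h2 : ∫ ω, w ω • Y ω ∂μ = ∫ ω, w ω • (μ[Y | m]) ω ∂μ := by
    rw [← integral_condExp hm]
    have := condExp_bilin_of_stronglyMeasurable_left
      (ContinuousLinearMap.lsmul ℝ ℝ : ℝ →L[ℝ] E →L[ℝ] E)
      (stronglyMeasurable_condExp (m := m) (μ := μ) (f := (X ⁻¹' U).indicator fun _ => (1 : ℝ)))
      (by rw [hlsmul]; exact hwY) hYi
    exact integral_congr_ae this
  have h3 : ∫ ω, w ω • (μ[Y | m]) ω ∂μ
      = ∫ ω, (X ⁻¹' U).indicator (fun _ => (1 : ℝ)) ω • (μ[Y | m]) ω ∂μ := by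
    have hi : Integrable (fun ω => (X ⁻¹' U).indicator (fun _ => (1 : ℝ)) ω • (μ[Y | m]) ω) μ := by
      refine integrable_condExp.bdd_smul 1 hiA.aestronglyMeasurable
        (Filter.Eventually.of_forall fun ω => ?_)
      by_cases hω : ω ∈ X ⁻¹' U <;> simp [hω]
    have := condExp_bilin_of_stronglyMeasurable_right
      (ContinuousLinearMap.lsmul ℝ ℝ : ℝ →L[ℝ] E →L[ℝ] E)
      (stronglyMeasurable_condExp (m := m) (μ := μ) (f := Y))
      (by rw [hlsmul]; exact hi) hiA
    rw [hlsmul] at this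
    rw [← integral_condExp (f := fun ω => (X ⁻¹' U).indicator (fun _ => (1 : ℝ)) ω
      • (μ[Y | m]) ω) hm, integral_congr_ae this]
    rfl
  rw [h1, h2, h3, ← integral_indicator hA]
  refine integral_congr_ae (Filter.Eventually.of_forall fun ω => ?_)
  by_cases hω : ω ∈ X ⁻¹' U <;> simp [hω]

/-- Conditionally independent square integrable vectors are conditionally uncorrelated. -/
theorem integral_inner_centered_eq_zero (hm : m ≤ mΩ) {X Y : Ω → E}
    (hX : StronglyMeasurable X) (hY : StronglyMeasurable Y) (hX2 : MemLp X 2 μ)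
    (hY2 : MemLp Y 2 μ) (h : CondIndepGiven m μ X Y) :
    ∫ ω, inner ℝ (X ω) (Y ω - (μ[Y | m]) ω) ∂μ = 0 := by
  have hYi : Integrable Y μ := hY2.integrable (by norm_num)
  have hcomap : MeasurableSpace.comap X inferInstance ≤ mΩ := hX.measurable.comap_le
  have hZ : MemLp (fun ω => Y ω - (μ[Y | m]) ω) 2 μ := hY2.sub (hY2.condExp (by norm_num))
  refine integral_inner_eq_zero_of_condExp hcomap (f := X)
    (comap_measurable X).stronglyMeasurable hX2 hZ ?_
  refine (ae_eq_condExp_of_forall_setIntegral_eq hcomap (hZ.integrable (by norm_num))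
    (fun s _ _ => integrableOn_zero) ?_ aestronglyMeasurable_zero).symm
  rintro s ⟨U, hU, rfl⟩ -
  rw [integral_sub hYi.integrableOn integrable_condExp.integrableOn,
    setIntegral_preimage_eq_of_condIndepGiven hm hX.measurable hY.measurable hYi h hU]
  simp

end Orthogonality

/-! ### Functions with Lipschitz gradient -/

section Gradient

variable {E : Type*} [NormedAddCommGroup E] [InnerProductSpace ℝ E] [CompleteSpace E]
  {f : E → ℝ} {L : ℝ}

/-- The quadratic upper bound for a function with `L`-Lipschitz gradient. -/
theorem le_add_inner_gradient_add_sq (hf : Differentiable ℝ f)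
    (hL : ∀ x y, ‖gradient f x - gradient f y‖ ≤ L * ‖x - y‖) (x y : E) :
    f y ≤ f x + inner ℝ (gradient f x) (y - x) + L / 2 * ‖y - x‖ ^ 2 := by
  set v := y - x with hv
  set φ : ℝ → ℝ := fun s => f (x + s • v) - s * inner ℝ (gradient f x) v
    - L / 2 * s ^ 2 * ‖v‖ ^ 2 with hφ
  have hline : ∀ s : ℝ, HasDerivAt (fun r : ℝ => x + r • v) v s := fun s => by
    simpa using ((hasDerivAt_id s).smul_const v).const_add x
  have hd : ∀ s, HasDerivAt φ (inner ℝ (gradient f (x + s • v)) v - inner ℝ (gradient f x) v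
      - L * s * ‖v‖ ^ 2) s := fun s => by
    have h1 : HasDerivAt (fun r : ℝ => f (x + r • v)) (inner ℝ (gradient f (x + s • v)) v) s := by
      have := (hf (x + s • v)).hasGradientAt.hasFDerivAt.comp_hasDerivAt s (hline s)
      simpa [Function.comp_def] using this
    have h2 : HasDerivAt (fun r : ℝ => r * inner ℝ (gradient f x) v)
        (inner ℝ (gradient f x) v) s := by
      simpa using (hasDerivAt_id s).mul_const (inner ℝ (gradient f x) v)
    have h3 : HasDerivAt (fun r : ℝ => L / 2 * r ^ 2 * ‖v‖ ^ 2) (L * s * ‖v‖ ^ 2) s := by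
      have := ((hasDerivAt_pow 2 s).const_mul (L / 2)).mul_const (‖v‖ ^ 2)
      refine this.congr_deriv ?_
      rw [Nat.cast_ofNat, Nat.add_one_sub_one, pow_one]
      ring
    exact (h1.sub h2).sub h3
  have hanti : AntitoneOn φ (Set.Icc 0 1) := by
    refine antitoneOn_of_deriv_nonpos (convex_Icc 0 1)
      (fun s _ => (hd s).continuousAt.continuousWithinAt)
      (fun s _ => (hd s).differentiableAt.differentiableWithinAt) fun s hs => ?_
    rw [interior_Icc] at hs
    rw [(hd s).deriv, ← inner_sub_left]
    have h1 := (real_inner_le_norm (gradient f (x + s • v) - gradient f x) v)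
    have h2 := hL (x + s • v) x
    rw [add_sub_cancel_left, norm_smul, Real.norm_of_nonneg hs.1.le] at h2
    have h3 := mul_le_mul_of_nonneg_right h2 (norm_nonneg v)
    nlinarith
  have h := hanti (Set.left_mem_Icc.mpr zero_le_one) (Set.right_mem_Icc.mpr zero_le_one)
    zero_le_one
  simp only [hφ, one_smul, zero_smul, add_zero, one_pow, mul_one, one_mul, zero_mul, sub_zero,
    ne_eq, OfNat.ofNat_ne_zero, not_false_eq_true, zero_pow, mul_zero] at h
  rw [hv, add_sub_cancel] at h
  linarith

/-- One exact gradient step of length `1 / L` shows that `‖∇f‖² ≤ 2L (f - inf f)`. -/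
theorem norm_gradient_sq_le (hL0 : 0 < L) (hf : Differentiable ℝ f)
    (hL : ∀ x y, ‖gradient f x - gradient f y‖ ≤ L * ‖x - y‖) (hb : BddBelow (Set.range f))
    (x : E) : ‖gradient f x‖ ^ 2 ≤ 2 * L * (f x - ⨅ z, f z) := by
  have h1 := le_add_inner_gradient_add_sq hf hL x (x - L⁻¹ • gradient f x)
  have h2 := ciInf_le hb (x - L⁻¹ • gradient f x)
  rw [sub_sub_cancel_left, inner_neg_right, inner_smul_right, real_inner_self_eq_norm_sq,
    norm_neg, norm_smul, Real.norm_of_nonneg (inv_nonneg.mpr hL0.le), mul_pow] at h1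
  have e : L / 2 * (L⁻¹ ^ 2 * ‖gradient f x‖ ^ 2) = L⁻¹ * ‖gradient f x‖ ^ 2 / 2 := by
    field_simp
  have h3 : L⁻¹ * ‖gradient f x‖ ^ 2 ≤ 2 * (f x - ⨅ z, f z) := by linarith
  rw [inv_mul_le_iff₀ hL0] at h3
  linarith

theorem continuous_gradient_of_lipschitz
    (hL : ∀ x y, ‖gradient f x - gradient f y‖ ≤ L * ‖x - y‖) : Continuous (gradient f) := by
  refine (LipschitzWith.of_dist_le_mul (K := L.toNNReal) fun x y => ?_).continuous
  rw [dist_eq_norm, dist_eq_norm]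
  exact (hL x y).trans (mul_le_mul_of_nonneg_right (Real.le_coe_toNNReal L) (norm_nonneg _))

end Gradient

section Average

variable {n d : ℕ} {f : Fin n → EuclideanSpace ℝ (Fin d) → ℝ} {x0 : EuclideanSpace ℝ (Fin d)}
  {L Δ : ℝ}

theorem Smooth.continuous_gradient (h : Smooth f x0 L Δ) (i : Fin n) :
    Continuous (gradient (f i)) :=
  continuous_gradient_of_lipschitz (h.lipschitz i)

theorem Smooth.hasGradientAt_avgFun (h : Smooth f x0 L Δ) (x : EuclideanSpace ℝ (Fin d)) :
    HasGradientAt (avgFun f) ((n : ℝ)⁻¹ • ∑ i, gradient (f i) x) x := by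
  rw [hasGradientAt_iff_hasFDerivAt, map_smul, map_sum]
  have := (HasFDerivAt.fun_sum (u := Finset.univ)
    fun i _ => ((h.differentiable i) x).hasGradientAt.hasFDerivAt).const_mul (1 / (n : ℝ))
  simpa [show avgFun f = fun y => 1 / (n : ℝ) * ∑ i, f i y from rfl] using this

theorem Smooth.gradient_avgFun (h : Smooth f x0 L Δ) (x : EuclideanSpace ℝ (Fin d)) :
    gradient (avgFun f) x = (n : ℝ)⁻¹ • ∑ i, gradient (f i) x :=
  (h.hasGradientAt_avgFun x).gradient

theorem Smooth.avgFun_le (h : Smooth f x0 L Δ) (hn : 0 < n) (x y : EuclideanSpace ℝ (Fin d)) :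
    avgFun f y ≤ avgFun f x + inner ℝ (gradient (avgFun f) x) (y - x)
      + L / 2 * ‖y - x‖ ^ 2 := by
  have hn' : (0 : ℝ) < n := Nat.cast_pos.mpr hn
  have hsum := Finset.sum_le_sum fun i (_ : i ∈ Finset.univ) =>
    le_add_inner_gradient_add_sq (h.differentiable i) (h.lipschitz i) x y
  rw [Finset.sum_add_distrib, Finset.sum_add_distrib, Finset.sum_const, Finset.card_univ,
    Fintype.card_fin, nsmul_eq_mul] at hsum
  have := mul_le_mul_of_nonneg_left hsum (inv_nonneg.mpr hn'.le)
  rw [h.gradient_avgFun, inner_smul_left, sum_inner, avgFun, avgFun, one_div]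
  rw [mul_add, mul_add, inv_mul_cancel_left₀ hn'.ne'] at this
  exact this

theorem Smooth.avgFun_ge (h : Smooth f x0 L Δ) (hn : 0 < n) (x : EuclideanSpace ℝ (Fin d)) :
    avgFun f x0 - Δ ≤ avgFun f x := by
  have hn' : (0 : ℝ) < n := Nat.cast_pos.mpr hn
  have hsum : ∑ i, (f i x0 - Δ) ≤ ∑ i, f i x := Finset.sum_le_sum fun i _ => by
    have h1 := h.gap i
    have h2 := ciInf_le (h.bddBelow i) x
    linarith
  rw [Finset.sum_sub_distrib, Finset.sum_const, Finset.card_univ, Fintype.card_fin,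
    nsmul_eq_mul] at hsum
  have := mul_le_mul_of_nonneg_left hsum (inv_nonneg.mpr hn'.le)
  rw [avgFun, avgFun, one_div]
  rw [mul_sub, inv_mul_cancel_left₀ hn'.ne'] at this
  exact this

theorem Smooth.norm_gradient_init_sq_le (h : Smooth f x0 L Δ) (hL : 0 < L) (i : Fin n) :
    ‖gradient (f i) x0‖ ^ 2 ≤ 2 * L * Δ :=
  (norm_gradient_sq_le hL (h.differentiable i) (h.lipschitz i) (h.bddBelow i) x0).trans
    (mul_le_mul_of_nonneg_left (h.gap i) (by positivity))

end Average

/-! ### Square integrable random vectors as elements of a Hilbert space -/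

section Classes

variable {Ω E : Type*} [NormedAddCommGroup E] {mΩ : MeasurableSpace Ω} {μ : Measure Ω}
  {f g : Ω → E}

open Classical in
/-- The element of `L²(μ; E)` given by a square integrable function; a function that is not square
integrable is sent to `0`. -/
noncomputable def toL2 (μ : Measure Ω) (f : Ω → E) : Lp E 2 μ :=
  if h : MemLp f 2 μ then h.toLp f else 0

theorem toL2_eq (hf : MemLp f 2 μ) : toL2 μ f = hf.toLp f := dif_pos hf

theorem memLp_add (hf : MemLp f 2 μ) (hg : MemLp g 2 μ) : MemLp (fun ω => f ω + g ω) 2 μ :=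
  hf.add hg

theorem toL2_add (hf : MemLp f 2 μ) (hg : MemLp g 2 μ) :
    toL2 μ (fun ω => f ω + g ω) = toL2 μ f + toL2 μ g := by
  rw [show (fun ω => f ω + g ω) = f + g from rfl, toL2_eq hf, toL2_eq hg, toL2_eq (hf.add hg),
    MemLp.toLp_add]

theorem toL2_sub (hf : MemLp f 2 μ) (hg : MemLp g 2 μ) :
    toL2 μ (fun ω => f ω - g ω) = toL2 μ f - toL2 μ g := by
  rw [show (fun ω => f ω - g ω) = f - g from rfl, toL2_eq hf, toL2_eq hg, toL2_eq (hf.sub hg),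
    MemLp.toLp_sub]

/-- A pointwise Lipschitz bound passes to the `L²` norms. -/
theorem norm_toL2_le {c : ℝ} (hf : MemLp f 2 μ) (hg : MemLp g 2 μ)
    (h : ∀ ω, ‖f ω‖ ≤ c * ‖g ω‖) : ‖toL2 μ f‖ ≤ c * ‖toL2 μ g‖ := by
  rw [toL2_eq hf, toL2_eq hg]
  refine Lp.norm_le_mul_norm_of_ae_le_mul ?_
  filter_upwards [hf.coeFn_toLp, hg.coeFn_toLp] with ω h1 h2
  rw [h1, h2]; exact h ω

variable [InnerProductSpace ℝ E]

theorem toL2_smul (a : ℝ) (hf : MemLp f 2 μ) : toL2 μ (fun ω => a • f ω) = a • toL2 μ f := by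
  rw [show (fun ω => a • f ω) = a • f from rfl, toL2_eq hf, toL2_eq (hf.const_smul a),
    MemLp.toLp_const_smul]

theorem memLp_smul (a : ℝ) (hf : MemLp f 2 μ) : MemLp (fun ω => a • f ω) 2 μ :=
  hf.const_smul a

theorem memLp_sum_smul {ι : Type*} (s : Finset ι) (a : ι → ℝ) {u : ι → Ω → E}
    (hu : ∀ i, MemLp (u i) 2 μ) : MemLp (fun ω => ∑ i ∈ s, a i • u i ω) 2 μ :=
  memLp_finsetSum s fun i _ => memLp_smul (a i) (hu i)

theorem toL2_sum_smul {ι : Type*} (s : Finset ι) (a : ι → ℝ) {u : ι → Ω → E}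
    (hu : ∀ i, MemLp (u i) 2 μ) :
    toL2 μ (fun ω => ∑ i ∈ s, a i • u i ω) = ∑ i ∈ s, a i • toL2 μ (u i) := by
  classical
  induction s using Finset.induction_on with
  | empty =>
    have h0 : MemLp (0 : Ω → E) 2 μ := MemLp.zero
    have e : (fun ω => ∑ j ∈ (∅ : Finset ι), a j • u j ω) = (0 : Ω → E) :=
      funext fun ω => Finset.sum_empty
    rw [e, toL2_eq h0, MemLp.toLp_zero, Finset.sum_empty]
  | insert i s hi ih =>
    have h1 : MemLp (fun ω => a i • u i ω) 2 μ := memLp_smul (a i) (hu i)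
    have h2 : MemLp (fun ω => ∑ i ∈ s, a i • u i ω) 2 μ := memLp_sum_smul s a hu
    have h3 := toL2_add h1 h2
    have h4 := toL2_smul (a i) (hu i)
    have e : (fun ω => ∑ j ∈ insert i s, a j • u j ω)
        = fun ω => a i • u i ω + ∑ j ∈ s, a j • u j ω :=
      funext fun ω => Finset.sum_insert hi
    rw [e, h3, h4, ih, Finset.sum_insert hi]

theorem inner_toL2 (hf : MemLp f 2 μ) (hg : MemLp g 2 μ) :
    inner ℝ (toL2 μ f) (toL2 μ g) = ∫ ω, inner ℝ (f ω) (g ω) ∂μ := by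
  rw [toL2_eq hf, toL2_eq hg, inner_toLp_eq_integral]

theorem norm_toL2_sq (hf : MemLp f 2 μ) : ‖toL2 μ f‖ ^ 2 = ∫ ω, ‖f ω‖ ^ 2 ∂μ := by
  rw [← real_inner_self_eq_norm_sq, inner_toL2 hf hf]
  simp

end Classes

/-! ### The random process as a system in `L²` -/

section Iterates

variable {n d : ℕ} {Ω : Type*} {mΩ : MeasurableSpace Ω} {μ : Measure Ω}
  {ℱ : Filtration ℕ mΩ} {f : Fin n → EuclideanSpace ℝ (Fin d) → ℝ}
  {A B : Matrix (Fin n) (Fin n) ℝ} {πA : Fin n → ℝ} {α L Δ σ : ℝ} {x0 : EuclideanSpace ℝ (Fin d)}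
  {x y g : ℕ → Fin n → Ω → EuclideanSpace ℝ (Fin d)}

/-- The Push-Pull recursion for random vectors `x t i`, `y t i` and stochastic gradients `g t i`. -/
structure Recursion (A B : Matrix (Fin n) (Fin n) ℝ) (α : ℝ) (x0 : EuclideanSpace ℝ (Fin d))
    (x y g : ℕ → Fin n → Ω → EuclideanSpace ℝ (Fin d)) : Prop where
  x_zero : ∀ i, x 0 i = fun _ => x0
  y_zero : ∀ i, y 0 i = g 0 i
  x_succ : ∀ t i, x (t + 1) i = fun ω => (∑ j, A i j • x t j ω) - α • y t i ω
  y_succ : ∀ t i, y (t + 1) i = fun ω => (∑ j, B i j • y t j ω) + g (t + 1) i ω - g t i ω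

theorem recursion_iter {S : Fin n → Type*} (A B : Matrix (Fin n) (Fin n) ℝ) (α : ℝ)
    (G : (i : Fin n) → EuclideanSpace ℝ (Fin d) → S i → EuclideanSpace ℝ (Fin d))
    (x0 : EuclideanSpace ℝ (Fin d)) (ξ : ℕ → (i : Fin n) → Ω → S i) :
    Recursion A B α x0 (xNode A B α G x0 ξ)
      (fun t i ω => (iter A B α G x0 (fun u j => ξ u j ω) t).2 i) (gNode A B α G x0 ξ) where
  x_zero _ := rfl
  y_zero _ := rfl
  x_succ _ _ := rfl
  y_succ _ _ := rfl

theorem Recursion.stronglyMeasurable (R : Recursion A B α x0 x y g)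
    (O : GradientOracle μ ℱ f x g σ) (t : ℕ) :
    (∀ i, StronglyMeasurable[ℱ t] (x t i)) ∧ ∀ i, StronglyMeasurable[ℱ (t + 1)] (y t i) := by
  induction t with
  | zero =>
    refine ⟨fun i => ?_, fun i => ?_⟩
    · rw [R.x_zero]; exact stronglyMeasurable_const
    · rw [R.y_zero]; exact O.measurable 0 i
  | succ t ih =>
    have hle : ℱ (t + 1) ≤ ℱ (t + 1 + 1) := ℱ.mono (Nat.le_succ _)
    refine ⟨fun i => ?_, fun i => ?_⟩
    · rw [R.x_succ]
      exact (Finset.stronglyMeasurable_fun_sum _ fun j _ =>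
        ((ih.1 j).mono (ℱ.mono (Nat.le_succ _))).const_smul (A i j)).sub
          ((ih.2 i).const_smul α)
    · rw [R.y_succ]
      exact ((Finset.stronglyMeasurable_fun_sum _ fun j _ =>
        ((ih.2 j).mono hle).const_smul (B i j)).add (O.measurable (t + 1) i)).sub
          ((O.measurable t i).mono hle)

/-- The noise of the stochastic gradient of node `i` at iteration `t`. -/
noncomputable def noise (f : Fin n → EuclideanSpace ℝ (Fin d) → ℝ)
    (x g : ℕ → Fin n → Ω → EuclideanSpace ℝ (Fin d)) (t : ℕ) (i : Fin n) (ω : Ω) :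
    EuclideanSpace ℝ (Fin d) :=
  g t i ω - gradient (f i) (x t i ω)

theorem Recursion.stronglyMeasurable_gradient (R : Recursion A B α x0 x y g)
    (Sm : Smooth f x0 L Δ) (O : GradientOracle μ ℱ f x g σ) (t : ℕ) (i : Fin n) :
    StronglyMeasurable[ℱ t] fun ω => gradient (f i) (x t i ω) :=
  (Sm.continuous_gradient i).comp_stronglyMeasurable ((R.stronglyMeasurable O t).1 i)

theorem Recursion.stronglyMeasurable_noise (R : Recursion A B α x0 x y g)
    (Sm : Smooth f x0 L Δ) (O : GradientOracle μ ℱ f x g σ) (t : ℕ) (i : Fin n) :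
    StronglyMeasurable[ℱ (t + 1)] (noise f x g t i) :=
  (O.measurable t i).sub
    ((R.stronglyMeasurable_gradient Sm O t i).mono (ℱ.mono (Nat.le_succ t)))

theorem GradientOracle.memLp_noise (O : GradientOracle μ ℱ f x g σ) (t : ℕ) (i : Fin n) :
    MemLp (noise f x g t i) 2 μ :=
  O.memLp t i

variable [IsProbabilityMeasure μ]

theorem Smooth.memLp_gradient (Sm : Smooth f x0 L Δ) (i : Fin n)
    {u : Ω → EuclideanSpace ℝ (Fin d)} (hu : MemLp u 2 μ) :
    MemLp (fun ω => gradient (f i) (u ω)) 2 μ := by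
  have hm : AEStronglyMeasurable (fun ω => gradient (f i) (u ω)) μ :=
    (Sm.continuous_gradient i).comp_aestronglyMeasurable hu.aestronglyMeasurable
  have h1 : MemLp (fun ω => gradient (f i) (u ω) - gradient (f i) 0) 2 μ :=
    hu.of_le_mul (hm.sub aestronglyMeasurable_const) (Filter.Eventually.of_forall fun ω => by
      simpa using Sm.lipschitz i (u ω) 0)
  simpa using memLp_add h1 (memLp_const (gradient (f i) 0))

/-- Square integrability of the iterates, from the growth of the gradients and the noise. -/
theorem Recursion.memLp (R : Recursion A B α x0 x y g) (Sm : Smooth f x0 L Δ)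
    (O : GradientOracle μ ℱ f x g σ) (t : ℕ) :
    (∀ i, MemLp (x t i) 2 μ) ∧ ∀ i, MemLp (y t i) 2 μ := by
  have hg : ∀ t i, MemLp (x t i) 2 μ → MemLp (g t i) 2 μ := fun t i h => by
    simpa using memLp_add (O.memLp t i) (Sm.memLp_gradient i h)
  induction t with
  | zero =>
    have h0 : ∀ i, MemLp (x 0 i) 2 μ := fun i => by rw [R.x_zero]; exact memLp_const x0
    exact ⟨h0, fun i => by rw [R.y_zero]; exact hg 0 i (h0 i)⟩
  | succ t ih =>
    have h1 : ∀ i, MemLp (x (t + 1) i) 2 μ := fun i => by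
      rw [R.x_succ]
      exact (memLp_sum_smul _ (A i) ih.1).sub (memLp_smul α (ih.2 i))
    refine ⟨h1, fun i => ?_⟩
    rw [R.y_succ]
    exact ((memLp_sum_smul _ (B i) ih.2).add (hg _ i (h1 i))).sub (hg t i (ih.1 i))

theorem Recursion.memLp_stochGradient (R : Recursion A B α x0 x y g) (Sm : Smooth f x0 L Δ)
    (O : GradientOracle μ ℱ f x g σ) (t : ℕ) (i : Fin n) : MemLp (g t i) 2 μ := by
  simpa using memLp_add (O.memLp t i) (Sm.memLp_gradient i ((R.memLp Sm O t).1 i))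

theorem Recursion.condExp_noise (R : Recursion A B α x0 x y g) (Sm : Smooth f x0 L Δ)
    (O : GradientOracle μ ℱ f x g σ) (t : ℕ) (i : Fin n) :
    μ[noise f x g t i | ℱ t] =ᵐ[μ] 0 := by
  have hgi := (R.memLp_stochGradient Sm O t i).integrable (q := 2) (by norm_num)
  have hhi := (Sm.memLp_gradient i ((R.memLp Sm O t).1 i)).integrable (q := 2) (by norm_num)
  have h1 := condExp_sub hgi hhi (ℱ t)
  rw [condExp_of_stronglyMeasurable (ℱ.le t) (R.stronglyMeasurable_gradient Sm O t i) hhi] at h1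
  refine Filter.EventuallyEq.trans h1 ?_
  filter_upwards [O.unbiased t i] with ω h2
  simp [h2]

/-- The noise at iteration `t` is orthogonal to everything known before. -/
theorem Recursion.integral_inner_noise_eq_zero (R : Recursion A B α x0 x y g)
    (Sm : Smooth f x0 L Δ) (O : GradientOracle μ ℱ f x g σ) (t : ℕ) (i : Fin n)
    {u : Ω → EuclideanSpace ℝ (Fin d)} (hu : StronglyMeasurable[ℱ t] u) (hu2 : MemLp u 2 μ) :
    ∫ ω, inner ℝ (u ω) (noise f x g t i ω) ∂μ = 0 :=
  integral_inner_eq_zero_of_condExp (ℱ.le t) hu hu2 (O.memLp_noise t i) (R.condExp_noise Sm O t i)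

/-- Noise vectors at different iterations or at different nodes are orthogonal in `L²`. -/
theorem Recursion.inner_noise_eq_zero (R : Recursion A B α x0 x y g) (Sm : Smooth f x0 L Δ)
    (O : GradientOracle μ ℱ f x g σ) {s t : ℕ} {i j : Fin n} (h : (s, i) ≠ (t, j)) :
    inner ℝ (toL2 μ (noise f x g s i)) (toL2 μ (noise f x g t j)) = 0 := by
  have htime : ∀ {s t : ℕ} (i j : Fin n), s < t →
      inner ℝ (toL2 μ (noise f x g s i)) (toL2 μ (noise f x g t j)) = 0 := fun {s t} i j hst => by
    rw [inner_toL2 (O.memLp_noise s i) (O.memLp_noise t j)]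
    exact R.integral_inner_noise_eq_zero Sm O t j
      ((R.stronglyMeasurable_noise Sm O s i).mono (ℱ.mono hst)) (O.memLp_noise s i)
  have hnode : ∀ (t : ℕ) {i j : Fin n}, i < j →
      inner ℝ (toL2 μ (noise f x g t i)) (toL2 μ (noise f x g t j)) = 0 := fun t {i j} hij => by
    rw [inner_toL2 (O.memLp_noise t i) (O.memLp_noise t j)]
    have hgi := R.memLp_stochGradient Sm O t i
    have hgj := R.memLp_stochGradient Sm O t j
    have hhi := Sm.memLp_gradient i ((R.memLp Sm O t).1 i)
    have e : ∀ ω, inner ℝ (noise f x g t i ω) (noise f x g t j ω)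
        = inner ℝ (g t i ω) (noise f x g t j ω)
          - inner ℝ (gradient (f i) (x t i ω)) (noise f x g t j ω) := fun ω => by
      rw [noise, inner_sub_left]
    simp_rw [e]
    rw [integral_sub (integrable_inner_of_memLp hgi (O.memLp_noise t j))
      (integrable_inner_of_memLp hhi (O.memLp_noise t j)),
      R.integral_inner_noise_eq_zero Sm O t j (R.stronglyMeasurable_gradient Sm O t i) hhi,
      sub_zero]
    have h0 := integral_inner_centered_eq_zero (ℱ.le t)
      ((O.measurable t i).mono (ℱ.le _)) ((O.measurable t j).mono (ℱ.le _)) hgi hgj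
      (O.indep t i j hij)
    rw [← h0]
    refine integral_congr_ae ?_
    filter_upwards [O.unbiased t j] with ω hω
    rw [noise, hω]
  rcases lt_trichotomy s t with hst | rfl | hst
  · exact htime i j hst
  · have hij : i ≠ j := fun e => h (by rw [e])
    rcases lt_or_gt_of_ne hij with hij | hij
    · exact hnode s hij
    · rw [real_inner_comm]; exact hnode s hij
  · rw [real_inner_comm]; exact htime j i hst

theorem GradientOracle.norm_noise_sq_le (O : GradientOracle μ ℱ f x g σ) (t : ℕ) (i : Fin n) :
    ‖toL2 μ (noise f x g t i)‖ ^ 2 ≤ σ ^ 2 := by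
  rw [norm_toL2_sq (O.memLp_noise t i), ← integral_condExp (ℱ.le t)]
  calc _ ≤ ∫ _, σ ^ 2 ∂μ :=
        integral_mono_ae integrable_condExp (integrable_const _) (O.variance t i)
    _ = σ ^ 2 := by simp

/-- The weighted average `∑ᵢ πᵢ x_i⁽ᵗ⁾` of the local variables. -/
noncomputable def weighted (πA : Fin n → ℝ)
    (x : ℕ → Fin n → Ω → EuclideanSpace ℝ (Fin d)) (t : ℕ) (ω : Ω) : EuclideanSpace ℝ (Fin d) :=
  ∑ i, πA i • x t i ω

theorem Recursion.memLp_weighted (R : Recursion A B α x0 x y g) (Sm : Smooth f x0 L Δ)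
    (O : GradientOracle μ ℱ f x g σ) (πA : Fin n → ℝ) (t : ℕ) :
    MemLp (weighted πA x t) 2 μ :=
  memLp_sum_smul _ πA (R.memLp Sm O t).1

theorem Recursion.toL2_weighted (R : Recursion A B α x0 x y g) (Sm : Smooth f x0 L Δ)
    (O : GradientOracle μ ℱ f x g σ) (πA : Fin n → ℝ) (t : ℕ) :
    toL2 μ (weighted πA x t) = pair πA (WithLp.toLp 2 fun i => toL2 μ (x t i)) :=
  toL2_sum_smul _ πA (R.memLp Sm O t).1

theorem Smooth.memLp_gradient_avgFun (Sm : Smooth f x0 L Δ)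
    {u : Ω → EuclideanSpace ℝ (Fin d)} (hu : MemLp u 2 μ) :
    MemLp (fun ω => gradient (avgFun f) (u ω)) 2 μ := by
  simp_rw [Sm.gradient_avgFun, Finset.smul_sum]
  exact memLp_sum_smul _ (fun _ => (n : ℝ)⁻¹) fun i => Sm.memLp_gradient i hu

theorem Smooth.toL2_gradient_avgFun (Sm : Smooth f x0 L Δ)
    {u : Ω → EuclideanSpace ℝ (Fin d)} (hu : MemLp u 2 μ) :
    toL2 μ (fun ω => gradient (avgFun f) (u ω))
      = mean (WithLp.toLp 2 fun i => toL2 μ fun ω => gradient (f i) (u ω)) := by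
  simp_rw [Sm.gradient_avgFun, Finset.smul_sum]
  exact toL2_sum_smul _ (fun _ => (n : ℝ)⁻¹) fun i => Sm.memLp_gradient i hu

theorem Smooth.continuous_gradient_avgFun (Sm : Smooth f x0 L Δ) :
    Continuous (gradient (avgFun f)) := by
  rw [funext Sm.gradient_avgFun]
  exact Continuous.const_smul (continuous_finsetSum _ fun i _ => Sm.continuous_gradient i)
    (n : ℝ)⁻¹

/-- The Lipschitz bound of the local gradients, in `L²` and summed over the nodes. -/
theorem Smooth.norm_gradients_sub_le (Sm : Smooth f x0 L Δ) (hL : 0 ≤ L)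
    {u v : Fin n → Ω → EuclideanSpace ℝ (Fin d)} (hu : ∀ i, MemLp (u i) 2 μ)
    (hv : ∀ i, MemLp (v i) 2 μ) :
    ‖(WithLp.toLp 2 fun i => toL2 μ fun ω => gradient (f i) (u i ω) :
        NodeVec n (Lp (EuclideanSpace ℝ (Fin d)) 2 μ))
        - WithLp.toLp 2 fun i => toL2 μ fun ω => gradient (f i) (v i ω)‖
      ≤ L * ‖(WithLp.toLp 2 fun i => toL2 μ (u i) :
        NodeVec n (Lp (EuclideanSpace ℝ (Fin d)) 2 μ)) - WithLp.toLp 2 fun i => toL2 μ (v i)‖ := by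
  refine le_of_sq_le_sq ?_ (by positivity)
  rw [mul_pow, PiLp.norm_sq_eq_of_L2, PiLp.norm_sq_eq_of_L2, Finset.mul_sum]
  refine Finset.sum_le_sum fun i _ => ?_
  rw [← mul_pow]
  refine pow_le_pow_left₀ (norm_nonneg _) ?_ 2
  simp only [PiLp.sub_apply]
  rw [← toL2_sub (Sm.memLp_gradient i (hu i)) (Sm.memLp_gradient i (hv i)),
    ← toL2_sub (hu i) (hv i)]
  exact norm_toL2_le ((Sm.memLp_gradient i (hu i)).sub (Sm.memLp_gradient i (hv i)))
    ((hu i).sub (hv i)) fun ω => Sm.lipschitz i _ _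

theorem norm_mean_le {H : Type*} [NormedAddCommGroup H] [InnerProductSpace ℝ H] (hn : 0 < n)
    (w : NodeVec n H) : ‖mean w‖ ≤ (Real.sqrt n)⁻¹ * ‖w‖ := by
  have hn' : (0 : ℝ) < n := Nat.cast_pos.mpr hn
  refine le_of_sq_le_sq ((norm_pair_sq_le _ w).trans (le_of_eq ?_)) (by positivity)
  rw [mul_pow, inv_pow (Real.sqrt n), Real.sq_sqrt hn'.le, Finset.sum_const, Finset.card_univ,
    Fintype.card_fin, nsmul_eq_mul]
  field_simp

theorem Smooth.integrable_avgFun (Sm : Smooth f x0 L Δ) (hn : 0 < n)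
    {u : Ω → EuclideanSpace ℝ (Fin d)} (hu : MemLp u 2 μ) :
    Integrable (fun ω => avgFun f (u ω)) μ := by
  have hcont : Continuous (avgFun f) :=
    continuous_const.mul (continuous_finsetSum _ fun i _ => (Sm.differentiable i).continuous)
  have h0 : MemLp (fun ω => u ω - x0) 2 μ := hu.sub (memLp_const x0)
  have hup : Integrable (fun ω => avgFun f x0 + inner ℝ (gradient (avgFun f) x0) (u ω - x0)
      + L / 2 * ‖u ω - x0‖ ^ 2) μ :=
    ((integrable_const _).add ((h0.integrable (by norm_num)).const_inner _)).add
      ((memLp_two_iff_integrable_sq_norm h0.aestronglyMeasurable).mp h0 |>.const_mul _)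
  refine integrable_of_le_of_le (hcont.comp_aestronglyMeasurable hu.aestronglyMeasurable)
    (g₁ := fun _ => avgFun f x0 - Δ) (Filter.Eventually.of_forall fun ω => Sm.avgFun_ge hn (u ω))
    (Filter.Eventually.of_forall fun ω => Sm.avgFun_le hn x0 (u ω)) (integrable_const _) hup

/-- Under the assumptions on the objectives and on the stochastic gradients, the iterates of
Push-Pull, seen as vectors in `L²`, form a `System`; the orthogonality relations come from
unbiasedness and conditional independence, the descent inequality from smoothness. -/
theorem Recursion.system (hn : 0 < n) (hπ : ∑ i, πA i = 1) (hL : 0 < L)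
    (R : Recursion A B α x0 x y g) (Sm : Smooth f x0 L Δ) (O : GradientOracle μ ℱ f x g σ) :
    System (H := Lp (EuclideanSpace ℝ (Fin d)) 2 μ) A B πA α L Δ σ (toL2 μ fun _ => x0)
      (fun t => WithLp.toLp 2 fun i => toL2 μ (x t i))
      (fun t => WithLp.toLp 2 fun i => toL2 μ (y t i))
      (fun t => WithLp.toLp 2 fun i => toL2 μ fun ω => gradient (f i) (x t i ω))
      (fun t => WithLp.toLp 2 fun i => toL2 μ (noise f x g t i))
      (fun t => toL2 μ fun ω => gradient (avgFun f) (weighted πA x t ω))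
      (fun t => ∫ ω, avgFun f (weighted πA x t ω) ∂μ) := by
  have hn' : (0 : ℝ) < n := Nat.cast_pos.mpr hn
  have hx := fun t => (R.memLp Sm O t).1
  have hy := fun t => (R.memLp Sm O t).2
  have hw := R.memLp_weighted Sm O πA
  have hG := fun t i => Sm.memLp_gradient i (hx t i)
  have hg := R.memLp_stochGradient Sm O
  have hε := O.memLp_noise
  have hsplit : ∀ t i, (toL2 μ fun ω => gradient (f i) (x t i ω)) + toL2 μ (noise f x g t i)
      = toL2 μ (g t i) := fun t i => by
    have := toL2_add (hG t i) (hε t i)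
    simp only [noise, add_sub_cancel] at this
    exact this.symm
  have hzero : ∀ ω, weighted πA x 0 ω = x0 := fun ω => by
    simp [weighted, R.x_zero, ← Finset.sum_smul, hπ]
  have hsub : ∀ s t, pair πA ((WithLp.toLp 2 fun i => toL2 μ (x t i) :
        NodeVec n (Lp (EuclideanSpace ℝ (Fin d)) 2 μ)) - WithLp.toLp 2 fun i => toL2 μ (x s i))
      = toL2 μ fun ω => weighted πA x t ω - weighted πA x s ω := fun s t => by
    rw [map_sub, ← R.toL2_weighted Sm O, ← R.toL2_weighted Sm O, toL2_sub (hw t) (hw s)]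
  exact {
    x_zero := by
      ext1 i
      simp only [R.x_zero, const_apply]
    y_zero := by
      ext1 i
      simp only [R.y_zero, PiLp.add_apply, hsplit]
    x_succ := fun t => by
      ext1 i
      simp only [R.x_succ, PiLp.sub_apply, PiLp.smul_apply, matrix_smul_apply]
      rw [toL2_sub (memLp_sum_smul _ (A i) (hx t)) (memLp_smul α (hy t i)),
        toL2_sum_smul _ _ (hx t), toL2_smul _ (hy t i)]
    y_succ := fun t => by
      ext1 i
      simp only [R.y_succ, PiLp.sub_apply, PiLp.add_apply, matrix_smul_apply, hsplit]
      rw [toL2_sub (memLp_add (memLp_sum_smul _ (B i) (hy t)) (hg (t + 1) i)) (hg t i),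
        toL2_add (memLp_sum_smul _ (B i) (hy t)) (hg (t + 1) i), toL2_sum_smul _ _ (hy t)]
    lipschitz := fun s t => Sm.norm_gradients_sub_le hL.le (hx s) (hx t)
    grad_mean := fun s t => by
      rw [Sm.toL2_gradient_avgFun (hw t), ← map_sub, ← R.toL2_weighted Sm O, mul_comm L,
        mul_assoc]
      exact (norm_mean_le hn _).trans (mul_le_mul_of_nonneg_left
        (Sm.norm_gradients_sub_le hL.le (hx s) fun _ => hw t) (by positivity))
    init := by
      rw [PiLp.norm_sq_eq_of_L2]
      calc _ ≤ ∑ _i : Fin n, 2 * L * Δ := Finset.sum_le_sum fun i _ => by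
            rw [norm_toL2_sq (hG 0 i)]
            simp only [R.x_zero, integral_const, probReal_univ, one_smul]
            exact Sm.norm_gradient_init_sq_le hL i
        _ = 2 * n * L * Δ := by
            rw [Finset.sum_const, Finset.card_univ, Fintype.card_fin, nsmul_eq_mul]; ring
    noise_orth := fun s t i j h => R.inner_noise_eq_zero Sm O h
    noise_sq := O.norm_noise_sq_le
    grad_orth := fun s t i hst => by
      refine (inner_toL2 (Sm.memLp_gradient_avgFun (hw s)) (hε t i)).trans ?_
      refine R.integral_inner_noise_eq_zero Sm O t i
        (Sm.continuous_gradient_avgFun.comp_stronglyMeasurable ?_)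
        (Sm.memLp_gradient_avgFun (hw s))
      exact Finset.stronglyMeasurable_fun_sum _ fun j _ =>
        (((R.stronglyMeasurable O s).1 j).mono (ℱ.mono hst)).const_smul (πA j)
    descent := fun s t => by
      have hd : MemLp (fun ω => weighted πA x t ω - weighted πA x s ω) 2 μ := (hw t).sub (hw s)
      have hGs := Sm.memLp_gradient_avgFun (hw s)
      have i1 := Sm.integrable_avgFun hn (hw s)
      have i2 := integrable_inner_of_memLp hGs hd
      have i3 := ((memLp_two_iff_integrable_sq_norm hd.aestronglyMeasurable).mp hd).const_mul
        (L / 2)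
      rw [hsub s t, inner_toL2 hGs hd, norm_toL2_sq hd, ← integral_const_mul,
        ← integral_add i1 i2]
      refine le_of_le_of_eq (integral_mono (Sm.integrable_avgFun hn (hw t)) ((i1.add i2).add i3)
        fun ω => Sm.avgFun_le hn _ _) (integral_add (i1.add i2) i3)
    gap := fun t => by
      have h := integral_mono (μ := μ) (integrable_const (avgFun f x0 - Δ))
        (Sm.integrable_avgFun hn (hw t)) fun ω => Sm.avgFun_ge hn _
      simp only [hzero, integral_const, probReal_univ, one_smul] at h ⊢
      linarith }

end Iterates

/-! ### Choice of the step size and of the block length -/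

section Tuning

variable {n m : ℕ} {c sB sBm σ L Δ T α : ℝ}

theorem inv_min_le {a b : ℝ} (ha : 0 < a) (hb : 0 < b) : (min a b)⁻¹ ≤ a⁻¹ + b⁻¹ := by
  rcases min_cases a b with ⟨h, _⟩ | ⟨h, _⟩ <;> rw [h]
  · linarith [inv_pos.mpr hb]
  · linarith [inv_pos.mpr ha]

theorem tunedStep_le : tunedStep n c sB sBm σ L Δ T m
    ≤ 1 / (10 * c * m * Real.sqrt (sB * sBm ^ 2) * L) := by
  rw [tunedStep]
  split_ifs
  · exact min_le_left _ _
  · exact (min_le_right _ _).trans (min_le_left _ _)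

theorem tunedStep_le_of_ne_zero (hσ : σ ≠ 0) : tunedStep n c sB sBm σ L Δ T m
    ≤ Real.sqrt (n * Δ) / (10 * c * σ * Real.sqrt (L * T)) := by
  rw [tunedStep, if_neg hσ]
  exact min_le_left _ _

theorem inv_tunedStep_le (hn : 0 < n) (hc : 0 < c) (hsB : 0 < sB) (hsBm : 0 < sBm) (hσ : 0 ≤ σ)
    (hL : 0 < L) (hΔ : 0 < Δ) (hT : 0 < T) (hm : 0 < m) :
    (tunedStep n c sB sBm σ L Δ T m)⁻¹ ≤ 10 * c * σ * Real.sqrt (L * T) / Real.sqrt (n * Δ)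
      + (10 * c * m * Real.sqrt (sB * sBm ^ 2) * L + 6 * L) := by
  have hn' : (0 : ℝ) < n := Nat.cast_pos.mpr hn
  have hm' : (0 : ℝ) < m := Nat.cast_pos.mpr hm
  have h1 : 0 < 1 / (10 * c * m * Real.sqrt (sB * sBm ^ 2) * L) := by positivity
  have h2 : 0 < 1 / (6 * L) := by positivity
  have h3 : (min (1 / (10 * c * m * Real.sqrt (sB * sBm ^ 2) * L)) (1 / (6 * L)))⁻¹
      ≤ 10 * c * m * Real.sqrt (sB * sBm ^ 2) * L + 6 * L := by
    simpa using inv_min_le h1 h2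
  rw [tunedStep]
  split_ifs with h
  · simpa [h] using h3
  · have hσ' : 0 < σ := lt_of_le_of_ne hσ (Ne.symm h)
    have h4 : 0 < Real.sqrt (n * Δ) / (10 * c * σ * Real.sqrt (L * T)) := by positivity
    refine (inv_min_le h4 (lt_min h1 h2)).trans ?_
    rw [inv_div]
    exact add_le_add_right h3 _

theorem sqrt_mul_div_sqrt (hn : 0 < n) (hL : 0 < L) (hΔ : 0 < Δ) (hT : 0 < T) :
    Real.sqrt (L * T) / Real.sqrt (n * Δ) * (Δ / T) = Real.sqrt (L * Δ) / Real.sqrt (n * T) := by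
  have hn' : (0 : ℝ) < n := Nat.cast_pos.mpr hn
  rw [Real.sqrt_mul hL.le, Real.sqrt_mul hn'.le, Real.sqrt_mul hL.le, Real.sqrt_mul hn'.le]
  have h1 := Real.sq_sqrt hΔ.le
  have h2 := Real.sq_sqrt hT.le
  have : 0 < Real.sqrt Δ := Real.sqrt_pos.mpr hΔ
  have : 0 < Real.sqrt T := Real.sqrt_pos.mpr hT
  have : 0 < Real.sqrt (n : ℝ) := Real.sqrt_pos.mpr hn'
  rw [show Δ / T = Real.sqrt Δ ^ 2 / Real.sqrt T ^ 2 by rw [h1, h2]]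
  field_simp

/-- With a step size below the first entry of the tuned one, the variance term is of the leading
order. -/
theorem variance_term_le (hn : 0 < n) (hc : 0 < c) (hσ : 0 ≤ σ) (hL : 0 < L) (hΔ : 0 < Δ)
    (hT : 0 < T) (hα : α ≤ tunedStep n c sB sBm σ L Δ T m) :
    100 * c * α * L / n * σ ^ 2 ≤ 10 * (σ * Real.sqrt (L * Δ) / Real.sqrt (n * T)) := by
  have hn' : (0 : ℝ) < n := Nat.cast_pos.mpr hn
  rcases hσ.eq_or_lt with rfl | hσ
  · simp
  have h := hα.trans (tunedStep_le_of_ne_zero hσ.ne')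
  calc 100 * c * α * L / n * σ ^ 2
      ≤ 100 * c * (Real.sqrt (n * Δ) / (10 * c * σ * Real.sqrt (L * T))) * L / n * σ ^ 2 := by
        gcongr
    _ = 10 * (σ * Real.sqrt (L * Δ) / Real.sqrt (n * T)) := by
        rw [mul_div_assoc σ, ← sqrt_mul_div_sqrt hn hL hΔ hT]
        have h1 := Real.sq_sqrt (mul_pos hn' hΔ).le
        have h2 := Real.sq_sqrt (mul_pos hL hT).le
        have h3 : 0 < Real.sqrt (n * Δ) := Real.sqrt_pos.mpr (mul_pos hn' hΔ)
        have h4 : 0 < Real.sqrt (L * T) := Real.sqrt_pos.mpr (mul_pos hL hT)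
        generalize Real.sqrt (n * Δ) = P at *
        generalize Real.sqrt (L * T) = Q at *
        have hL' : L = Q ^ 2 / T := by rw [h2]; field_simp
        have hΔ' : Δ = P ^ 2 / n := by rw [h1]; field_simp
        rw [hL', hΔ']
        field_simp
        norm_num

/-- With the tuned block length the noise collected inside a block is of the leading order. -/
theorem block_noise_term_le (hn : 0 < n) (hc : 0 < c) (hsB : 1 ≤ sB) (hsBm : 1 ≤ sBm)
    (hσ : 0 ≤ σ) (hL : 0 < L) (hΔ : 0 < Δ) (hT : 0 < T) (hm : 0 < m)
    (hM : 4 * c⁻¹ * sB ^ (3 / 2 : ℝ) * sBm * ((n : ℝ) * T * σ ^ 2 / (L * Δ)) ^ (1 / 4 : ℝ) ≤ m) :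
    144 * sB * σ ^ 2 / ((m : ℝ) ^ 2 * c ^ 2)
      ≤ 9 * (σ * Real.sqrt (L * Δ) / Real.sqrt (n * T)) := by
  have hn' : (0 : ℝ) < n := Nat.cast_pos.mpr hn
  have hm' : (0 : ℝ) < m := Nat.cast_pos.mpr hm
  rcases hσ.eq_or_lt with rfl | hσ
  · simp
  have hsB0 : 0 < sB := by linarith
  set q := (n : ℝ) * T * σ ^ 2 / (L * Δ) with hq
  have hq0 : 0 < q := by positivity
  have hq4 : (q ^ (1 / 4 : ℝ)) ^ 2 = σ * Real.sqrt (n * T) / Real.sqrt (L * Δ) := by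
    rw [← Real.rpow_natCast, ← Real.rpow_mul hq0.le,
      show (1 / 4 : ℝ) * (2 : ℕ) = 1 / 2 by norm_num, ← Real.sqrt_eq_rpow, hq,
      Real.sqrt_div (by positivity), Real.sqrt_mul (by positivity), Real.sqrt_sq hσ.le, mul_comm σ]
  have hs : (sB ^ (3 / 2 : ℝ)) ^ 2 = sB ^ 3 := by
    rw [← Real.rpow_natCast, ← Real.rpow_mul hsB0.le,
      show (3 / 2 : ℝ) * (2 : ℕ) = (3 : ℕ) by norm_num, Real.rpow_natCast]
  have h1 : sB ≤ (sB ^ (3 / 2 : ℝ)) ^ 2 * sBm ^ 2 := by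
    rw [hs]
    calc sB = sB ^ 1 * 1 := by ring
      _ ≤ sB ^ 3 * sBm ^ 2 := mul_le_mul (pow_le_pow_right₀ hsB (by norm_num))
          (one_le_pow₀ hsBm) zero_le_one (by positivity)
  have h2 := pow_le_pow_left₀ (by positivity) hM 2
  have h3 : 16 * sB * (σ * Real.sqrt (n * T) / Real.sqrt (L * Δ)) ≤ (m : ℝ) ^ 2 * c ^ 2 := by
    rw [← hq4]
    calc 16 * sB * (q ^ (1 / 4 : ℝ)) ^ 2
        ≤ 16 * ((sB ^ (3 / 2 : ℝ)) ^ 2 * sBm ^ 2) * (q ^ (1 / 4 : ℝ)) ^ 2 := by gcongr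
      _ = (4 * c⁻¹ * sB ^ (3 / 2 : ℝ) * sBm * q ^ (1 / 4 : ℝ)) ^ 2 * c ^ 2 := by
          field_simp; norm_num
      _ ≤ (m : ℝ) ^ 2 * c ^ 2 := by gcongr
  have hP : 0 < Real.sqrt (n * T) := Real.sqrt_pos.mpr (by positivity)
  have hQ : 0 < Real.sqrt (L * Δ) := Real.sqrt_pos.mpr (by positivity)
  calc 144 * sB * σ ^ 2 / ((m : ℝ) ^ 2 * c ^ 2)
      ≤ 144 * sB * σ ^ 2 / (16 * sB * (σ * Real.sqrt (n * T) / Real.sqrt (L * Δ))) := by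
        gcongr
    _ = 9 * (σ * Real.sqrt (L * Δ) / Real.sqrt (n * T)) := by
        field_simp; norm_num

/-- The step-size dependent terms for the tuned parameters; the leading constant is
`25 + 10 + 9 = 44`. -/
theorem tuned_terms_le (hn : 0 < n) (hc : 0 < c) (hsB : 1 ≤ sB) (hsBm : 1 ≤ sBm) (hσ : 0 ≤ σ)
    (hL : 0 < L) (hΔ : 0 < Δ) (hT : 0 < T) (hm : 0 < m) (hα : 0 < α)
    (hstep : α = tunedStep n c sB sBm σ L Δ T m)
    (hM : 4 * c⁻¹ * sB ^ (3 / 2 : ℝ) * sBm * ((n : ℝ) * T * σ ^ 2 / (L * Δ)) ^ (1 / 4 : ℝ) ≤ m) :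
    5 / 2 * Δ / (c * α * T) + 100 * c * α * L / n * σ ^ 2
        + 144 * sB * σ ^ 2 / ((m : ℝ) ^ 2 * c ^ 2)
      ≤ 44 * σ * Real.sqrt (L * Δ) / Real.sqrt (n * T)
        + L * Δ * (25 * m * Real.sqrt (sB * sBm ^ 2) + 15 / c) / T := by
  have h1 := variance_term_le hn hc hσ hL hΔ hT hstep.le
  have h2 := block_noise_term_le hn hc hsB hsBm hσ hL hΔ hT hm hM
  have h3 := inv_tunedStep_le (σ := σ) (sB := sB) (sBm := sBm) hn hc (by linarith) (by linarith)
    hσ hL hΔ hT hm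
  rw [← hstep] at h3
  have h4 : 5 / 2 * Δ / (c * α * T) ≤ 25 * (σ * Real.sqrt (L * Δ) / Real.sqrt (n * T))
      + L * Δ * (25 * m * Real.sqrt (sB * sBm ^ 2) + 15 / c) / T := by
    calc 5 / 2 * Δ / (c * α * T) = 5 / 2 * Δ / (c * T) * α⁻¹ := by field_simp
      _ ≤ 5 / 2 * Δ / (c * T) * (10 * c * σ * Real.sqrt (L * T) / Real.sqrt (n * Δ)
          + (10 * c * m * Real.sqrt (sB * sBm ^ 2) * L + 6 * L)) := by gcongr
      _ = 25 * (σ * (Real.sqrt (L * T) / Real.sqrt (n * Δ) * (Δ / T)))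
          + L * Δ * (25 * m * Real.sqrt (sB * sBm ^ 2) + 15 / c) / T := by
          field_simp; ring
      _ = _ := by rw [sqrt_mul_div_sqrt hn hL hΔ hT, mul_div_assoc σ]
  have e : 44 * σ * Real.sqrt (L * Δ) / Real.sqrt (n * T)
      = 44 * (σ * Real.sqrt (L * Δ) / Real.sqrt (n * T)) := by ring
  rw [e]
  linarith

theorem fixed_step_terms_le (hc : 0 < c) (hΔ : 0 < Δ) (hα : 0 < α) (hT : 0 < T) (hm : 0 < m)
    (hsB : 1 ≤ sB) (hsBm : 1 ≤ sBm) :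
    5 / 2 * Δ / (c * α * T) + 144 * sB * σ ^ 2 / ((m : ℝ) ^ 2 * c ^ 2)
      ≤ 4 * Δ / (c * α * T) + 384 * sB ^ 3 * sBm ^ 2 / ((m : ℝ) ^ 2 * c ^ 2) * σ ^ 2 := by
  have hm' : (0 : ℝ) < m := Nat.cast_pos.mpr hm
  have hsB0 : 0 < sB := by linarith
  have h1 : sB * 1 ≤ sB ^ 3 * sBm ^ 2 :=
    mul_le_mul (le_self_pow₀ hsB (by norm_num)) (one_le_pow₀ hsBm) zero_le_one (by positivity)
  have h2 : 144 * sB ≤ 384 * sB ^ 3 * sBm ^ 2 := by linarith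
  rw [div_mul_eq_mul_div _ _ (σ ^ 2)]
  refine add_le_add ?_ ?_
  · gcongr
    norm_num
  · gcongr

/-- The fourth root in the tuned block length turns one factor `L Δ / T` into `(L Δ / T)^{3/4}`. -/
theorem fourth_root_mul (hσ : 0 ≤ σ) (hL : 0 < L) (hΔ : 0 < Δ) (hT : 0 < T) :
    ((n : ℝ) * T * σ ^ 2 / (L * Δ)) ^ (1 / 4 : ℝ) * (L * Δ / T)
      = (n : ℝ) ^ (1 / 4 : ℝ) * Real.sqrt σ * (L * Δ / T) ^ (3 / 4 : ℝ) := by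
  have hX : 0 < L * Δ / T := by positivity
  have e : (n : ℝ) * T * σ ^ 2 / (L * Δ) = n * σ ^ 2 * (L * Δ / T)⁻¹ := by field_simp
  rw [e, Real.mul_rpow (by positivity) (by positivity), Real.mul_rpow (by positivity)
    (by positivity), Real.inv_rpow hX.le, ← Real.rpow_neg hX.le, ← Real.rpow_natCast σ,
    ← Real.rpow_mul hσ, show ((2 : ℕ) : ℝ) * (1 / 4 : ℝ) = 1 / 2 by norm_num,
    ← Real.sqrt_eq_rpow, mul_assoc, ← Real.rpow_add_one hX.ne',
    show -(1 / 4 : ℝ) + 1 = 3 / 4 by norm_num]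

theorem blockThreshold_nonneg {sA sAm : ℝ} :
    0 ≤ blockThreshold n c sA sAm sB sBm :=
  le_max_of_le_left (by positivity)

theorem deltaConst_mono {sA sAm sAm' sBm' : ℝ} (hsA : 0 ≤ sA) (hsAm : 0 ≤ sAm)
    (hA : sAm ≤ sAm') (hB : sBm ≤ sBm') :
    deltaConst n c sA sAm sB sBm ≤ deltaConst n c sA sAm' sB sBm' := by
  unfold deltaConst
  gcongr

/-- The passage from the explicit rate to constants depending on the weight matrices only. -/
theorem tuned_rate_le {sA sAm : ℝ} (hc : 0 < c) (hsA : 1 ≤ sA) (hsAm : 1 ≤ sAm)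
    (hsB : 1 ≤ sB) (hsBm : 1 ≤ sBm) (hA : sAm ≤ sA) (hB : sBm ≤ sB) (hσ : 0 ≤ σ) (hL : 0 < L)
    (hΔ : 0 < Δ) (hT : 0 < T) (hm : 0 < m)
    (hM : m ≤ ⌈tunedBlock n c sA sA sB sB σ L Δ T⌉₊) :
    L * Δ * (deltaConst n c sA sAm sB sBm / m + 40 * m * Real.sqrt (sB * sBm ^ 2) + 24 / c) / T
      ≤ 160 * Real.sqrt (sB * sB ^ 2) * c⁻¹ * sB ^ (3 / 2 : ℝ) * sB * (n : ℝ) ^ (1 / 4 : ℝ)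
          * Real.sqrt σ * (L * Δ / T) ^ (3 / 4 : ℝ)
        + (deltaConst n c sA sA sB sB
            + 40 * Real.sqrt (sB * sB ^ 2) * (blockThreshold n c sA sA sB sB + 1) + 24 / c)
          * (L * Δ / T) := by
  have hm1 : (1 : ℝ) ≤ m := Nat.one_le_cast.mpr hm
  set b := blockThreshold n c sA sA sB sB with hb
  have hb0 : 0 ≤ b := blockThreshold_nonneg
  set w := Real.sqrt (sB * sB ^ 2) with hw
  set X := L * Δ / T with hX
  have hX0 : 0 < X := by positivity
  set q := ((n : ℝ) * T * σ ^ 2 / (L * Δ)) ^ (1 / 4 : ℝ) with hq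
  have hq0 : 0 ≤ q := by positivity
  have hsB0 : 0 < sB := by linarith
  have hM' : (m : ℝ) ≤ 4 * c⁻¹ * sB ^ (3 / 2 : ℝ) * sB * q + b + 1 := by
    have h0 : 0 ≤ tunedBlock n c sA sA sB sB σ L Δ T := le_max_of_le_right hb0
    have h1 : (m : ℝ) ≤ ⌈tunedBlock n c sA sA sB sB σ L Δ T⌉₊ := Nat.cast_le.mpr hM
    have h2 := Nat.ceil_lt_add_one h0
    have h3 : tunedBlock n c sA sA sB sB σ L Δ T ≤ 4 * c⁻¹ * sB ^ (3 / 2 : ℝ) * sB * q + b :=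
      max_le_add_of_nonneg (by positivity) hb0
    linarith
  have hδ0 : 0 ≤ deltaConst n c sA sAm sB sBm := by unfold deltaConst; positivity
  have h1 : deltaConst n c sA sAm sB sBm / m ≤ deltaConst n c sA sA sB sB :=
    (div_le_self hδ0 hm1).trans (deltaConst_mono (by linarith) (by linarith) hA hB)
  have h2 : Real.sqrt (sB * sBm ^ 2) ≤ w := Real.sqrt_le_sqrt (by gcongr)
  have hfr := fourth_root_mul (n := n) hσ hL hΔ hT
  rw [← hq, ← hX] at hfr
  calc L * Δ * (deltaConst n c sA sAm sB sBm / m + 40 * m * Real.sqrt (sB * sBm ^ 2)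
        + 24 / c) / T
      = (deltaConst n c sA sAm sB sBm / m + 40 * m * Real.sqrt (sB * sBm ^ 2) + 24 / c) * X := by
        rw [hX]; ring
    _ ≤ (deltaConst n c sA sA sB sB + 40 * (4 * c⁻¹ * sB ^ (3 / 2 : ℝ) * sB * q + b + 1) * w
          + 24 / c) * X := by gcongr
    _ = 160 * w * c⁻¹ * sB ^ (3 / 2 : ℝ) * sB * (q * X)
        + (deltaConst n c sA sA sB sB + 40 * w * (b + 1) + 24 / c) * X := by ring
    _ = _ := by rw [hfr]; ring

end Tuning

/-! ### The convergence bounds -/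

section Rates

variable {n : ℕ} {H : Type*} [NormedAddCommGroup H] [InnerProductSpace ℝ H]
  {A B : Matrix (Fin n) (Fin n) ℝ} {πA πB : Fin n → ℝ} {α L Δ σ : ℝ} {x0 : H}
  {x y h ε : ℕ → NodeVec n H} {Gr : ℕ → H} {F : ℕ → ℝ}

/-- The bound on the average squared gradient over the block starts. -/
theorem System.average_gradient_sq_le (hn : 2 ≤ n) (hE : ExpDecay A B πA πB)
    (S : System A B πA α L Δ σ x0 x y h ε Gr F) (hσ : 0 ≤ σ) (hα : 0 < α) (hL : 0 < L)
    (hΔ : 0 < Δ) {m K : ℕ} (hm : 0 < m) (hK : 0 < K)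
    (hstep : α ≤ 1 / (10 * cConst πA πB * m
      * Real.sqrt (mixSum B (colLimit πB) * mixSum (B ^ m) (colLimit πB) ^ 2) * L))
    (hC : blockThreshold n (cConst πA πB) (mixSum A (rowLimit πA))
      (mixSum (A ^ m) (rowLimit πA)) (mixSum B (colLimit πB)) (mixSum (B ^ m) (colLimit πB)) ≤ m) :
    (1 / (K : ℝ)) * ∑ k ∈ Finset.range K, ‖Gr (m * k)‖ ^ 2
      ≤ 5 / 2 * Δ / (cConst πA πB * α * (m * K)) + 100 * cConst πA πB * α * L / n * σ ^ 2
        + 144 * mixSum B (colLimit πB) * σ ^ 2 / ((m : ℝ) ^ 2 * cConst πA πB ^ 2)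
        + deltaConst n (cConst πA πB) (mixSum A (rowLimit πA)) (mixSum (A ^ m) (rowLimit πA))
            (mixSum B (colLimit πB)) (mixSum (B ^ m) (colLimit πB)) * (L * Δ) / (m * (m * K)) := by
  have hc := hE.cConst_pos hn
  have hn' : (0 : ℝ) < n := Nat.cast_pos.mpr (by omega)
  have hm' : (0 : ℝ) < m := Nat.cast_pos.mpr hm
  have hK' : (0 : ℝ) < K := Nat.cast_pos.mpr hK
  refine (mul_le_mul_of_nonneg_left
    (S.sum_gradient_sq_le hn hE hσ hα hL hΔ hm hstep hC K) (by positivity)).trans (le_of_eq ?_)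
  rw [deltaConst]
  field_simp

end Rates

end PushPull

theorem theorem1 {n : ℕ} (hn : 2 ≤ n) :
    -- weight matrices of strongly connected digraphs have the exponential decay property
    (∀ A B : Matrix (Fin n) (Fin n) ℝ,
      A ∈ Matrix.rowStochastic ℝ (Fin n) → B ∈ Matrix.colStochastic ℝ (Fin n) →
      A.IsIrreducible → B.IsIrreducible → 0 < A.trace → 0 < B.trace →
      ∃ πA πB : Fin n → ℝ, PushPull.ExpDecay A B πA πB) ∧
    -- the convergence bounds, for all weight matrices with the exponential decay property
    (∀ (A B : Matrix (Fin n) (Fin n) ℝ) (πA πB : Fin n → ℝ), PushPull.ExpDecay A B πA πB →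
      ∃ C₁ C₂ : ℝ,
      ∀ {d : ℕ} {S : Fin n → Type*} {Ω : Type*} [mΩ : MeasurableSpace Ω]
        (μ : Measure Ω) [IsProbabilityMeasure μ] (ℱ : Filtration ℕ mΩ)
        (f : Fin n → EuclideanSpace ℝ (Fin d) → ℝ)
        (G : (i : Fin n) → EuclideanSpace ℝ (Fin d) → S i → EuclideanSpace ℝ (Fin d))
        (ξ : ℕ → (i : Fin n) → Ω → S i)
        (x0 : EuclideanSpace ℝ (Fin d)) (σ L Δ α : ℝ),
        0 ≤ σ → 0 < L → 0 < Δ → 0 < α →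
        PushPull.Smooth f x0 L Δ →
        PushPull.GradientOracle μ ℱ f
          (PushPull.xNode A B α G x0 ξ) (PushPull.gNode A B α G x0 ξ) σ →
        let gradSq : ℕ → Ω → ℝ := fun t ω =>
          ‖gradient (PushPull.avgFun f) (PushPull.xHat A B πA α G x0 ξ t ω)‖ ^ 2
        let c : ℝ := PushPull.cConst πA πB
        let sA : ℝ := PushPull.mixSum A (PushPull.rowLimit πA)
        let sB : ℝ := PushPull.mixSum B (PushPull.colLimit πB)
        -- all the expectations below are finite
        (∀ t, Integrable (gradSq t) μ) ∧
        ∀ m K : ℕ, 0 < m → 0 < K →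
          let T : ℝ := (m : ℝ) * (K : ℝ)
          let sAm : ℝ := PushPull.mixSum (A ^ m) (PushPull.rowLimit πA)
          let sBm : ℝ := PushPull.mixSum (B ^ m) (PushPull.colLimit πB)
          let Cm : ℝ := PushPull.blockThreshold n c sA sAm sB sBm
          let CΔ : ℝ := PushPull.deltaConst n c sA sAm sB sBm
          -- the bound on the average over block starts
          (α ≤ 1 / (10 * c * m * Real.sqrt (sB * sBm ^ 2) * L) → Cm ≤ m →
            (1 / (K : ℝ)) * ∑ k ∈ Finset.range K, ∫ ω, gradSq (m * k) ω ∂μ ≤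
              4 * Δ / (c * α * T) + 100 * c * α * L / n * σ ^ 2
                + 384 * sB ^ 3 * sBm ^ 2 / ((m : ℝ) ^ 2 * c ^ 2) * σ ^ 2
                + CΔ * (L * Δ) / (m * T)) ∧
          -- the explicit rate for the tuned parameters
          (PushPull.tunedBlock n c sA sAm sB sBm σ L Δ T ≤ m →
            α = PushPull.tunedStep n c sB sBm σ L Δ T m →
            ∃ t < m * K, ∫ ω, gradSq t ω ∂μ ≤
              44 * σ * Real.sqrt (L * Δ) / Real.sqrt (n * T)
                + L * Δ * (CΔ / m + 40 * m * Real.sqrt (sB * sBm ^ 2) + 24 / c) / T) ∧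
          -- the asymptotic form of the rate, with constants depending on the matrices only
          (PushPull.tunedBlock n c sA sAm sB sBm σ L Δ T ≤ m →
            m ≤ ⌈PushPull.tunedBlock n c sA sA sB sB σ L Δ T⌉₊ →
            α = PushPull.tunedStep n c sB sBm σ L Δ T m →
            ∃ t < m * K, ∫ ω, gradSq t ω ∂μ ≤
              44 * σ * Real.sqrt (L * Δ) / Real.sqrt (n * T)
                + C₁ * Real.sqrt σ * (L * Δ / T) ^ (3 / 4 : ℝ)
                + C₂ * (L * Δ / T))) := by
  refine ⟨fun A B hA hB iA iB tA tB => PushPull.exists_expDecay hA hB iA iB tA tB,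
    fun A B πA πB hE => ?_⟩
  refine ⟨160 * Real.sqrt (PushPull.mixSum B (PushPull.colLimit πB)
        * PushPull.mixSum B (PushPull.colLimit πB) ^ 2) * (PushPull.cConst πA πB)⁻¹
        * PushPull.mixSum B (PushPull.colLimit πB) ^ (3 / 2 : ℝ)
        * PushPull.mixSum B (PushPull.colLimit πB) * (n : ℝ) ^ (1 / 4 : ℝ),
    PushPull.deltaConst n (PushPull.cConst πA πB) (PushPull.mixSum A (PushPull.rowLimit πA))
        (PushPull.mixSum A (PushPull.rowLimit πA)) (PushPull.mixSum B (PushPull.colLimit πB))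
        (PushPull.mixSum B (PushPull.colLimit πB))
      + 40 * Real.sqrt (PushPull.mixSum B (PushPull.colLimit πB)
          * PushPull.mixSum B (PushPull.colLimit πB) ^ 2)
        * (PushPull.blockThreshold n (PushPull.cConst πA πB)
          (PushPull.mixSum A (PushPull.rowLimit πA)) (PushPull.mixSum A (PushPull.rowLimit πA))
          (PushPull.mixSum B (PushPull.colLimit πB))
          (PushPull.mixSum B (PushPull.colLimit πB)) + 1)
      + 24 / PushPull.cConst πA πB, ?_⟩
  intro d S Ω mΩ μ _ ℱ f G ξ x0 σ L Δ α hσ hL hΔ hα Sm O gradSq c sA sB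
  have hn0 : 0 < n := by omega
  have R := PushPull.recursion_iter A B α G x0 ξ
  have hw := R.memLp_weighted Sm O πA
  have hGr := fun t => Sm.memLp_gradient_avgFun (hw t)
  have hint : ∀ t, Integrable (gradSq t) μ := fun t =>
    (memLp_two_iff_integrable_sq_norm (hGr t).aestronglyMeasurable).mp (hGr t)
  refine ⟨hint, fun m K hm hK => ?_⟩
  intro T sAm sBm Cm CΔ
  have hm' : (0 : ℝ) < m := Nat.cast_pos.mpr hm
  have hK' : (0 : ℝ) < K := Nat.cast_pos.mpr hK
  have hT : 0 < T := mul_pos hm' hK'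
  have hc : 0 < c := hE.cConst_pos hn
  have hsAm : 1 ≤ sAm := hE.one_le_mixSum_A hn hm
  have hsBm : 1 ≤ sBm := hE.one_le_mixSum_B hn hm
  have hA : sAm ≤ sA := hE.decay_A.mixSum_pow_le hm
  have hB : sBm ≤ sB := hE.decay_B.mixSum_pow_le hm
  have hsA : 1 ≤ sA := hsAm.trans hA
  have hsB : 1 ≤ sB := hsBm.trans hB
  have havg : α ≤ 1 / (10 * c * m * Real.sqrt (sB * sBm ^ 2) * L) → Cm ≤ m →
      (1 / (K : ℝ)) * ∑ k ∈ Finset.range K, ∫ ω, gradSq (m * k) ω ∂μ ≤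
        5 / 2 * Δ / (c * α * T) + 100 * c * α * L / n * σ ^ 2
          + 144 * sB * σ ^ 2 / ((m : ℝ) ^ 2 * c ^ 2) + CΔ * (L * Δ) / (m * T) := by
    intro hstep hC
    have h := (R.system hn0 hE.sum_A hL Sm O).average_gradient_sq_le hn hE hσ hα hL hΔ hm hK
      hstep hC
    simp only [PushPull.norm_toL2_sq (hGr _)] at h
    exact h
  have htuned : PushPull.tunedBlock n c sA sAm sB sBm σ L Δ T ≤ m →
      α = PushPull.tunedStep n c sB sBm σ L Δ T m →
      ∃ t < m * K, ∫ ω, gradSq t ω ∂μ ≤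
        44 * σ * Real.sqrt (L * Δ) / Real.sqrt (n * T)
          + L * Δ * (CΔ / m + 40 * m * Real.sqrt (sB * sBm ^ 2) + 24 / c) / T := by
    intro hM hstep
    have h1 := havg (hstep.le.trans PushPull.tunedStep_le) ((le_max_right _ _).trans hM)
    have h2 := PushPull.tuned_terms_le hn0 hc hsB hsBm hσ hL hΔ hT hm hα hstep
      ((le_max_left _ _).trans hM)
    have h3 : L * Δ * (25 * m * Real.sqrt (sB * sBm ^ 2) + 15 / c) / T
        ≤ L * Δ * (40 * m * Real.sqrt (sB * sBm ^ 2) + 24 / c) / T := by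
      gcongr <;> norm_num
    have h4 : L * Δ * (CΔ / m + 40 * m * Real.sqrt (sB * sBm ^ 2) + 24 / c) / T
        = CΔ * (L * Δ) / (m * T)
          + L * Δ * (40 * m * Real.sqrt (sB * sBm ^ 2) + 24 / c) / T := by
      field_simp
      ring
    have h5 : (1 / (K : ℝ)) * ∑ k ∈ Finset.range K, ∫ ω, gradSq (m * k) ω ∂μ
        ≤ 44 * σ * Real.sqrt (L * Δ) / Real.sqrt (n * T)
          + L * Δ * (CΔ / m + 40 * m * Real.sqrt (sB * sBm ^ 2) + 24 / c) / T := by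
      linarith
    -- some block start does at least as well as the average over the block starts
    rw [one_div, inv_mul_le_iff₀ hK'] at h5
    obtain ⟨k, hk, hle⟩ := Finset.exists_le_of_sum_le (s := Finset.range K)
      (Finset.nonempty_range_iff.mpr hK.ne')
      (h5.trans_eq (by rw [Finset.sum_const, Finset.card_range, nsmul_eq_mul]))
    exact ⟨m * k, Nat.mul_lt_mul_of_pos_left (Finset.mem_range.mp hk) hm, hle⟩
  refine ⟨fun hstep hC => (havg hstep hC).trans ?_, htuned, fun hM hM' hstep => ?_⟩
  · have h := PushPull.fixed_step_terms_le (T := T) hc hΔ hα hT hm hsB hsBm (σ := σ)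
    linarith
  · obtain ⟨t, ht, hle⟩ := htuned hM hstep
    refine ⟨t, ht, hle.trans ?_⟩
    exact (add_le_add_right
      (PushPull.tuned_rate_le hc hsA hsAm hsB hsBm hA hB hσ hL hΔ hT hm hM') _).trans_eq
      (add_assoc _ _ _).symm
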